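/- Identify $\mathbb{S}^1=\mathbb{R}/\mathbb{Z}$. Let $G\subset \mathsf{Homeo}_+(\mathbb{S}^1)$ be a free group of finite rank at least $2$, marked by a free symmetric generating system $S$ (that is, $S=S_0\sqcup S_0^{-1}$ with $S_0$ a finite free basis of $G$). A \emph{ping-pong partition} for $(G,S)$ is a finite collection $\Theta=\{V_s\}_{s\in S}\cup\{U_k\}_{k\in K}$ ($K$ finite, possibly empty) of pairwise disjoint open subsets of $\mathbb{S}^1$, called atoms, with every $V_s$ non-empty (the $U_k$ may be empty), such that: (1) for every $s\in S$ and every atom $O$ of $\Theta$ other than $V_{s^{-1}}$, one has $s(O)\subset V_s$; (2) every atom has finitely many connected components; (3) let $\mathcal{I}$ be the set of connected components of the atoms, and let $\mathcal{J}$ be the set of gaps, i.e. of connected components of $\mathbb{S}^1\setminus\bigcup_{I\in\mathcal{I}}I$; then for every $s\in S$ and $I\in\mathcal{I}$, either $s(I)$ is contained in an atom, or $s(I)=I_0\cup\dots\cup I_m\cup J_1\cup\dots\cup J_m$ for some $m\ge 1$, distinct $I_0,\dots,I_m\in\mathcal{I}$ and distinct $J_1,\dots,J_m\in\mathcal{J}$.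 It is \emph{proper} if, in the case where $S=\{s,s^{-1}\}$ and all $U_k$ are empty, there is $p\in\mathbb{S}^1\setminus(V_s\cup V_{s^{-1}})$ with $s(p)\in V_s$ and $s^{-1}(p)\in V_{s^{-1}}$ (for rank at least $2$ every ping-pong partition is thus proper). Two representations $\rho_1,\rho_2:G\to\mathsf{Homeo}_+(\mathbb{S}^1)$ are \emph{semi-conjugate} if there are a central extension $1\to\mathbb{Z}\to\widehat{G}\to G\to1$, homomorphisms $\widehat\rho_1,\widehat\rho_2$ from $\widehat G$ to the group of increasing homeomorphisms of $\mathbb{R}$ commuting with integer translations, such that $\widehat\rho_\nu(\widehat g)$ is a lift of $\rho_\nu(g)$ whenever $\widehat g\in\widehat G$ projects to $g$, and such that the generator $1$ of $\mathbb{Z}$ acts as $x\mapsto x+1$ under both, and a monotone non-decreasing map $h:\mathbb{R}\to\mathbb{R}$ commuting with integer translations with $h\,\widehat\rho_1(\widehat g)=\widehat\rho_2(\widehat g)\,h$ for all $\widehat g\in\widehat G$. \textbf{Theorem.} If $(G,S)$ as above (finitely generated, free of rank at least $2$) admits a proper ping-pong partition, then $G$ is semi-conjugate to a subgroup of $\mathsf{Diff}^\omega_+(\mathbb{S}^1)$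 whose action is minimal. That is, there are a subgroup $G'$ of the group $\mathsf{Diff}^\omega_+(\mathbb{S}^1)$ of orientation-preserving real-analytic diffeomorphisms, every orbit of which is dense in $\mathbb{S}^1$, and an isomorphism $\phi:G\to G'$, such that the inclusion $G\hookrightarrow\mathsf{Homeo}_+(\mathbb{S}^1)$ and $\phi$ are semi-conjugate. -/

import Mathlib

/-! ### Circle homeomorphisms, lifts, real-analytic diffeomorphisms

The circle is `UnitAddCircle = ℝ / ℤ`.  A unit of Mathlib's monoid `CircleDeg1Lift` (monotone maps
`ℝ → ℝ` commuting with `x ↦ x + 1`) is exactly an increasing homeomorphism of the line commuting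
with the integer translations. -/

/-- `F` is a lift to the real line of the circle homeomorphism `f`. -/
def IsLift (F : CircleDeg1Liftˣ) (f : UnitAddCircle ≃ₜ UnitAddCircle) : Prop :=
  ∀ x : ℝ, f (x : UnitAddCircle) = ((F x : ℝ) : UnitAddCircle)

theorem IsLift.one : IsLift 1 1 := fun _ => rfl

theorem IsLift.mul {F F' : CircleDeg1Liftˣ} {f f' : UnitAddCircle ≃ₜ UnitAddCircle}
    (h : IsLift F f) (h' : IsLift F' f') : IsLift (F * F') (f * f') := by
  intro x
  have h1 : (f * f') (x : UnitAddCircle) = f (f' x) := rfl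
  have h2 : (F * F') x = F (F' x) := rfl
  rw [h1, h2, h' x, h (F' x)]

theorem IsLift.inv {F : CircleDeg1Liftˣ} {f : UnitAddCircle ≃ₜ UnitAddCircle}
    (h : IsLift F f) : IsLift F⁻¹ f⁻¹ := by
  intro x
  have h1 := h (F⁻¹ x)
  rw [CircleDeg1Lift.units_apply_inv_apply] at h1
  rw [← h1]
  exact f.symm_apply_apply _

/-- `Homeo₊(S¹)`: the group of orientation-preserving homeomorphisms of the circle, that is, of
those that lift to an increasing homeomorphism of the line commuting with integer translations. -/
def HomeoPlus : Subgroup (UnitAddCircle ≃ₜ UnitAddCircle) where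
  carrier := {f | ∃ F : CircleDeg1Liftˣ, IsLift F f}
  one_mem' := ⟨1, IsLift.one⟩
  mul_mem' := fun ⟨_, hF⟩ ⟨_, hF'⟩ => ⟨_, hF.mul hF'⟩
  inv_mem' := fun ⟨_, hF⟩ => ⟨_, hF.inv⟩

/-- `Diff^ω₊(S¹)`: the group of orientation-preserving real-analytic diffeomorphisms of the
circle (real-analytic together with the inverse; read on a lift to the line). -/
def DiffOmegaPlus : Subgroup (UnitAddCircle ≃ₜ UnitAddCircle) where
  carrier := {f | ∃ F : CircleDeg1Liftˣ, IsLift F f ∧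
    AnalyticOnNhd ℝ (fun x : ℝ => F x) Set.univ ∧
    AnalyticOnNhd ℝ (fun x : ℝ => F⁻¹ x) Set.univ}
  one_mem' := ⟨1, IsLift.one, analyticOnNhd_id, analyticOnNhd_id⟩
  mul_mem' := fun ⟨F, hF, a, b⟩ ⟨F', hF', a', b'⟩ =>
    ⟨F * F', hF.mul hF', a.comp a' (Set.mapsTo_univ _ _), by
      rw [mul_inv_rev]
      exact b'.comp b (Set.mapsTo_univ _ _)⟩
  inv_mem' := fun ⟨F, hF, a, b⟩ => ⟨F⁻¹, hF.inv, b, by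
      rw [inv_inv]
      exact a⟩

/-- The action of a group of circle homeomorphisms is minimal: every orbit is dense. -/
def ActsMinimally (G : Subgroup (UnitAddCircle ≃ₜ UnitAddCircle)) : Prop :=
  ∀ x : UnitAddCircle, Dense {y : UnitAddCircle | ∃ g ∈ G, g x = y}

/-! ### Semi-conjugacy -/

/-- Semi-conjugacy of two actions `ρ₁`, `ρ₂` of `G` on the circle: there are central lifts `R₁`,
`R₂` of `ρ₁`, `ρ₂`, defined on one central extension `1 → ℤ → Ĝ → G → 1` whose centre part,
generated by `z`, acts by the integer translations, and a monotone non-decreasing map `h` of the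
line, commuting with the integer translations, such that `h ∘ R₁ γ = R₂ γ ∘ h` for all `γ` in `Ĝ`.
-/
def SemiConjugate {G : Type} [Group G] (ρ₁ ρ₂ : G →* (UnitAddCircle ≃ₜ UnitAddCircle)) : Prop :=
  ∃ (Ghat : Type) (_ : Group Ghat) (π : Ghat →* G) (z : Ghat) (R₁ R₂ : Ghat →* CircleDeg1Liftˣ)
    (h : CircleDeg1Lift),
    Function.Surjective π ∧
    z ∈ Subgroup.center Ghat ∧
    π.ker = Subgroup.zpowers z ∧
    R₁ z = CircleDeg1Lift.translate (Multiplicative.ofAdd 1) ∧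
    R₂ z = CircleDeg1Lift.translate (Multiplicative.ofAdd 1) ∧
    (∀ γ : Ghat, IsLift (R₁ γ) (ρ₁ (π γ))) ∧
    (∀ γ : Ghat, IsLift (R₂ γ) (ρ₂ (π γ))) ∧
    ∀ (γ : Ghat) (x : ℝ), h (R₁ γ x) = R₂ γ (h x)

/-! ### Marked free groups and ping-pong partitions

A marking of a free group is a choice of a free symmetric generating system
`S = {b i, (b i)⁻¹ : i ∈ ι}`, where `b` is a free basis; the elements of `S` are indexed by
`ι × Bool`. -/

/-- The generator with index `s`: `b i` for `s = (i, true)`, and `(b i)⁻¹` for `s = (i, false)`. -/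
def symGen {G ι : Type*} [Group G] (b : FreeGroupBasis ι G) (s : ι × Bool) : G :=
  if s.2 then b s.1 else (b s.1)⁻¹

/-- The index of the inverse generator. -/
def sbar {ι : Type*} (s : ι × Bool) : ι × Bool := (s.1, !s.2)

/-- The set of connected components of a subset of the circle. -/
def components (O : Set UnitAddCircle) : Set (Set UnitAddCircle) :=
  {I | ∃ x ∈ O, I = connectedComponentIn O x}

/-- The gaps of a collection of intervals: the components of the complement of their union. -/
def gaps (ℐ : Set (Set UnitAddCircle)) : Set (Set UnitAddCircle) :=
  components (⋃₀ ℐ)ᶜ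

/-- A subset of the circle (the image of an interval of `ℐ`) is `ℐ`-Markovian if it is the union of
intervals `I₀, …, I_m` of `ℐ` and gaps `J₁, …, J_m` of `ℐ`, where `m ≥ 1`. -/
def IsMarkovian (ℐ : Set (Set UnitAddCircle)) (A : Set UnitAddCircle) : Prop :=
  ∃ (m : ℕ) (I : Fin (m + 1) → Set UnitAddCircle) (J : Fin m → Set UnitAddCircle),
    1 ≤ m ∧ Function.Injective I ∧ Function.Injective J ∧
    (∀ j, I j ∈ ℐ) ∧ (∀ j, J j ∈ gaps ℐ) ∧
    A = (⋃ j, I j) ∪ ⋃ j, J j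

/-- The atoms of a partition given by the sets `V s` (indexed by the generators) and the sets `U k`
(the atoms attached to the vertices). -/
def atoms {ι κ : Type*} (V : ι × Bool → Set UnitAddCircle) (U : κ → Set UnitAddCircle) :
    Set (Set UnitAddCircle) :=
  Set.range V ∪ Set.range U

/-- The collection of the connected components of the atoms. -/
def atomIntervals {ι κ : Type*} (V : ι × Bool → Set UnitAddCircle) (U : κ → Set UnitAddCircle) :
    Set (Set UnitAddCircle) :=
  ⋃ O ∈ atoms V U, components O

/-- Ping-pong partitions for the marked free group `(G, b)` of circle homeomorphisms.

For a free group all vertex groups and edge groups of the marking are trivial.  The atoms `V s` are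
indexed by the symmetric generating system, and the atoms `U k` by the oriented edges of the
quotient graph of the marking (the atom of the edge `e` being attached to the origin of `e`); as
the `U k` may be empty, `κ` is here an arbitrary finite index type.  The conditions on interactive
families that quantify over a difference `G_v \ α_e(A_e)`, or ask for invariance under an edge
group, are void for trivial groups, and so is the identity in the preferred generating system. -/
structure IsPingPongPartition {ι κ : Type*}
    {G : Subgroup (UnitAddCircle ≃ₜ UnitAddCircle)} (b : FreeGroupBasis ι G)
    (V : ι × Bool → Set UnitAddCircle) (U : κ → Set UnitAddCircle) : Prop where
  isOpen_V : ∀ s, IsOpen (V s)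
  isOpen_U : ∀ k, IsOpen (U k)
  nonempty_V : ∀ s, (V s).Nonempty
  disjoint_V : ∀ s t, s ≠ t → Disjoint (V s) (V t)
  disjoint_U : ∀ k l, k ≠ l → Disjoint (U k) (U l)
  disjoint_V_U : ∀ s k, Disjoint (V s) (U k)
  /-- `s (O) ⊆ V s` for all atoms `O` except `V (s⁻¹)`. -/
  image_V : ∀ s t, t ≠ sbar s → (symGen b s).1 '' V t ⊆ V s
  image_U : ∀ s k, (symGen b s).1 '' U k ⊆ V s
  /-- Every atom is a union of finitely many intervals. -/
  finite_components : ∀ O ∈ atoms V U, (components O).Finite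
  /-- The image of each interval of the partition under each generator is either contained in an
  atom or Markovian. -/
  markov : ∀ s, ∀ I ∈ atomIntervals V U,
    (∃ O ∈ atoms V U, (symGen b s).1 '' I ⊆ O) ∨
      IsMarkovian (atomIntervals V U) ((symGen b s).1 '' I)

/-- Proper ping-pong partitions.  For a free group, properness only concerns the case where the
generating system is `{s, s⁻¹}` and all the `U k` are empty: the requirements that edge groups act
faithfully and that images under differences of groups miss a point are void for trivial groups. -/
structure IsProperPingPongPartition {ι κ : Type*}
    {G : Subgroup (UnitAddCircle ≃ₜ UnitAddCircle)} (b : FreeGroupBasis ι G)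
    (V : ι × Bool → Set UnitAddCircle) (U : κ → Set UnitAddCircle) : Prop
    extends IsPingPongPartition b V U where
  proper : ∀ i : ι, (∀ j, j = i) → (∀ k, U k = ∅) →
    ∃ p : UnitAddCircle, p ∉ V (i, true) ∪ V (i, false) ∧
      (symGen b (i, true)).1 p ∈ V (i, true) ∧ (symGen b (i, false)).1 p ∈ V (i, false)

/-! Everything is lifted to the line, where the generators become increasing homeomorphisms
commuting with integer translations. Each point is labelled by the atom met last on its left. The
Markov condition is what lets the letters respect these labels, although atoms do not cover the
circle (`IsLabel.map`, `exists_weakLabelling`). Discarding surplus arcs makes the labelling exact: a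
letter `s` maps the complement of the arcs labelled `sbar s` onto the arcs labelled `s`
(`WeakLabelling.exists_partialCoding`). In rank at least two there are no finite orbits, so there is
a smallest nonempty closed invariant set. It is perfect and avoids the interior of the unlabelled
part. Giving every point the label of the last point before it that this set accumulates at from the
left yields a labelling without unlabelled arcs, at whose jumps every orbit accumulates
(`PartialCoding.exists_coding`).

Such a coding depends only on the values of the letters at finitely many boundary points modulo 1.
Other generators with these values have the same coding (`AgreeOnBd.coding`). They move the jumps in
a compatible order, whence a semi-conjugacy (`AgreeOnBd.exists_semiconj`). So it suffices to
interpolate these values by analytic diffeomorphisms whose action is minimal.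

Minimality comes from expansion: each arc should be expanded by the inverse of its label. A
necessary condition on the endpoints is that the arc gets longer. A conjugation achieves this, with
a length that counts the jumps of successive refinements of the coding (`Coding.exists_lengthen`).
Given the lengths, the analytic maps are found by integrating a density of prescribed signs and
integrals, supplied by Stone-Weierstrass and finite-dimensional convexity (`exists_entire_density`,
`exists_analytic_unit`).

Finally, a nonempty closed set invariant under the new action meets every arc, by the semi-conjugacy
(`meets_arc`). It contains all jumps, since a longest gap following a jump would be expanded to a
longer one (`Expanding.jumps_subset`). It is the whole line, since a point farthest from it would be
sent still farther away (`Expanding.eq_univ`). Faithfulness is the usual ping-pong argument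
(`Coding.injective_descend_lift`). -/

open Set Filter Topology

namespace PingPong

variable {ι : Type}

/-! ### Units of `CircleDeg1Lift` -/

theorem unit_lt_iff (F : CircleDeg1Liftˣ) {x y : ℝ} : F x < F y ↔ x < y :=
  (CircleDeg1Lift.toOrderIso F).lt_iff_lt

theorem unit_le_iff (F : CircleDeg1Liftˣ) {x y : ℝ} : F x ≤ F y ↔ x ≤ y :=
  (CircleDeg1Lift.toOrderIso F).le_iff_le

theorem unit_inj (F : CircleDeg1Liftˣ) {x y : ℝ} : F x = F y ↔ x = y :=
  (CircleDeg1Lift.toOrderIso F).injective.eq_iff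

theorem unit_continuous (F : CircleDeg1Liftˣ) : Continuous F :=
  (CircleDeg1Lift.toOrderIso F).continuous

theorem unit_inv_lt_iff (F : CircleDeg1Liftˣ) {x y : ℝ} : F⁻¹ x < y ↔ x < F y := by
  rw [← unit_lt_iff F, CircleDeg1Lift.units_apply_inv_apply]

theorem lt_unit_inv_iff (F : CircleDeg1Liftˣ) {x y : ℝ} : x < F⁻¹ y ↔ F x < y := by
  rw [← unit_lt_iff F, CircleDeg1Lift.units_apply_inv_apply]

theorem unit_inv_le_iff (F : CircleDeg1Liftˣ) {x y : ℝ} : F⁻¹ x ≤ y ↔ x ≤ F y := by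
  rw [← unit_le_iff F, CircleDeg1Lift.units_apply_inv_apply]

theorem le_unit_inv_iff (F : CircleDeg1Liftˣ) {x y : ℝ} : x ≤ F⁻¹ y ↔ F x ≤ y := by
  rw [← unit_le_iff F, CircleDeg1Lift.units_apply_inv_apply]

theorem unit_inv_eq_iff (F : CircleDeg1Liftˣ) {x y : ℝ} : F⁻¹ x = y ↔ x = F y := by
  rw [← unit_inj F, CircleDeg1Lift.units_apply_inv_apply]

theorem map_unit_nhdsLT (F : CircleDeg1Liftˣ) (x : ℝ) : map F (𝓝[<] x) = 𝓝[<] (F x) := by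
  have h := (CircleDeg1Lift.toOrderIso F).toHomeomorph.isEmbedding.map_nhdsWithin_eq (Iio x) x
  have h2 : (CircleDeg1Lift.toOrderIso F).toHomeomorph '' Iio x = Iio (F x) :=
    (CircleDeg1Lift.toOrderIso F).image_Iio x
  rw [h2] at h
  exact h

theorem map_unit_nhdsGT (F : CircleDeg1Liftˣ) (x : ℝ) : map F (𝓝[>] x) = 𝓝[>] (F x) := by
  have h := (CircleDeg1Lift.toOrderIso F).toHomeomorph.isEmbedding.map_nhdsWithin_eq (Ioi x) x
  have h2 : (CircleDeg1Lift.toOrderIso F).toHomeomorph '' Ioi x = Ioi (F x) :=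
    (CircleDeg1Lift.toOrderIso F).image_Ioi x
  rw [h2] at h
  exact h

theorem eventually_nhdsLT_unit (F : CircleDeg1Liftˣ) {x : ℝ} {p : ℝ → Prop} :
    (∀ᶠ y in 𝓝[<] (F x), p y) ↔ ∀ᶠ y in 𝓝[<] x, p (F y) := by
  rw [← map_unit_nhdsLT, eventually_map]

theorem eventually_nhdsGT_unit (F : CircleDeg1Liftˣ) {x : ℝ} {p : ℝ → Prop} :
    (∀ᶠ y in 𝓝[>] (F x), p y) ↔ ∀ᶠ y in 𝓝[>] x, p (F y) := by
  rw [← map_unit_nhdsGT, eventually_map]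

theorem unit_image_Ioc (F : CircleDeg1Liftˣ) (a b : ℝ) : F '' Ioc a b = Ioc (F a) (F b) :=
  (CircleDeg1Lift.toOrderIso F).image_Ioc a b

theorem unit_image_Ioo (F : CircleDeg1Liftˣ) (a b : ℝ) : F '' Ioo a b = Ioo (F a) (F b) :=
  (CircleDeg1Lift.toOrderIso F).image_Ioo a b

theorem translate_int_apply (n : ℤ) (x : ℝ) :
    CircleDeg1Lift.translate (Multiplicative.ofAdd (n : ℝ)) x = x + n := by
  rw [CircleDeg1Lift.translate_apply, add_comm]

/-- A continuous strictly monotone degree one map is a unit. -/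
theorem exists_unit_of_strictMono (g : ℝ → ℝ) (hc : Continuous g) (hm : StrictMono g)
    (h1 : ∀ x, g (x + 1) = g x + 1) : ∃ F : CircleDeg1Liftˣ, ∀ x, F x = g x := by
  let G : CircleDeg1Lift := ⟨⟨g, hm.monotone⟩, h1⟩
  have hsurj : Function.Surjective g := by
    apply hc.surjective
    · exact CircleDeg1Lift.tendsto_atTop G
    · exact CircleDeg1Lift.tendsto_atBot G
  obtain ⟨F, hF⟩ := (CircleDeg1Lift.isUnit_iff_bijective (f := G)).2 ⟨hm.injective, hsurj⟩
  exact ⟨F, fun x => by rw [hF]; rfl⟩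

/-! ### Passage between the line and the circle -/

theorem coe_eq_coe_iff {x y : ℝ} : (x : UnitAddCircle) = y ↔ ∃ n : ℤ, x = y + n := by
  rw [← sub_eq_zero, ← AddCircle.coe_sub, AddCircle.coe_eq_zero_iff]
  constructor
  · rintro ⟨n, hn⟩
    exact ⟨n, by simp at hn; linarith⟩
  · rintro ⟨n, hn⟩
    exact ⟨n, by simp; linarith⟩

theorem coe_add_int (x : ℝ) (n : ℤ) : ((x + n : ℝ) : UnitAddCircle) = x :=
  coe_eq_coe_iff.2 ⟨n, rfl⟩

theorem coe_surj (y : UnitAddCircle) : ∃ x : ℝ, (x : UnitAddCircle) = y :=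
  QuotientAddGroup.mk_surjective y

theorem isOpenMap_coe : IsOpenMap ((↑) : ℝ → UnitAddCircle) :=
  QuotientAddGroup.isOpenMap_coe

theorem continuous_coe : Continuous ((↑) : ℝ → UnitAddCircle) :=
  AddCircle.continuous_mk' 1

/-- The continuous map of the circle induced by a unit of `CircleDeg1Lift`. -/
def descendFun (F : CircleDeg1Liftˣ) : UnitAddCircle → UnitAddCircle :=
  Quotient.lift (fun x : ℝ => ((F x : ℝ) : UnitAddCircle)) (by
    intro x y h
    have h' : (x : UnitAddCircle) = y := Quotient.sound h
    obtain ⟨n, rfl⟩ := coe_eq_coe_iff.1 h'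
    simp only [CircleDeg1Lift.map_add_int]
    exact coe_add_int _ _)

theorem descendFun_coe (F : CircleDeg1Liftˣ) (x : ℝ) :
    descendFun F (x : UnitAddCircle) = ((F x : ℝ) : UnitAddCircle) := rfl

theorem continuous_descendFun (F : CircleDeg1Liftˣ) : Continuous (descendFun F) :=
  Continuous.quotient_lift (continuous_coe.comp (unit_continuous F)) _

/-- The circle homeomorphism induced by a unit of `CircleDeg1Lift`. -/
def descend : CircleDeg1Liftˣ →* (UnitAddCircle ≃ₜ UnitAddCircle) where
  toFun F :=
    { toFun := descendFun F
      invFun := descendFun F⁻¹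
      left_inv := by
        intro y
        obtain ⟨x, rfl⟩ := coe_surj y
        rw [descendFun_coe, descendFun_coe, CircleDeg1Lift.units_inv_apply_apply]
      right_inv := by
        intro y
        obtain ⟨x, rfl⟩ := coe_surj y
        rw [descendFun_coe, descendFun_coe, CircleDeg1Lift.units_apply_inv_apply]
      continuous_toFun := continuous_descendFun F
      continuous_invFun := continuous_descendFun F⁻¹ }
  map_one' := by
    ext y
    obtain ⟨x, rfl⟩ := coe_surj y
    rfl
  map_mul' F F' := by
    ext y
    obtain ⟨x, rfl⟩ := coe_surj y
    rfl

theorem isLift_descend (F : CircleDeg1Liftˣ) : IsLift F (descend F) := fun _ => rfl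

/-! ### Letters and words -/

theorem sbar_sbar (s : ι × Bool) : sbar (sbar s) = s := by simp [sbar]

theorem sbar_ne (s : ι × Bool) : sbar s ≠ s := by
  intro h
  have := congrArg Prod.snd h
  simp [sbar] at this

theorem eq_sbar_comm {s t : ι × Bool} : s = sbar t ↔ t = sbar s :=
  ⟨fun h => by rw [h, sbar_sbar], fun h => by rw [h, sbar_sbar]⟩

/-- The element attached to the letter `s`. -/
def letter (f : ι → CircleDeg1Liftˣ) (s : ι × Bool) : CircleDeg1Liftˣ :=
  bif s.2 then f s.1 else (f s.1)⁻¹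

theorem letter_sbar (f : ι → CircleDeg1Liftˣ) (s : ι × Bool) :
    letter f (sbar s) = (letter f s)⁻¹ := by
  obtain ⟨i, _ | _⟩ := s <;> simp [letter, sbar]

theorem letter_false (f : ι → CircleDeg1Liftˣ) (i : ι) : letter f (i, false) = (f i)⁻¹ := rfl

theorem letter_sbar_apply (f : ι → CircleDeg1Liftˣ) (s : ι × Bool) (x : ℝ) :
    letter f (sbar s) (letter f s x) = x := by
  rw [letter_sbar, CircleDeg1Lift.units_inv_apply_apply]

theorem letter_apply_sbar (f : ι → CircleDeg1Liftˣ) (s : ι × Bool) (x : ℝ) :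
    letter f s (letter f (sbar s) x) = x := by
  rw [letter_sbar, CircleDeg1Lift.units_apply_inv_apply]

theorem lift_mk_cons (f : ι → CircleDeg1Liftˣ) (s : ι × Bool) (L : List (ι × Bool)) :
    FreeGroup.lift f (FreeGroup.mk (s :: L)) = letter f s * FreeGroup.lift f (FreeGroup.mk L) := by
  simp [FreeGroup.lift_mk, letter]

theorem lift_mk_cons_apply (f : ι → CircleDeg1Liftˣ) (s : ι × Bool) (L : List (ι × Bool)) (x : ℝ) :
    FreeGroup.lift f (FreeGroup.mk (s :: L)) x =
      letter f s (FreeGroup.lift f (FreeGroup.mk L) x) := by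
  rw [lift_mk_cons]; rfl

theorem lift_mk_nil_apply (f : ι → CircleDeg1Liftˣ) (x : ℝ) :
    FreeGroup.lift f (FreeGroup.mk []) x = x := by
  simp [FreeGroup.lift_mk]

theorem lift_mk_concat_apply (f : ι → CircleDeg1Liftˣ) (L : List (ι × Bool)) (s : ι × Bool)
    (x : ℝ) : FreeGroup.lift f (FreeGroup.mk (L ++ [s])) x =
      FreeGroup.lift f (FreeGroup.mk L) (letter f s x) := by
  have : FreeGroup.lift f (FreeGroup.mk (L ++ [s])) =
      FreeGroup.lift f (FreeGroup.mk L) * letter f s := by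
    simp [FreeGroup.lift_mk, letter]
  rw [this]; rfl

theorem exists_reduced (γ : FreeGroup ι) :
    ∃ L : List (ι × Bool), FreeGroup.IsReduced L ∧ FreeGroup.mk L = γ := by
  classical
  exact ⟨γ.toWord, FreeGroup.isReduced_toWord, FreeGroup.mk_toWord⟩

theorem reduced_cons_cons {s t : ι × Bool} {L : List (ι × Bool)} :
    FreeGroup.IsReduced (s :: t :: L) ↔ s ≠ sbar t ∧ FreeGroup.IsReduced (t :: L) := by
  rw [FreeGroup.isReduced_cons_cons]
  refine and_congr_left fun _ => ?_
  obtain ⟨i, b⟩ := s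
  obtain ⟨j, c⟩ := t
  cases b <;> cases c <;> simp [sbar]

theorem reduced_tail {s : ι × Bool} {L : List (ι × Bool)} (h : FreeGroup.IsReduced (s :: L)) :
    FreeGroup.IsReduced L :=
  h.infix (List.suffix_cons s L).isInfix

/-- A set of reals that is invariant under all letters and all integer translations. -/
structure Invariant (f : ι → CircleDeg1Liftˣ) (M : Set ℝ) : Prop where
  letter_mem : ∀ s, ∀ x ∈ M, letter f s x ∈ M
  add_int_mem : ∀ n : ℤ, ∀ x ∈ M, x + n ∈ M

theorem Invariant.lift_mem {f : ι → CircleDeg1Liftˣ} {M : Set ℝ} (h : Invariant f M)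
    (γ : FreeGroup ι) {x : ℝ} (hx : x ∈ M) : FreeGroup.lift f γ x ∈ M := by
  obtain ⟨L, -, rfl⟩ := exists_reduced γ
  induction L with
  | nil => rwa [lift_mk_nil_apply]
  | cons s L ih => rw [lift_mk_cons_apply]; exact h.letter_mem s _ ih

theorem Invariant.letter_mem_iff {f : ι → CircleDeg1Liftˣ} {M : Set ℝ} (h : Invariant f M)
    (s : ι × Bool) {x : ℝ} : letter f s x ∈ M ↔ x ∈ M :=
  ⟨fun hx => by simpa [letter_sbar_apply] using h.letter_mem (sbar s) _ hx, h.letter_mem s x⟩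

theorem Invariant.add_int_mem_iff {f : ι → CircleDeg1Liftˣ} {M : Set ℝ} (h : Invariant f M)
    (n : ℤ) {x : ℝ} : x + n ∈ M ↔ x ∈ M :=
  ⟨fun hx => by simpa using h.add_int_mem (-n) _ hx, h.add_int_mem n x⟩

/-- The orbit of `x` under the lifted group, integer translations included. -/
def orb (f : ι → CircleDeg1Liftˣ) (x : ℝ) : Set ℝ :=
  {y | ∃ (γ : FreeGroup ι) (n : ℤ), y = FreeGroup.lift f γ x + n}

theorem mem_orb_self (f : ι → CircleDeg1Liftˣ) (x : ℝ) : x ∈ orb f x := ⟨1, 0, by simp⟩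

theorem invariant_orb (f : ι → CircleDeg1Liftˣ) (x : ℝ) : Invariant f (orb f x) where
  letter_mem := by
    rintro s _ ⟨γ, n, rfl⟩
    refine ⟨FreeGroup.mk [s] * γ, n, ?_⟩
    rw [map_mul, CircleDeg1Lift.map_add_int]
    simp [letter, FreeGroup.lift_mk]
  add_int_mem := by
    rintro m _ ⟨γ, n, rfl⟩
    exact ⟨γ, n + m, by push_cast; ring⟩

theorem Invariant.orb_subset {f : ι → CircleDeg1Liftˣ} {M : Set ℝ} (h : Invariant f M) {x : ℝ}
    (hx : x ∈ M) : orb f x ⊆ M := by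
  rintro _ ⟨γ, n, rfl⟩
  exact h.add_int_mem n _ (h.lift_mem γ hx)

theorem Invariant.closure {f : ι → CircleDeg1Liftˣ} {M : Set ℝ} (h : Invariant f M) :
    Invariant f (closure M) where
  letter_mem s x hx :=
    map_mem_closure (unit_continuous (letter f s)) hx fun y hy => h.letter_mem s y hy
  add_int_mem n x hx :=
    map_mem_closure (f := fun y : ℝ => y + n) (by fun_prop) hx fun y hy => h.add_int_mem n y hy

/-! ### Labelling the line by a finite family of open sets -/

section Labelling

variable {A : Type} (W : A → Set ℝ)

/-- The point `x` carries the label `a` if the last point of `⋃ a, W a` before `x` lies in `W a`. -/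
def IsLabel (x : ℝ) (a : A) : Prop :=
  ∃ p q : ℝ, p < q ∧ q ≤ x ∧ Ioo p q ⊆ W a ∧ ∀ y ∈ Ioo q x, ∀ c, y ∉ W c

variable {W}

/-- If two witnesses had different last points `q`, the later one would contribute points of the
union after the earlier one. -/
theorem IsLabel.unique (hd : ∀ a c, a ≠ c → Disjoint (W a) (W c)) {x : ℝ} {a c : A}
    (ha : IsLabel W x a) (hc : IsLabel W x c) : a = c := by
  obtain ⟨p, q, hpq, hqx, hW, hn⟩ := ha
  obtain ⟨p', q', hpq', hqx', hW', hn'⟩ := hc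
  rcases lt_trichotomy q q' with h | h | h
  · obtain ⟨y, hy1, hy2⟩ := exists_between (max_lt hpq' h)
    rw [max_lt_iff] at hy1
    exact absurd (hW' ⟨hy1.1, hy2⟩) (hn y ⟨hy1.2, hy2.trans_le hqx'⟩ c)
  · subst h
    obtain ⟨y, hy1, hy2⟩ := exists_between (max_lt hpq hpq')
    rw [max_lt_iff] at hy1
    by_contra hac
    exact (hd a c hac).notMem_of_mem_left (hW ⟨hy1.1, hy2⟩) (hW' ⟨hy1.2, hy2⟩)
  · obtain ⟨y, hy1, hy2⟩ := exists_between (max_lt hpq h)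
    rw [max_lt_iff] at hy1
    exact absurd (hW ⟨hy1.1, hy2⟩) (hn' y ⟨hy1.2, hy2.trans_le hqx⟩ a)

theorem IsLabel.add_one (hp : ∀ a x, x + 1 ∈ W a ↔ x ∈ W a) {x : ℝ} {a : A}
    (ha : IsLabel W x a) : IsLabel W (x + 1) a := by
  obtain ⟨p, q, hpq, hqx, hW, hn⟩ := ha
  refine ⟨p + 1, q + 1, by linarith, by linarith, fun y hy => ?_, fun y hy c => ?_⟩
  · have := (hp a (y - 1)).2 (hW ⟨by linarith [hy.1], by linarith [hy.2]⟩)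
    simpa using this
  · have := fun h => hn (y - 1) ⟨by linarith [hy.1], by linarith [hy.2]⟩ c ((hp c (y - 1)).1 h)
    simpa using this

/-- The last point is the supremum of the union below `x`. By `hl` and finiteness of `A`, a whole
left neighbourhood of it lies in one `W a`, instead of infinitely many small intervals accumulating
there. -/
theorem exists_isLabel [Finite A] (ho : ∀ a, IsOpen (W a))
    (hl : ∀ a x, (∀ᶠ y in 𝓝[<] x, y ∈ W a) ∨ ∀ᶠ y in 𝓝[<] x, y ∉ W a)
    (x : ℝ) (hne : ∃ a, ∃ y < x, y ∈ W a) : ∃ a, IsLabel W x a := by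
  set Z : Set ℝ := {y | y < x ∧ ∃ a, y ∈ W a} with hZ
  obtain ⟨a₀, y₀, hy₀, hya₀⟩ := hne
  have hZne : Z.Nonempty := ⟨y₀, hy₀, a₀, hya₀⟩
  have hZb : BddAbove Z := ⟨x, fun y hy => hy.1.le⟩
  set q := sSup Z with hq
  have hqx : q ≤ x := csSup_le hZne fun y hy => hy.1.le
  have hqZ : q ∉ Z := by
    rintro ⟨hqlt, a, ha⟩
    have h1 : ∀ᶠ y in 𝓝[>] q, y ∈ W a := nhdsWithin_le_nhds ((ho a).mem_nhds ha)
    have h2 : ∀ᶠ y in 𝓝[>] q, y < x := nhdsWithin_le_nhds (Iio_mem_nhds hqlt)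
    obtain ⟨y, ⟨hy1, hy2⟩, hy3⟩ := ((h1.and h2).and self_mem_nhdsWithin).exists
    exact absurd (le_csSup hZb ⟨hy2, a, hy1⟩) (not_le.2 hy3)
  have hfreq : ∃ a, ∀ᶠ y in 𝓝[<] q, y ∈ W a := by
    by_contra hcon
    rw [not_exists] at hcon
    have h1 : ∀ᶠ y in 𝓝[<] q, ∀ a, y ∉ W a :=
      eventually_all.2 fun a => (hl a q).resolve_left (hcon a)
    obtain ⟨p, hp, hpq⟩ := (mem_nhdsLT_iff_exists_Ioo_subset).1 h1
    obtain ⟨y, hyZ, hy⟩ := exists_lt_of_lt_csSup hZne (show p < sSup Z from hp)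
    have hyq : y < q := lt_of_le_of_ne (le_csSup hZb hyZ) fun h => hqZ (h ▸ hyZ)
    obtain ⟨_, a, ha⟩ := hyZ
    exact hpq ⟨hy, hyq⟩ a ha
  obtain ⟨a, ha⟩ := hfreq
  obtain ⟨p, hp, hpq⟩ := (mem_nhdsLT_iff_exists_Ioo_subset).1 ha
  refine ⟨a, p, q, hp, hqx, hpq, fun y hy c hc => ?_⟩
  exact absurd (le_csSup hZb ⟨hy.2, c, hc⟩) (not_le.2 hy.1)

theorem IsLabel.eventually_left {x : ℝ} {a : A} (ha : IsLabel W x a) :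
    ∀ᶠ y in 𝓝[<] x, IsLabel W y a := by
  obtain ⟨p, q, hpq, hqx, hW, hn⟩ := ha
  rcases hqx.eq_or_lt with rfl | h
  · filter_upwards [Ioo_mem_nhdsLT hpq] with y hy
    exact ⟨p, y, hy.1, le_rfl, fun z hz => hW ⟨hz.1, hz.2.trans hy.2⟩,
      fun z hz => absurd (hz.1.trans hz.2) (lt_irrefl _)⟩
  · filter_upwards [Ioo_mem_nhdsLT h] with y hy
    exact ⟨p, q, hpq, hy.1.le, hW, fun z hz => hn z ⟨hz.1, hz.2.trans hy.2⟩⟩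

theorem eventually_right_isLabel [Finite A] (ho : ∀ a, IsOpen (W a))
    (hr : ∀ a x, (∀ᶠ y in 𝓝[>] x, y ∈ W a) ∨ ∀ᶠ y in 𝓝[>] x, y ∉ W a)
    {x : ℝ} {c : A} (hc : IsLabel W x c) :
    ∃ a, ∀ᶠ y in 𝓝[>] x, IsLabel W y a := by
  by_cases h : ∃ a, ∀ᶠ y in 𝓝[>] x, y ∈ W a
  · obtain ⟨a, ha⟩ := h
    obtain ⟨u, hu, hxu⟩ := (mem_nhdsGT_iff_exists_Ioo_subset).1 ha
    refine ⟨a, ?_⟩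
    filter_upwards [Ioo_mem_nhdsGT hu] with y hy
    exact ⟨x, y, hy.1, le_rfl, fun z hz => hxu ⟨hz.1, hz.2.trans hy.2⟩,
      fun z hz => absurd (hz.1.trans hz.2) (lt_irrefl _)⟩
  · rw [not_exists] at h
    have h1 : ∀ᶠ y in 𝓝[>] x, ∀ a, y ∉ W a :=
      eventually_all.2 fun a => (hr a x).resolve_left (h a)
    obtain ⟨u, hu, hxu⟩ := (mem_nhdsGT_iff_exists_Ioo_subset).1 h1
    obtain ⟨p, q, hpq, hqx, hW, hn⟩ := hc
    refine ⟨c, ?_⟩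
    filter_upwards [Ioo_mem_nhdsGT hu] with y hy
    refine ⟨p, q, hpq, hqx.trans hy.1.le, hW, fun z hz a ha => ?_⟩
    rcases lt_trichotomy z x with hzx | rfl | hzx
    · exact hn z ⟨hz.1, hzx⟩ a ha
    · exact h a (nhdsWithin_le_nhds ((ho a).mem_nhds ha))
    · exact hxu ⟨hzx, hz.2.trans hy.2⟩ a ha

/-- If `F` maps `W a` into `W c`, and the preimages under `F` of the left ends of the intervals of
`⋃ a, W a` are followed by points of `⋃ a, W a`, then `F` maps the points with label `a` to points
with label `c`. -/
theorem IsLabel.map (ho : ∀ a, IsOpen (W a)) (hd : ∀ a c, a ≠ c → Disjoint (W a) (W c))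
    (F : CircleDeg1Liftˣ) {a c : A} (hF : ∀ x ∈ W a, F x ∈ W c)
    (hM : ∀ d e g, e < g → Ioo e g ⊆ W d → (∀ d', e ∉ W d') →
      ∀ᶠ y in 𝓝[>] (F⁻¹ e), ∃ d', y ∈ W d')
    {x : ℝ} (hx : IsLabel W x a) : IsLabel W (F x) c := by
  obtain ⟨p, q, hpq, hqx, hW, hn⟩ := hx
  have hpre : ∀ y ∈ Ioo (F p) (F q), y ∈ W c := by
    intro y hy
    have := hF (F⁻¹ y) (hW ⟨(lt_unit_inv_iff F).2 hy.1, (unit_inv_lt_iff F).2 hy.2⟩)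
    rwa [CircleDeg1Lift.units_apply_inv_apply] at this
  have hFpq : F p < F q := (unit_lt_iff F).2 hpq
  have hFqx : F q ≤ F x := (unit_le_iff F).2 hqx
  -- No new interval can start between `F q` and `F x`: by `hM` the preimage of its left end would
  -- be followed by points of the union, whereas there are none between `q` and `x`. So such a `w`
  -- still belongs to the interval through `F q`.
  have key : ∀ w ∈ Ioo (F q) (F x), ∀ d, w ∈ W d → Icc (F q) w ⊆ W c := by
    intro w hw d hwd
    have hsub : Icc (F q) w ⊆ W d := by
      by_contra hcon
      have hne : (Icc (F q) w ∩ (W d)ᶜ).Nonempty := by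
        obtain ⟨z, hz, hzd⟩ := not_subset.1 hcon
        exact ⟨z, hz, hzd⟩
      obtain ⟨e, ⟨⟨he1, he2⟩, hed⟩, hmax⟩ :=
        (isCompact_Icc.inter_right (ho d).isClosed_compl).exists_isGreatest hne
      have hew : e < w := lt_of_le_of_ne he2 fun h => hed (h ▸ hwd)
      have hIoo : Ioo e w ⊆ W d := by
        intro z hz
        by_contra hzd
        exact absurd (hmax ⟨⟨he1.trans hz.1.le, hz.2.le⟩, hzd⟩) (not_le.2 hz.1)
      have heall : ∀ d', e ∉ W d' := by
        intro d' hd'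
        have hne' : d ≠ d' := fun h => hed (h ▸ hd')
        have h1 : ∀ᶠ y in 𝓝[>] e, y ∈ W d' := nhdsWithin_le_nhds ((ho d').mem_nhds hd')
        obtain ⟨y, hy1, hy2⟩ := (h1.and (Ioo_mem_nhdsGT hew)).exists
        exact (hd d d' hne').notMem_of_mem_left (hIoo hy2) hy1
      have h1 := hM d e w hew hIoo heall
      have hlt : F⁻¹ e < x := (unit_inv_lt_iff F).2 (hew.trans hw.2)
      obtain ⟨y, ⟨d', hy1⟩, hy2⟩ := (h1.and (Ioo_mem_nhdsGT hlt)).exists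
      exact hn y ⟨((le_unit_inv_iff F).2 he1).trans_lt hy2.1, hy2.2⟩ d' hy1
    have hdc : d = c := by
      by_contra hdc
      have h1 : ∀ᶠ y in 𝓝[<] (F q), y ∈ W d :=
        nhdsWithin_le_nhds ((ho d).mem_nhds (hsub ⟨le_rfl, hw.1.le⟩))
      obtain ⟨y, hy1, hy2⟩ := (h1.and (Ioo_mem_nhdsLT hFpq)).exists
      exact (hd d c hdc).notMem_of_mem_left hy1 (hpre y hy2)
    exact hdc ▸ hsub
  -- The last point before `F x` is `sSup Z` when the interval containing `F q` goes on, and `F q`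
  -- otherwise.
  set Z : Set ℝ := {w | w ∈ Ioo (F q) (F x) ∧ ∃ d, w ∈ W d} with hZ
  by_cases hZne : Z.Nonempty
  · have hZb : BddAbove Z := ⟨F x, fun y hy => hy.1.2.le⟩
    have hqs : F q < sSup Z := by
      obtain ⟨w, hw⟩ := hZne
      exact hw.1.1.trans_le (le_csSup hZb hw)
    refine ⟨F p, sSup Z, hFpq.trans hqs, csSup_le hZne fun y hy => hy.1.2.le, ?_, ?_⟩
    · intro y hy
      rcases lt_or_ge y (F q) with h | h
      · exact hpre y ⟨hy.1, h⟩
      · obtain ⟨w, ⟨hw, d, hwd⟩, hyw⟩ := exists_lt_of_lt_csSup hZne hy.2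
        exact key w hw d hwd ⟨h, hyw.le⟩
    · intro y hy d hyd
      exact absurd (le_csSup hZb ⟨⟨hqs.trans hy.1, hy.2⟩, d, hyd⟩) (not_le.2 hy.1)
  · refine ⟨F p, F q, hFpq, hFqx, hpre, fun y hy d hyd => hZne ⟨y, hy, d, hyd⟩⟩

end Labelling

/-! ### Components of subsets of the circle -/

/-- A connected subset of the circle that misses two points meets only one of the two arcs. -/
theorem not_mem_of_isPreconnected {I : Set UnitAddCircle} (hI : IsPreconnected I) {z' z y₁ y₂ : ℝ}
    (hz' : (z' : UnitAddCircle) ∉ I) (hz : (z : UnitAddCircle) ∉ I)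
    (h1 : y₁ ∈ Ioo z' z) (h2 : y₂ ∈ Ioo z (z' + 1)) (hy₁ : (y₁ : UnitAddCircle) ∈ I) :
    (y₂ : UnitAddCircle) ∉ I := by
  intro hy₂
  have hcov : I ⊆ ((↑) '' Ioo z' z) ∪ ((↑) '' Ioo z (z' + 1) : Set UnitAddCircle) := by
    intro u hu
    have : u ∈ ((↑) : ℝ → UnitAddCircle) '' Ico z' (z' + 1) := by
      rw [AddCircle.coe_image_Ico_eq]; trivial
    obtain ⟨v, hv, rfl⟩ := this
    rcases lt_trichotomy v z with h | rfl | h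
    · left
      exact ⟨v, ⟨lt_of_le_of_ne hv.1 fun h => hz' (h ▸ hu), h⟩, rfl⟩
    · exact absurd hu hz
    · right
      exact ⟨v, ⟨h, hv.2⟩, rfl⟩
  obtain ⟨u, -, ⟨v, hv, rfl⟩, ⟨w, hw, hvw⟩⟩ := hI _ _ (isOpenMap_coe _ isOpen_Ioo)
    (isOpenMap_coe _ isOpen_Ioo) hcov ⟨_, hy₁, y₁, h1, rfl⟩ ⟨_, hy₂, y₂, h2, rfl⟩
  obtain ⟨n, hn⟩ := coe_eq_coe_iff.1 hvw
  have h3 : (0 : ℝ) < n := by linarith [hv.2, hw.1]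
  have h4 : (n : ℝ) < 1 := by linarith [hv.1, hw.2]
  have h5 : (0 : ℤ) < n := by exact_mod_cast h3
  have h6 : n < (1 : ℤ) := by exact_mod_cast h4
  lia

theorem exists_component_frequently {O : Set UnitAddCircle} (hfin : (components O).Finite)
    {l : Filter ℝ} (h : ∃ᶠ y : ℝ in l, (y : UnitAddCircle) ∈ O) :
    ∃ I ⊆ O, IsPreconnected I ∧ ∃ᶠ y : ℝ in l, (y : UnitAddCircle) ∈ I := by
  by_contra hcon
  push Not at hcon
  have h1 : ∀ᶠ y : ℝ in l, ∀ I ∈ components O, (y : UnitAddCircle) ∉ I := by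
    rw [eventually_all_finite hfin]
    rintro I ⟨x, hx, rfl⟩
    exact hcon _ (connectedComponentIn_subset O x) isPreconnected_connectedComponentIn
  refine h (h1.mono fun y hy hyO => ?_)
  exact hy _ ⟨y, hyO, rfl⟩ (mem_connectedComponentIn hyO)

/-- Otherwise one of the finitely many components is met arbitrarily close to `x`, and points
outside `O` alternate with its points: `z' < y₂ < z < y₁ < z' + 1`. A connected subset of the circle
cannot do this. -/
theorem eventually_right_mem_or {O : Set UnitAddCircle} (hfin : (components O).Finite) (x : ℝ) :
    (∀ᶠ y : ℝ in 𝓝[>] x, (y : UnitAddCircle) ∈ O) ∨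
      ∀ᶠ y : ℝ in 𝓝[>] x, (y : UnitAddCircle) ∉ O := by
  by_contra hcon
  push Not at hcon
  obtain ⟨hout, hin⟩ := hcon
  have hout' : ∃ᶠ y : ℝ in 𝓝[>] x, (y : UnitAddCircle) ∉ O := hout
  obtain ⟨I, hIsub, hI, hfr⟩ := exists_component_frequently hfin (not_eventually.1 hin |>.mono
    fun y hy => not_not.1 hy)
  obtain ⟨y₁, hy₁, hx1⟩ := (hfr.and_eventually (Ioo_mem_nhdsGT (lt_add_one x))).exists
  obtain ⟨z, hz, hx2⟩ := (hout'.and_eventually (Ioo_mem_nhdsGT hx1.1)).exists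
  obtain ⟨y₂, hy₂, hx3⟩ := (hfr.and_eventually (Ioo_mem_nhdsGT hx2.1)).exists
  obtain ⟨z', hz', hx4⟩ := (hout'.and_eventually (Ioo_mem_nhdsGT hx3.1)).exists
  exact not_mem_of_isPreconnected hI (fun h => hz' (hIsub h)) (fun h => hz (hIsub h))
    ⟨hx4.2, hx3.2⟩ ⟨hx2.2, by linarith [hx1.2, hx4.1]⟩ hy₂ hy₁

theorem eventually_left_mem_or {O : Set UnitAddCircle} (hfin : (components O).Finite) (x : ℝ) :
    (∀ᶠ y : ℝ in 𝓝[<] x, (y : UnitAddCircle) ∈ O) ∨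
      ∀ᶠ y : ℝ in 𝓝[<] x, (y : UnitAddCircle) ∉ O := by
  by_contra hcon
  push Not at hcon
  obtain ⟨hout, hin⟩ := hcon
  have hout' : ∃ᶠ y : ℝ in 𝓝[<] x, (y : UnitAddCircle) ∉ O := hout
  obtain ⟨I, hIsub, hI, hfr⟩ := exists_component_frequently hfin (not_eventually.1 hin |>.mono
    fun y hy => not_not.1 hy)
  obtain ⟨y₁, hy₁, hx1⟩ := (hfr.and_eventually (Ioo_mem_nhdsLT (sub_one_lt x))).exists
  obtain ⟨z, hz, hx2⟩ := (hout'.and_eventually (Ioo_mem_nhdsLT hx1.2)).exists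
  obtain ⟨y₂, hy₂, hx3⟩ := (hfr.and_eventually (Ioo_mem_nhdsLT hx2.2)).exists
  obtain ⟨z', hz', hx4⟩ := (hout'.and_eventually (Ioo_mem_nhdsLT hx3.2)).exists
  -- Here `z'` is the rightmost of the four points, so it is moved back by one turn to the left of
  -- `y₁`.
  have hz'' : ((z' - 1 : ℝ) : UnitAddCircle) ∉ I := by
    have : ((z' - 1 : ℝ) : UnitAddCircle) = z' := coe_eq_coe_iff.2 ⟨-1, by push_cast; ring⟩
    rw [this]
    exact fun h => hz' (hIsub h)
  exact not_mem_of_isPreconnected hI hz'' (fun h => hz (hIsub h))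
    ⟨by linarith [hx4.2, hx1.1], hx2.1⟩ ⟨hx3.1, by linarith [hx4.1]⟩ hy₁ hy₂

/-! ### The labelling attached to a ping-pong partition -/

section Partition

variable {κ : Type} {G : Subgroup (UnitAddCircle ≃ₜ UnitAddCircle)}
  {b : FreeGroupBasis ι G} {V : ι × Bool → Set UnitAddCircle} {U : κ → Set UnitAddCircle}

theorem isLift_letter {f : ι → CircleDeg1Liftˣ} (hf : ∀ i, IsLift (f i) (b i).1) (s : ι × Bool) :
    IsLift (letter f s) (symGen b s).1 := by
  obtain ⟨i, _ | _⟩ := s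
  · exact (hf i).inv
  · exact hf i

theorem sUnion_atomIntervals : ⋃₀ atomIntervals V U = ⋃₀ atoms V U := by
  ext x
  simp only [mem_sUnion, atomIntervals, mem_iUnion, exists_prop]
  constructor
  · rintro ⟨I, ⟨O, hO, y, hy, rfl⟩, hx⟩
    exact ⟨O, hO, connectedComponentIn_subset _ _ hx⟩
  · rintro ⟨O, hO, hx⟩
    exact ⟨_, ⟨O, hO, x, hx, rfl⟩, mem_connectedComponentIn hx⟩

theorem isOpen_atom (h : IsPingPongPartition b V U) {O : Set UnitAddCircle} (hO : O ∈ atoms V U) :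
    IsOpen O := by
  rcases hO with ⟨s, rfl⟩ | ⟨k, rfl⟩
  · exact h.isOpen_V s
  · exact h.isOpen_U k

theorem finite_atoms [Finite ι] [Finite κ] : (atoms V U).Finite :=
  (finite_range V).union (finite_range U)

/-- The Markov property: the image of an interval of the partition starts with a point of an
atom. -/
theorem eventually_mem_atom_of_markov [Finite ι] [Finite κ] (h : IsPingPongPartition b V U)
    {f : ι → CircleDeg1Liftˣ} (hf : ∀ i, IsLift (f i) (b i).1) (s : ι × Bool)
    {O : Set UnitAddCircle} (hO : O ∈ atoms V U) {e g : ℝ} (heg : e < g)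
    (hsub : ∀ y ∈ Ioo e g, (y : UnitAddCircle) ∈ O) (he : (e : UnitAddCircle) ∉ O) :
    ∀ᶠ y : ℝ in 𝓝[>] (letter f s e), (y : UnitAddCircle) ∈ ⋃₀ atoms V U := by
  set F := letter f s with hF
  have hFl := isLift_letter hf s
  obtain ⟨w, hw⟩ := exists_between heg
  set I := connectedComponentIn O (w : UnitAddCircle) with hI
  have hIsub : I ⊆ O := connectedComponentIn_subset _ _
  have hsubI : ∀ y ∈ Ioo e g, (y : UnitAddCircle) ∈ I := by
    have : ((↑) : ℝ → UnitAddCircle) '' Ioo e g ⊆ I := by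
      apply (isPreconnected_Ioo.image _ continuous_coe.continuousOn).subset_connectedComponentIn
      · exact ⟨w, hw, rfl⟩
      · rintro _ ⟨y, hy, rfl⟩
        exact hsub y hy
    exact fun y hy => this ⟨y, hy, rfl⟩
  have himg : ∀ y ∈ Ioo (F e) (F g), (y : UnitAddCircle) ∈ (symGen b s).1 '' I := by
    intro y hy
    refine ⟨(F⁻¹ y : ℝ), hsubI _ ⟨(lt_unit_inv_iff F).2 hy.1, (unit_inv_lt_iff F).2 hy.2⟩, ?_⟩
    rw [hFl, CircleDeg1Lift.units_apply_inv_apply]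
  have hFeg : F e < F g := (unit_lt_iff F).2 heg
  have hImem : I ∈ atomIntervals V U :=
    mem_biUnion hO ⟨w, hsub w hw, rfl⟩
  rcases h.markov s I hImem with ⟨O', hO', hsub'⟩ | ⟨m, Is, Js, -, -, -, hIs, hJs, heq⟩
  · filter_upwards [Ioo_mem_nhdsGT hFeg] with y hy
    exact ⟨O', hO', hsub' (himg y hy)⟩
  · by_contra hcon
    have hout : ∀ᶠ y : ℝ in 𝓝[>] (F e), ∀ O' ∈ atoms V U, (y : UnitAddCircle) ∉ O' := by
      rw [eventually_all_finite finite_atoms]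
      intro O' hO'
      refine (eventually_right_mem_or (h.finite_components O' hO') _).resolve_left fun hin => ?_
      exact hcon (hin.mono fun y hy => ⟨O', hO', hy⟩)
    obtain ⟨u, hu, hsubu⟩ := (mem_nhdsGT_iff_exists_Ioo_subset).1
      (hout.and (Ioo_mem_nhdsGT hFeg))
    have hFe : ∀ O' ∈ atoms V U, ((F e : ℝ) : UnitAddCircle) ∉ O' := by
      intro O' hO' hmem
      have : ∀ᶠ y : ℝ in 𝓝[>] (F e), (y : UnitAddCircle) ∈ O' :=
        nhdsWithin_le_nhds (continuous_coe.continuousAt.preimage_mem_nhds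
          ((isOpen_atom h hO').mem_nhds hmem))
      obtain ⟨y, hy1, hy2⟩ := (this.and hout).exists
      exact hy2 O' hO' hy1
    have hIco : ((↑) : ℝ → UnitAddCircle) '' Ico (F e) u ⊆ (⋃₀ atomIntervals V U)ᶜ := by
      rintro _ ⟨y, hy, rfl⟩
      rw [sUnion_atomIntervals]
      rintro ⟨O', hO', hmem⟩
      rcases hy.1.eq_or_lt with heq' | hlt
      · exact hFe O' hO' (heq' ▸ hmem)
      · exact (hsubu ⟨hlt, hy.2⟩).1 O' hO' hmem
    obtain ⟨v, hv⟩ := exists_between (show F e < u from hu)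
    have hvmem := himg v (hsubu hv).2
    rw [heq] at hvmem
    rcases hvmem with hvmem | hvmem
    · obtain ⟨j, hj⟩ := mem_iUnion.1 hvmem
      exact hIco ⟨v, ⟨hv.1.le, hv.2⟩, rfl⟩ ⟨Is j, hIs j, hj⟩
    · obtain ⟨j, hj⟩ := mem_iUnion.1 hvmem
      -- If no atom follows `F e`, the image starts inside one of the gaps that it contains
      -- entirely. That gap also contains `F e`, so `e` itself would lie in the interval, contrary
      -- to `he`.
      have hsubJ : ((↑) : ℝ → UnitAddCircle) '' Ico (F e) u ⊆ Js j := by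
        obtain ⟨x₀, -, hx₀⟩ := hJs j
        rw [hx₀] at hj ⊢
        rw [connectedComponentIn_eq hj]
        exact (isPreconnected_Ico.image _ continuous_coe.continuousOn).subset_connectedComponentIn
          ⟨v, ⟨hv.1.le, hv.2⟩, rfl⟩ hIco
      have hmem : ((F e : ℝ) : UnitAddCircle) ∈ (symGen b s).1 '' I := by
        rw [heq]
        exact Or.inr (mem_iUnion.2 ⟨j, hsubJ ⟨F e, ⟨le_rfl, hu⟩, rfl⟩⟩)
      obtain ⟨x, hx, hxe⟩ := hmem
      rw [← hFl e] at hxe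
      rw [(symGen b s).1.injective hxe] at hx
      exact he (hIsub hx)

/-- A labelling of the line by left-open arcs on which the letters play ping-pong. -/
structure WeakLabelling (f : ι → CircleDeg1Liftˣ) (Lab : ℝ → Option (ι × Bool)) : Prop where
  add_one : ∀ x, Lab (x + 1) = Lab x
  left : ∀ x, ∀ᶠ y in 𝓝[<] x, Lab y = Lab x
  right : ∀ x, ∃ c, ∀ᶠ y in 𝓝[>] x, Lab y = c
  act : ∀ s x, Lab x ≠ some (sbar s) → Lab (letter f s x) = some s

/-- The atoms `V s` keep their letter as label, while all the atoms `U k` become unlabelled: no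
letter treats any of them differently from another. -/
theorem exists_weakLabelling [Finite ι] [Nontrivial ι] [Finite κ] (h : IsPingPongPartition b V U)
    {f : ι → CircleDeg1Liftˣ} (hf : ∀ i, IsLift (f i) (b i).1) :
    ∃ Lab, WeakLabelling f Lab := by
  let W : (ι × Bool) ⊕ κ → Set ℝ := fun a => {x : ℝ | (x : UnitAddCircle) ∈ Sum.elim V U a}
  have hat : ∀ a, Sum.elim V U a ∈ atoms V U := by
    rintro (s | k)
    · exact Or.inl ⟨s, rfl⟩
    · exact Or.inr ⟨k, rfl⟩
  have hat' : ∀ O ∈ atoms V U, ∃ a, Sum.elim V U a = O := by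
    rintro O (⟨s, rfl⟩ | ⟨k, rfl⟩)
    · exact ⟨.inl s, rfl⟩
    · exact ⟨.inr k, rfl⟩
  have ho : ∀ a, IsOpen (W a) := fun a => (isOpen_atom h (hat a)).preimage continuous_coe
  have hd : ∀ a c, a ≠ c → Disjoint (W a) (W c) := by
    intro a c hac
    refine Disjoint.preimage _ ?_
    rcases a with s | k <;> rcases c with t | l
    · exact h.disjoint_V s t fun h => hac (h ▸ rfl)
    · exact h.disjoint_V_U s l
    · exact (h.disjoint_V_U t k).symm
    · exact h.disjoint_U k l fun h => hac (h ▸ rfl)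
  have hl : ∀ a x, (∀ᶠ y in 𝓝[<] x, y ∈ W a) ∨ ∀ᶠ y in 𝓝[<] x, y ∉ W a := fun a x =>
    eventually_left_mem_or (h.finite_components _ (hat a)) x
  have hr : ∀ a x, (∀ᶠ y in 𝓝[>] x, y ∈ W a) ∨ ∀ᶠ y in 𝓝[>] x, y ∉ W a := fun a x =>
    eventually_right_mem_or (h.finite_components _ (hat a)) x
  have hp : ∀ a x, x + 1 ∈ W a ↔ x ∈ W a := by
    intro a x
    have : ((x + 1 : ℝ) : UnitAddCircle) = x := coe_eq_coe_iff.2 ⟨1, by simp⟩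
    simp only [W, mem_ofPred_eq, this]
  have hp' : ∀ (n : ℕ) a x, x ∈ W a → x - n ∈ W a := by
    intro n
    induction n with
    | zero => simp
    | succ n ih =>
      intro a x hx
      rw [← hp]
      convert ih a x hx using 1
      push_cast
      ring
  have hex : ∀ x, ∃ a, IsLabel W x a := by
    intro x
    refine exists_isLabel ho hl x ?_
    obtain ⟨i, -⟩ := exists_pair_ne ι
    obtain ⟨z, hz⟩ := h.nonempty_V (i, true)
    obtain ⟨y, rfl⟩ := coe_surj z
    obtain ⟨n, hn⟩ := exists_nat_gt (y - x)
    exact ⟨.inl (i, true), y - n, by linarith, hp' n (.inl (i, true)) y hz⟩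
  choose lab hlab using hex
  have huniq : ∀ {x a}, IsLabel W x a → lab x = a := fun h => (hlab _).unique hd h
  refine ⟨fun x => Sum.elim some (fun _ => none) (lab x), ?_, ?_, ?_, ?_⟩
  · intro x
    rw [huniq ((hlab x).add_one hp)]
  · intro x
    filter_upwards [(hlab x).eventually_left] with y hy
    rw [huniq hy]
  · intro x
    obtain ⟨a, ha⟩ := eventually_right_isLabel ho hr (hlab x)
    refine ⟨Sum.elim some (fun _ => none) a, ?_⟩
    filter_upwards [ha] with y hy
    rw [huniq hy]
  · intro s x hx
    have : IsLabel W (letter f s x) (.inl s) := by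
      refine (hlab x).map ho hd (letter f s) ?_ ?_
      · intro y hy
        have h1 : (symGen b s).1 (y : UnitAddCircle) ∈ V s := by
          rcases hlx : lab x with t | k
          · rw [hlx] at hx hy
            exact h.image_V s t (fun h => hx (by rw [h]; rfl)) ⟨y, hy, rfl⟩
          · rw [hlx] at hy
            exact h.image_U s k ⟨y, hy, rfl⟩
        rwa [isLift_letter hf s] at h1
      -- The preimage of a left end under the letter is its image under the inverse letter, to which
      -- the Markov condition is applied.
      · intro d e g heg hsub he
        rw [← letter_sbar]
        filter_upwards [eventually_mem_atom_of_markov h hf (sbar s) (hat d) heg hsub (he d)]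
          with y ⟨O, hO, hy⟩
        obtain ⟨a, rfl⟩ := hat' O hO
        exact ⟨a, hy⟩
    rw [huniq this]
    rfl

end Partition

/-! ### Exact labellings -/

/-- A labelling of the line by left-open arcs for which every letter `s` maps the complement of the
arcs labelled `sbar s` exactly onto the arcs labelled `s`; some arcs may carry no label. -/
structure PartialCoding (f : ι → CircleDeg1Liftˣ) (Lab : ℝ → Option (ι × Bool)) : Prop where
  add_one : ∀ x, Lab (x + 1) = Lab x
  left : ∀ x, ∀ᶠ y in 𝓝[<] x, Lab y = Lab x
  right : ∀ x, ∃ c, ∀ᶠ y in 𝓝[>] x, Lab y = c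
  act : ∀ s x, Lab (letter f s x) = some s ↔ Lab x ≠ some (sbar s)

open Classical in
-- For every generator only the positive label is trimmed: it is kept exactly on the image under `f
-- i` of the complement of the arcs labelled `(i, false)`. The condition for the inverse letter then
-- also becomes an equivalence, since the trimmed points are precisely the missing ones.
theorem WeakLabelling.exists_partialCoding [Finite ι] {f : ι → CircleDeg1Liftˣ}
    {Lab : ℝ → Option (ι × Bool)} (h : WeakLabelling f Lab) : ∃ Lab', PartialCoding f Lab' := by
  let Lab' : ℝ → Option (ι × Bool) := fun x =>
    if ∃ i, Lab x = some (i, true) ∧ Lab (letter f (i, false) x) = some (i, false)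
    then none else Lab x
  have htrue : ∀ i x, Lab' x = some (i, true) ↔
      Lab x = some (i, true) ∧ Lab (letter f (i, false) x) ≠ some (i, false) := by
    intro i x
    simp only [Lab']
    split_ifs with hc
    · obtain ⟨j, hj1, hj2⟩ := hc
      simp only [false_iff, not_and, not_not]
      intro hi
      rw [hj1] at hi
      simp only [Option.some.injEq, Prod.mk.injEq, and_true] at hi
      exact hi ▸ hj2
    · constructor
      · exact fun hi => ⟨hi, fun h2 => hc ⟨i, hi, h2⟩⟩
      · exact fun hi => hi.1
  have hfalse : ∀ i x, Lab' x = some (i, false) ↔ Lab x = some (i, false) := by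
    intro i x
    simp only [Lab']
    split_ifs with hc
    · obtain ⟨j, hj1, hj2⟩ := hc
      rw [hj1]
      simp
    · rfl
  refine ⟨Lab', ?_, ?_, ?_, ?_⟩
  · intro x
    have h1 : ∀ i, Lab (letter f (i, false) (x + 1)) = Lab (letter f (i, false) x) := by
      intro i
      rw [CircleDeg1Lift.map_add_one, h.add_one]
    simp only [Lab', h1, h.add_one]
  · intro x
    have h1 : ∀ᶠ y in 𝓝[<] x, ∀ i, Lab (letter f (i, false) y) = Lab (letter f (i, false) x) :=
      eventually_all.2 fun i => (eventually_nhdsLT_unit _).1 (h.left _)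
    filter_upwards [h.left x, h1] with y hy1 hy2
    simp only [Lab', hy1, hy2]
  · intro x
    obtain ⟨c, hc⟩ := h.right x
    choose d hd using fun i => h.right (letter f (i, false) x)
    have h1 : ∀ᶠ y in 𝓝[>] x, ∀ i, Lab (letter f (i, false) y) = d i :=
      eventually_all.2 fun i => (eventually_nhdsGT_unit _).1 (hd i)
    refine ⟨if ∃ i, c = some (i, true) ∧ d i = some (i, false) then none else c, ?_⟩
    filter_upwards [hc, h1] with y hy1 hy2
    simp only [Lab', hy1, hy2]
  · rintro ⟨i, _ | _⟩ x
    · rw [hfalse]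
      change _ ↔ Lab' x ≠ some (i, true)
      rw [Ne, htrue, not_and_not_right]
      constructor
      · exact fun h1 _ => h1
      · intro h1
        by_cases h2 : Lab x = some (i, true)
        · exact h1 h2
        · exact h.act (i, false) x h2
    · rw [htrue]
      have hsb : sbar (i, true) = (i, false) := rfl
      rw [hsb, ne_eq (Lab' x), hfalse]
      have : letter f (i, false) (letter f (i, true) x) = x := letter_sbar_apply f (i, true) x
      rw [this]
      exact ⟨fun h1 => h1.2, fun h1 => ⟨h.act (i, true) x h1, h1⟩⟩

/-- A point outside the arcs labelled by the inverse of the last letter of a reduced word is mapped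
to an arc labelled by the first letter. -/
theorem PartialCoding.lab_lift {f : ι → CircleDeg1Liftˣ} {Lab : ℝ → Option (ι × Bool)}
    (h : PartialCoding f Lab) {x : ℝ} (hx : Lab x = none) (s : ι × Bool) (L : List (ι × Bool))
    (hL : FreeGroup.IsReduced (s :: L)) :
    Lab (FreeGroup.lift f (FreeGroup.mk (s :: L)) x) = some s := by
  induction L generalizing s with
  | nil =>
    rw [lift_mk_cons_apply, lift_mk_nil_apply, h.act, hx]
    simp
  | cons t L ih =>
    rw [lift_mk_cons_apply, h.act, ih t (reduced_tail hL)]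
    intro heq
    have h1 := (reduced_cons_cons.1 hL).1
    rw [Option.some.injEq] at heq
    exact h1 (by rw [heq, sbar_sbar])

theorem int_fract_mem {f : ι → CircleDeg1Liftˣ} {M : Set ℝ} (hM : Invariant f M) {x : ℝ}
    (hx : x ∈ M) : Int.fract x ∈ M := by
  have := hM.add_int_mem (-⌊x⌋) x hx
  rwa [Int.cast_neg, ← sub_eq_add_neg] at this

open Classical in
/-- There are no finite orbits. -/
theorem PartialCoding.infinite_of_invariant [Nontrivial ι] {f : ι → CircleDeg1Liftˣ}
    {Lab : ℝ → Option (ι × Bool)} (h : PartialCoding f Lab) {M : Set ℝ} (hM : Invariant f M)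
    (hne : M.Nonempty) : (M ∩ Ico 0 1).Infinite := by
  intro hfin
  have hper : Function.Periodic Lab 1 := h.add_one
  let labC : UnitAddCircle → Option (ι × Bool) := hper.lift
  have hlabC : ∀ x : ℝ, labC x = Lab x := fun x => hper.lift_coe x
  have hfinC : (((↑) : ℝ → UnitAddCircle) '' M).Finite := by
    refine (hfin.image ((↑) : ℝ → UnitAddCircle)).subset ?_
    rintro _ ⟨x, hx, rfl⟩
    refine ⟨Int.fract x, ⟨int_fract_mem hM hx, Int.fract_nonneg x, Int.fract_lt_one x⟩, ?_⟩
    exact AddCircle.coe_fract x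
  set T := hfinC.toFinset with hT
  have hTmem : ∀ x : ℝ, x ∈ M → (x : UnitAddCircle) ∈ T := by
    intro x hx
    rw [hT, Set.Finite.mem_toFinset]
    exact ⟨x, hx, rfl⟩
  have hTmem' : ∀ u ∈ T, ∃ x ∈ M, (x : UnitAddCircle) = u := by
    intro u hu
    rw [hT, Set.Finite.mem_toFinset] at hu
    exact hu
  -- On a finite invariant set `T`, the letter `s` is a bijection from the points not labelled `sbar
  -- s` to the points labelled `s`.
  have hcard : ∀ s : ι × Bool, (T.filter fun u => labC u = some s).card =
      (T.filter fun u => ¬ labC u = some (sbar s)).card := by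
    intro s
    rw [← Finset.card_image_of_injective (T.filter fun u => ¬ labC u = some (sbar s))
      (descend (letter f s)).injective]
    congr 1
    ext u
    simp only [Finset.mem_filter, Finset.mem_image]
    constructor
    · rintro ⟨hu, hl⟩
      obtain ⟨x, hx, rfl⟩ := hTmem' u hu
      refine ⟨((letter f (sbar s) x : ℝ) : UnitAddCircle), ⟨hTmem _ (hM.letter_mem _ _ hx), ?_⟩, ?_⟩
      · rw [hlabC, ← Ne, ← h.act, letter_apply_sbar, ← hlabC, hl]
      · rw [isLift_descend, letter_apply_sbar]
    · rintro ⟨v, ⟨hv, hl⟩, rfl⟩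
      obtain ⟨x, hx, rfl⟩ := hTmem' v hv
      rw [isLift_descend]
      refine ⟨hTmem _ (hM.letter_mem _ _ hx), ?_⟩
      rw [hlabC, h.act, ← hlabC]
      exact hl
  -- By counting, the two labels of any single generator already exhaust `T`; this cannot hold for
  -- two generators at once.
  have hall : ∀ i : ι, ∀ u ∈ T, labC u = some (i, true) ∨ labC u = some (i, false) := by
    intro i u hu
    have h1 := hcard (i, true)
    have h2 : (T.filter fun u => labC u = some (sbar (i, true))).card +
        (T.filter fun u => ¬ labC u = some (sbar (i, true))).card = T.card := by
      convert Finset.card_filter_add_card_filter_not (s := T) _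
    have h3 : Disjoint (T.filter fun u => labC u = some (i, true))
        (T.filter fun u => labC u = some (sbar (i, true))) := by
      rw [Finset.disjoint_filter]
      intro v _ hv1 hv2
      rw [hv1] at hv2
      simp [sbar] at hv2
    have h4 := Finset.card_union_of_disjoint h3
    have h5 : (T.filter fun u => labC u = some (i, true)) ∪
        (T.filter fun u => labC u = some (sbar (i, true))) = T := by
      apply Finset.eq_of_subset_of_card_le
      · exact Finset.union_subset (Finset.filter_subset _ _) (Finset.filter_subset _ _)
      · omega
    rw [← h5, Finset.mem_union, Finset.mem_filter, Finset.mem_filter] at hu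
    rcases hu with hu | hu
    · exact Or.inl hu.2
    · exact Or.inr hu.2
  obtain ⟨x, hx⟩ := hne
  obtain ⟨i, j, hij⟩ := exists_pair_ne ι
  rcases hall i _ (hTmem x hx) with h1 | h1 <;> rcases hall j _ (hTmem x hx) with h2 | h2 <;>
  · rw [h1] at h2
    simp [hij] at h2

/-! ### The limit set -/

theorem finite_of_separated {S : Set ℝ} {δ : ℝ} (hδ : 0 < δ) (hS : S ⊆ Ico 0 1)
    (hsep : ∀ x ∈ S, ∀ y ∈ S, x < y → δ ≤ y - x) : S.Finite := by
  refine Set.Finite.of_injOn (f := fun x : ℝ => ⌊x / δ⌋) (t := Icc 0 ⌊1 / δ⌋) ?_ ?_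
    (Set.finite_Icc _ _)
  · intro x hx
    refine ⟨Int.floor_nonneg.2 (div_nonneg (hS hx).1 hδ.le), Int.floor_mono ?_⟩
    exact div_le_div_of_nonneg_right (hS hx).2.le hδ.le
  · have key : ∀ x ∈ S, ∀ y ∈ S, x < y → ⌊x / δ⌋ ≠ ⌊y / δ⌋ := by
      intro x hx y hy hxy heq
      have h1 := hsep x hx y hy hxy
      have h2 := Int.abs_sub_lt_one_of_floor_eq_floor heq
      rw [abs_lt, ← sub_div, lt_div_iff₀ hδ] at h2
      linarith [h2.1]
    intro x hx y hy hxy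
    rcases lt_trichotomy x y with h | h | h
    · exact absurd hxy (key x hx y hy h)
    · exact h
    · exact absurd hxy.symm (key y hy x hx h)

/-- Modulo 1 the first set is compact, so the two sets are at positive distance. -/
theorem exists_pos_le_abs_sub {f : ι → CircleDeg1Liftˣ} {M₁ M₂ : Set ℝ} (hM₁ : Invariant f M₁)
    (hM₂ : Invariant f M₂) (hc₁ : IsClosed M₁) (hc₂ : IsClosed M₂) (hd : Disjoint M₁ M₂) :
    ∃ δ > 0, ∀ x ∈ M₁, ∀ y ∈ M₂, δ ≤ |x - y| := by
  obtain ⟨δ, hδ, hthick⟩ := (hd.mono_left inter_subset_left).exists_thickenings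
    (isCompact_Icc.inter_left hc₁ : IsCompact (M₁ ∩ Icc 0 1)) hc₂
  refine ⟨δ, hδ, fun x hx y hy => ?_⟩
  by_contra hlt
  push Not at hlt
  have hx' : Int.fract x ∈ M₁ ∩ Icc (0 : ℝ) 1 :=
    ⟨int_fract_mem hM₁ hx, Int.fract_nonneg x, (Int.fract_lt_one x).le⟩
  have hy' : y - ⌊x⌋ ∈ M₂ := by
    have := hM₂.add_int_mem (-⌊x⌋) y hy
    rwa [Int.cast_neg, ← sub_eq_add_neg] at this
  refine hthick.notMem_of_mem_left (a := Int.fract x) (Metric.self_subset_thickening hδ _ hx') ?_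
  rw [Metric.mem_thickening_iff]
  refine ⟨_, hy', ?_⟩
  rw [Real.dist_eq, Int.fract]
  rwa [sub_sub_sub_cancel_right]

/-- Two nonempty closed invariant sets meet. -/
theorem PartialCoding.inter_nonempty [Nontrivial ι] {f : ι → CircleDeg1Liftˣ}
    {Lab : ℝ → Option (ι × Bool)} (h : PartialCoding f Lab) {M₁ M₂ : Set ℝ}
    (hM₁ : Invariant f M₁) (hM₂ : Invariant f M₂) (hc₁ : IsClosed M₁) (hc₂ : IsClosed M₂)
    (hn₁ : M₁.Nonempty) (hn₂ : M₂.Nonempty) : (M₁ ∩ M₂).Nonempty := by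
  by_contra hcon
  rw [not_nonempty_iff_eq_empty, ← disjoint_iff_inter_eq_empty] at hcon
  obtain ⟨δ, hδ, hsep⟩ := exists_pos_le_abs_sub hM₁ hM₂ hc₁ hc₂ hcon
  obtain ⟨y, hy⟩ := hn₂
  obtain ⟨x, hx⟩ := hn₁
  have hne : (M₁ ∩ Iic y).Nonempty := by
    refine ⟨x + (-⌈x - y⌉ : ℤ), hM₁.add_int_mem _ x hx, ?_⟩
    push_cast
    have := Int.le_ceil (x - y)
    rw [mem_Iic]
    linarith
  have hb : BddAbove (M₁ ∩ Iic y) := ⟨y, fun z hz => hz.2⟩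
  obtain ⟨hl, hly⟩ := (hc₁.inter isClosed_Iic).csSup_mem hne hb
  -- A gap of `M₁` starts at `l` and contains the point `y` of `M₂`. Its translates under the group
  -- all have length at least `δ`, so the orbit of `l` is finite modulo 1.
  set l := sSup (M₁ ∩ Iic y) with hl_def
  have hgap : ∀ z, l < z → z ≤ y → z ∉ M₁ := fun z hz hzy hzM =>
    absurd (le_csSup hb ⟨hzM, hzy⟩) (not_le.2 hz)
  have hsepl : ∀ u ∈ orb f l, ∀ v ∈ orb f l, u < v → δ ≤ v - u := by
    rintro u ⟨γ, n, rfl⟩ v hv huv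
    set F := FreeGroup.lift f γ
    have hvM : v ∈ M₁ := hM₁.orb_subset hl hv
    have h1 := hsep (F l + n) (hM₁.add_int_mem n _ (hM₁.lift_mem γ hl)) (F y + n)
      (hM₂.add_int_mem n _ (hM₂.lift_mem γ hy))
    have hFl : F l ≤ F y := (unit_le_iff F).2 hly
    rw [abs_sub_comm, abs_of_nonneg (by linarith)] at h1
    have h2 : F y + n < v := by
      by_contra hle
      push Not at hle
      have hv' : (F⁻¹ (v - n) : ℝ) ∈ M₁ := by
        have h3 : v - n ∈ M₁ := by
          have := hM₁.add_int_mem (-n) v hvM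
          rwa [Int.cast_neg, ← sub_eq_add_neg] at this
        have h4 := hM₁.lift_mem γ⁻¹ h3
        rwa [map_inv] at h4
      refine hgap _ ?_ ?_ hv'
      · rw [lt_unit_inv_iff]; linarith
      · rw [unit_inv_le_iff]; linarith
    linarith
  exact h.infinite_of_invariant (invariant_orb f l) ⟨l, mem_orb_self f l⟩
    (finite_of_separated hδ inter_subset_right fun u hu v hv => hsepl u hu.1 v hv.1)

/-- The smallest nonempty closed invariant set. -/
def limitSet (f : ι → CircleDeg1Liftˣ) : Set ℝ :=
  ⋂ M : {M : Set ℝ // IsClosed M ∧ Invariant f M ∧ M.Nonempty}, M.1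

theorem isClosed_limitSet (f : ι → CircleDeg1Liftˣ) : IsClosed (limitSet f) :=
  isClosed_iInter fun M => M.2.1

theorem invariant_limitSet (f : ι → CircleDeg1Liftˣ) : Invariant f (limitSet f) where
  letter_mem s x hx := mem_iInter.2 fun M => M.2.2.1.letter_mem s x (mem_iInter.1 hx M)
  add_int_mem n x hx := mem_iInter.2 fun M => M.2.2.1.add_int_mem n x (mem_iInter.1 hx M)

theorem limitSet_subset {f : ι → CircleDeg1Liftˣ} {M : Set ℝ} (hc : IsClosed M)
    (hM : Invariant f M) (hne : M.Nonempty) : limitSet f ⊆ M :=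
  iInter_subset (fun M : {M : Set ℝ // IsClosed M ∧ Invariant f M ∧ M.Nonempty} => M.1)
    ⟨M, hc, hM, hne⟩

section Coding

variable {f : ι → CircleDeg1Liftˣ} {Lab : ℝ → Option (ι × Bool)}

/-- Two nonempty closed invariant sets meet, so these sets form a directed family. Compactness of a
period gives a common point. -/
theorem PartialCoding.nonempty_limitSet [Nontrivial ι] (h : PartialCoding f Lab) : (limitSet f).Nonempty := by
  let P := {M : Set ℝ // IsClosed M ∧ Invariant f M ∧ M.Nonempty}
  have hinter : ∀ M N : P, ∃ K : P, K.1 = M.1 ∩ N.1 := fun M N =>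
    ⟨⟨M.1 ∩ N.1, M.2.1.inter N.2.1,
      ⟨fun s x hx => ⟨M.2.2.1.letter_mem s x hx.1, N.2.2.1.letter_mem s x hx.2⟩,
        fun n x hx => ⟨M.2.2.1.add_int_mem n x hx.1, N.2.2.1.add_int_mem n x hx.2⟩⟩,
      h.inter_nonempty M.2.2.1 N.2.2.1 M.2.1 N.2.1 M.2.2.2 N.2.2.2⟩, rfl⟩
  have : Nonempty P := ⟨⟨univ, isClosed_univ, ⟨fun _ _ _ => trivial, fun _ _ _ => trivial⟩,
    univ_nonempty⟩⟩
  have key : (⋂ M : P, M.1 ∩ Icc (0 : ℝ) 1).Nonempty := by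
    apply IsCompact.nonempty_iInter_of_directed_nonempty_isCompact_isClosed
    · intro M N
      obtain ⟨K, hK⟩ := hinter M N
      refine ⟨K, ?_, ?_⟩ <;> dsimp only <;> rw [hK]
      · exact fun x hx => ⟨hx.1.1, hx.2⟩
      · exact fun x hx => ⟨hx.1.2, hx.2⟩
    · intro M
      obtain ⟨x, hx⟩ := M.2.2.2
      exact ⟨Int.fract x, int_fract_mem M.2.2.1 hx, Int.fract_nonneg x, (Int.fract_lt_one x).le⟩
    · exact fun M => isCompact_Icc.inter_left M.2.1
    · exact fun M => M.2.1.inter isClosed_Icc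
  obtain ⟨x, hx⟩ := key
  exact ⟨x, mem_iInter.2 fun M => (mem_iInter.1 hx M).1⟩

theorem limitSet_subset_closure_orb (x : ℝ) :
    limitSet f ⊆ closure (orb f x) :=
  limitSet_subset isClosed_closure (invariant_orb f x).closure
    ⟨x, subset_closure (mem_orb_self f x)⟩

/-- The limit set does not meet the interior of the unlabelled part. -/
theorem PartialCoding.notMem_interior_of_mem_limitSet [Nontrivial ι] (h : PartialCoding f Lab) {x : ℝ}
    (hx : x ∈ limitSet f) : x ∉ interior {y : ℝ | Lab y = none} := by
  set N : Set ℝ := interior {y : ℝ | Lab y = none} with hN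
  have hNo : IsOpen N := isOpen_interior
  have hNlab : ∀ y ∈ N, Lab y = none := fun y hy => (interior_subset (s := {y : ℝ | Lab y = none}) hy :)
  have hper : Function.Periodic Lab 1 := h.add_one
  have hperint : ∀ (n : ℤ) y, Lab (y + n) = Lab y := fun n y => by
    simpa using hper.int_mul n y
  -- It is enough that some orbit avoids `N`: then `M` is a nonempty closed invariant set disjoint
  -- from `N`.
  set M : Set ℝ := {y | ∀ z ∈ orb f y, z ∉ N} with hM
  have hMinv : Invariant f M := by
    constructor
    · intro s y hy z hz
      refine hy z ?_
      have := (invariant_orb f y).orb_subset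
        ((invariant_orb f y).letter_mem s y (mem_orb_self f y))
      exact this hz
    · intro n y hy z hz
      refine hy z ?_
      have := (invariant_orb f y).orb_subset
        ((invariant_orb f y).add_int_mem n y (mem_orb_self f y))
      exact this hz
  have hMc : IsClosed M := by
    have : M = ⋂ (γ : FreeGroup ι) (n : ℤ), {y | FreeGroup.lift f γ y + n ∉ N} := by
      ext y
      simp only [hM, mem_ofPred_eq, mem_iInter]
      constructor
      · exact fun hy γ n => hy _ ⟨γ, n, rfl⟩
      · rintro hy _ ⟨γ, n, rfl⟩
        exact hy γ n
    rw [this]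
    refine isClosed_iInter fun γ => isClosed_iInter fun n => ?_
    exact hNo.isClosed_compl.preimage ((unit_continuous _).add continuous_const)
  have hMne : M.Nonempty := by
    by_contra hcon
    rw [not_nonempty_iff_eq_empty] at hcon
    -- Near a point `y` outside `N` whose orbit enters `N`, some element sends all points into `N`.
    -- A nontrivial reduced word maps points of `N` to labelled points, so `N` misses a
    -- neighbourhood of `y`. Hence `N` is clopen, which is absurd in both cases.
    have hNclosed : IsClosed N := by
      rw [← isOpen_compl_iff, isOpen_iff_mem_nhds]
      intro y hy
      have hyM : y ∉ M := by rw [hcon]; exact notMem_empty y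
      simp only [hM, mem_ofPred_eq, not_forall, not_not] at hyM
      obtain ⟨_, ⟨γ, n, rfl⟩, hz⟩ := hyM
      have hopen : IsOpen {w : ℝ | FreeGroup.lift f γ w + n ∈ N} :=
        hNo.preimage ((unit_continuous _).add continuous_const)
      obtain ⟨L, hL, rfl⟩ := exists_reduced γ
      rcases L with _ | ⟨s, L⟩
      · exfalso
        apply hy
        rw [hN, mem_interior]
        refine ⟨_, fun w hw => ?_, hopen, hz⟩
        have h1 := hNlab _ hw
        rw [lift_mk_nil_apply, hperint] at h1
        exact h1
      · filter_upwards [hopen.mem_nhds hz] with w hw hwN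
        have h1 := hNlab _ hw
        rw [hperint, h.lab_lift (hNlab w hwN) s L hL] at h1
        exact absurd h1 (by simp)
    rcases isClopen_iff.1 ⟨hNclosed, hNo⟩ with h0 | h0
    · have : (0 : ℝ) ∈ M := fun z _ => by rw [h0]; exact notMem_empty z
      rw [hcon] at this
      exact this
    · obtain ⟨i, -⟩ := exists_pair_ne ι
      have h1 := (h.act (i, true) 0).2 (by rw [hNlab 0 (by rw [h0]; trivial)]; simp)
      rw [hNlab _ (by rw [h0]; trivial)] at h1
      exact absurd h1 (by simp)
  exact limitSet_subset hMc hMinv hMne hx x (mem_orb_self f x)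

/-- The derived set of the limit set is closed, invariant and nonempty, since the limit set is
infinite modulo 1. By minimality it contains the limit set. -/
theorem PartialCoding.limitSet_perfect [Nontrivial ι] (h : PartialCoding f Lab) {x : ℝ} (hx : x ∈ limitSet f) :
    ∃ᶠ y in 𝓝[≠] x, y ∈ limitSet f := by
  rw [← accPt_iff_frequently_nhdsNE]
  have hmap : ∀ F : CircleDeg1Liftˣ, (∀ y ∈ limitSet f, F y ∈ limitSet f) →
      ∀ y ∈ derivedSet (limitSet f), F y ∈ derivedSet (limitSet f) := by
    intro F hF y hy
    rw [mem_derivedSet] at hy ⊢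
    refine (hy.map (unit_continuous F).continuousAt
      (CircleDeg1Lift.toOrderIso F).injective).mono ?_
    rw [map_principal, principal_mono]
    rintro _ ⟨z, hz, rfl⟩
    exact hF z hz
  refine limitSet_subset (f := f) (isClosed_derivedSet _) ⟨?_, ?_⟩ ?_ hx
  · exact fun s => hmap (letter f s) ((invariant_limitSet f).letter_mem s)
  · intro n y hy
    have := hmap (CircleDeg1Lift.translate (Multiplicative.ofAdd (n : ℝ))) (fun z hz => by
      rw [translate_int_apply]
      exact (invariant_limitSet f).add_int_mem n z hz) y hy
    rwa [translate_int_apply] at this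
  · obtain ⟨y, -, hy⟩ := (h.infinite_of_invariant (invariant_limitSet f)
      h.nonempty_limitSet).exists_accPt_of_subset_isCompact
      (isCompact_Icc (a := (0 : ℝ)) (b := 1))
      (inter_subset_right.trans Ico_subset_Icc_self)
    exact ⟨y, hy.mono (principal_mono.2 inter_subset_left)⟩

/-! ### Left accumulation points of the limit set -/

/-- The points of the limit set that are accumulated from the left. -/
def leftLimitSet (f : ι → CircleDeg1Liftˣ) : Set ℝ :=
  {x | ∃ᶠ y in 𝓝[<] x, y ∈ limitSet f}

theorem mem_leftLimitSet {x : ℝ} :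
    x ∈ leftLimitSet f ↔ ∃ᶠ y in 𝓝[<] x, y ∈ limitSet f := Iff.rfl

theorem leftLimitSet_subset : leftLimitSet f ⊆ limitSet f := by
  intro x hx
  have h1 : ∃ᶠ y in 𝓝 x, y ∈ limitSet f := hx.filter_mono nhdsWithin_le_nhds
  exact (isClosed_limitSet f).mem_of_frequently_of_tendsto h1 tendsto_id

theorem leftLimitSet_map {F : CircleDeg1Liftˣ} (hF : ∀ y ∈ limitSet f, F y ∈ limitSet f) {x : ℝ}
    (hx : x ∈ leftLimitSet f) : F x ∈ leftLimitSet f := by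
  rw [mem_leftLimitSet, ← map_unit_nhdsLT, frequently_map]
  exact Frequently.mono hx fun y hy => hF y hy

theorem invariant_leftLimitSet : Invariant f (leftLimitSet f) where
  letter_mem s _ hx := leftLimitSet_map ((invariant_limitSet f).letter_mem s) hx
  add_int_mem n x hx := by
    have := leftLimitSet_map (F := CircleDeg1Lift.translate (Multiplicative.ofAdd (n : ℝ)))
      (fun z hz => by
        rw [translate_int_apply]
        exact (invariant_limitSet f).add_int_mem n z hz) hx
    rwa [translate_int_apply] at this

theorem mem_leftLimitSet_of_frequently {x : ℝ} (hx : ∃ᶠ y in 𝓝[<] x, y ∈ leftLimitSet f) :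
    x ∈ leftLimitSet f :=
  hx.mono fun _ hy => leftLimitSet_subset hy

/-- If `v` does not qualify, the last point of the limit set before `v` is isolated on the right;
perfectness then forces accumulation from the left. -/
theorem PartialCoding.exists_mem_leftLimitSet [Nontrivial ι] (h : PartialCoding f Lab) {u v : ℝ}
    (hu : u ∈ limitSet f) (huv : u < v) :
    ∃ e ∈ leftLimitSet f, u ≤ e ∧ e ≤ v := by
  by_cases hvE : v ∈ leftLimitSet f
  · exact ⟨v, hvE, huv.le, le_rfl⟩
  rw [mem_leftLimitSet, not_frequently] at hvE
  obtain ⟨d, hd, hdv⟩ := (mem_nhdsLT_iff_exists_Ioo_subset).1 hvE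
  have hud : u ≤ d := by
    by_contra hlt
    push Not at hlt
    exact hdv ⟨hlt, huv⟩ hu
  obtain ⟨l, ⟨hl, hul, hld⟩, hmax⟩ := (isCompact_Icc.inter_left (isClosed_limitSet f) :
    IsCompact (limitSet f ∩ Icc u d)).exists_isGreatest ⟨u, hu, le_rfl, hud⟩
  have hlv : l < v := hld.trans_lt hd
  have hgap : ∀ z ∈ Ioo l v, z ∉ limitSet f := by
    intro z hz hzL
    rcases le_or_gt z d with hzd | hzd
    · exact absurd (hmax ⟨hzL, hul.trans hz.1.le, hzd⟩) (not_le.2 hz.1)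
    · exact hdv ⟨hzd, hz.2⟩ hzL
  have hacc := h.limitSet_perfect hl
  rw [← nhdsLT_sup_nhdsGT, frequently_sup] at hacc
  refine ⟨l, hacc.resolve_right ?_, hul, hlv.le⟩
  rw [not_frequently]
  filter_upwards [Ioo_mem_nhdsGT hlv] with z hz
  exact hgap z hz

theorem PartialCoding.leftLimitSet_left [Nontrivial ι] (h : PartialCoding f Lab) {x c : ℝ}
    (hx : x ∈ leftLimitSet f) (hc : c < x) : ∃ e ∈ leftLimitSet f, c < e ∧ e < x := by
  obtain ⟨u, hu, huc⟩ := (Frequently.and_eventually hx (Ioo_mem_nhdsLT hc)).exists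
  obtain ⟨v, -, hvu⟩ := (Frequently.and_eventually hx (Ioo_mem_nhdsLT huc.2)).exists
  obtain ⟨e, he, h1, h2⟩ := h.exists_mem_leftLimitSet hu hvu.1
  exact ⟨e, he, huc.1.trans_le h1, h2.trans_lt hvu.2⟩

theorem PartialCoding.nonempty_leftLimitSet [Nontrivial ι] (h : PartialCoding f Lab) :
    (leftLimitSet f).Nonempty := by
  obtain ⟨x, hx⟩ := h.nonempty_limitSet
  obtain ⟨e, he, -⟩ := h.exists_mem_leftLimitSet hx (lt_add_one x)
  exact ⟨e, he⟩

/-- The label is constant just to the left of `x`, where there are points of the limit set; these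
are not interior to the unlabelled part. -/
theorem PartialCoding.lab_ne_none [Nontrivial ι] (h : PartialCoding f Lab) {x : ℝ} (hx : x ∈ leftLimitSet f) :
    Lab x ≠ none := by
  intro hnone
  obtain ⟨p, hp, hpx⟩ := (mem_nhdsLT_iff_exists_Ioo_subset).1 (h.left x)
  obtain ⟨u, hu, hup⟩ := (Frequently.and_eventually hx (Ioo_mem_nhdsLT hp)).exists
  refine h.notMem_interior_of_mem_limitSet hu ?_
  rw [mem_interior]
  exact ⟨Ioo p x, fun y hy => (hpx hy).trans hnone, isOpen_Ioo, hup⟩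

theorem PartialCoding.exists_isGreatest [Nontrivial ι] (h : PartialCoding f Lab) (x : ℝ) :
    ∃ p, IsGreatest (leftLimitSet f ∩ Iic x) p := by
  obtain ⟨y, hy⟩ := h.nonempty_leftLimitSet
  have hne : (leftLimitSet f ∩ Iic x).Nonempty := by
    refine ⟨y + (-⌈y - x⌉ : ℤ), invariant_leftLimitSet.add_int_mem _ y hy, ?_⟩
    push_cast
    have := Int.le_ceil (y - x)
    rw [mem_Iic]
    linarith
  have hb : BddAbove (leftLimitSet f ∩ Iic x) := ⟨x, fun z hz => hz.2⟩
  refine ⟨sSup (leftLimitSet f ∩ Iic x), ⟨?_, csSup_le hne fun z hz => hz.2⟩,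
    fun z hz => le_csSup hb hz⟩
  by_contra hcon
  refine hcon (mem_leftLimitSet_of_frequently ?_)
  rw [frequently_iff]
  intro S hS
  obtain ⟨c, hc, hcS⟩ := (mem_nhdsLT_iff_exists_Ioo_subset).1 hS
  obtain ⟨e, he, hce⟩ := exists_lt_of_lt_csSup hne (show c < sSup _ from hc)
  exact ⟨e, hcS ⟨hce, lt_of_le_of_ne (le_csSup hb he) fun h => hcon (h ▸ he.1)⟩, he.1⟩

theorem isGreatest_map {F : CircleDeg1Liftˣ}
    (hF : ∀ y, F y ∈ leftLimitSet f ↔ y ∈ leftLimitSet f) {x p : ℝ}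
    (hp : IsGreatest (leftLimitSet f ∩ Iic x) p) :
    IsGreatest (leftLimitSet f ∩ Iic (F x)) (F p) := by
  refine ⟨⟨(hF p).2 hp.1.1, (unit_le_iff F).2 hp.1.2⟩, fun z hz => ?_⟩
  rw [← unit_inv_le_iff]
  refine hp.2 ⟨?_, ?_⟩
  · rw [← hF, CircleDeg1Lift.units_apply_inv_apply]
    exact hz.1
  · rw [mem_Iic, unit_inv_le_iff]
    exact hz.2

/-- A labelling of the line by left-open arcs, without unlabelled arcs, for which every letter `s`
maps the complement of the arcs labelled `sbar s` exactly onto the arcs labelled `s`. -/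
structure Coding (f : ι → CircleDeg1Liftˣ) (Lab : ℝ → ι × Bool) : Prop where
  add_one : ∀ x, Lab (x + 1) = Lab x
  left : ∀ x, ∀ᶠ y in 𝓝[<] x, Lab y = Lab x
  right : ∀ x, ∃ c, ∀ᶠ y in 𝓝[>] x, Lab y = c
  act : ∀ s x, Lab (letter f s x) = s ↔ Lab x ≠ sbar s

/-- The left ends of the arcs of a labelling. -/
def jumps (Lab : ℝ → ι × Bool) : Set ℝ := {x | ¬ ∀ᶠ y in 𝓝[>] x, Lab y = Lab x}

/-- Every orbit accumulates from the right at every left end of an arc. -/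
def OrbitsAccumulate (f : ι → CircleDeg1Liftˣ) (Lab : ℝ → ι × Bool) : Prop :=
  ∀ x, ∀ a ∈ jumps Lab, ∀ b, a < b → ∃ y ∈ orb f x, a < y ∧ y < b

/-- Every point is rounded down to the last point `p x` of the left limit set and takes over its
label. Rounding commutes with the letters because that set is invariant, so exactness is inherited,
and unlabelled points disappear. -/
theorem PartialCoding.exists_coding [Nontrivial ι] (h : PartialCoding f Lab) :
    ∃ Lab', Coding f Lab' ∧ OrbitsAccumulate f Lab' := by
  choose p hp using h.exists_isGreatest
  have huniq : ∀ {x q}, IsGreatest (leftLimitSet f ∩ Iic x) q → p x = q :=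
    fun hq => (hp _).unique hq
  have hpE : ∀ x, p x ∈ leftLimitSet f := fun x => (hp x).1.1
  have hple : ∀ x, p x ≤ x := fun x => (hp x).1.2
  have hex : ∀ x, ∃ s, Lab (p x) = some s := fun x =>
    Option.ne_none_iff_exists'.1 (h.lab_ne_none (hpE x))
  choose Lab' hLab' using hex
  have hpeq : ∀ {x y}, p x ≤ y → (∀ e ∈ leftLimitSet f, e ≤ y → e ≤ p x) → p y = p x :=
    fun h1 h2 => huniq ⟨⟨hpE _, h1⟩, fun e he => h2 e he.1 he.2⟩
  have hLabeq : ∀ {x y}, Lab (p x) = Lab (p y) → Lab' x = Lab' y := by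
    intro x y hxy
    rw [hLab', hLab', Option.some.injEq] at hxy
    exact hxy
  have hconst : ∀ {x y}, x ≤ y → (∀ e ∈ leftLimitSet f, e ∉ Ioc x y) → p y = p x := by
    intro x y hxy hE
    refine hpeq ((hple x).trans hxy) fun e he hey => ?_
    by_contra hlt
    push Not at hlt
    refine hE e he ⟨?_, hey⟩
    by_contra hex
    push Not at hex
    exact absurd ((hp x).2 ⟨he, hex⟩) (not_le.2 hlt)
  refine ⟨Lab', ⟨?_, ?_, ?_, ?_⟩, ?_⟩
  · intro x
    apply hLabeq
    have h1 := isGreatest_map (f := f)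
      (F := CircleDeg1Lift.translate (Multiplicative.ofAdd ((1 : ℤ) : ℝ)))
      (fun y => by rw [translate_int_apply]; exact invariant_leftLimitSet.add_int_mem_iff 1) (hp x)
    rw [translate_int_apply, translate_int_apply, Int.cast_one] at h1
    rw [huniq h1, h.add_one]
  · intro x
    rcases (hple x).eq_or_lt with heq | hlt
    · obtain ⟨d, hd, hdx⟩ := (mem_nhdsLT_iff_exists_Ioo_subset).1 (h.left x)
      have hxE : x ∈ leftLimitSet f := heq ▸ hpE x
      obtain ⟨e, he, hde, hex⟩ := h.leftLimitSet_left hxE hd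
      filter_upwards [Ioo_mem_nhdsLT hex] with y hy
      apply hLabeq
      rw [heq]
      exact hdx ⟨hde.trans_le ((hp y).2 ⟨he, hy.1.le⟩), (hple y).trans_lt hy.2⟩
    · filter_upwards [Ioo_mem_nhdsLT hlt] with y hy
      apply hLabeq
      rw [hpeq hy.1.le fun e he hey => (hp x).2 ⟨he, hey.trans hy.2.le⟩]
  · intro x
    by_cases hfr : ∃ᶠ e in 𝓝[>] x, e ∈ leftLimitSet f
    · obtain ⟨c, hc⟩ := h.right x
      obtain ⟨d, hd, hdx⟩ := (mem_nhdsGT_iff_exists_Ioo_subset).1 hc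
      have key : ∀ y ∈ Ioo x d, Lab (p y) = c := by
        intro y hy
        obtain ⟨e, he, hxe⟩ := (hfr.and_eventually (Ioo_mem_nhdsGT hy.1)).exists
        exact hdx ⟨hxe.1.trans_le ((hp y).2 ⟨he, hxe.2.le⟩), (hple y).trans_lt hy.2⟩
      obtain ⟨y₀, hy₀⟩ := exists_between (show x < d from hd)
      refine ⟨Lab' y₀, ?_⟩
      filter_upwards [Ioo_mem_nhdsGT hd] with y hy
      exact hLabeq ((key y hy).trans (key y₀ hy₀).symm)
    · rw [not_frequently] at hfr
      obtain ⟨d, hd, hdx⟩ := (mem_nhdsGT_iff_exists_Ioo_subset).1 hfr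
      refine ⟨Lab' x, ?_⟩
      filter_upwards [Ioo_mem_nhdsGT hd] with y hy
      apply hLabeq
      rw [hconst hy.1.le fun e he hey => hdx ⟨hey.1, hey.2.trans_lt hy.2⟩ he]
  · intro s x
    have h1 := isGreatest_map (f := f) (F := letter f s)
      (fun y => invariant_leftLimitSet.letter_mem_iff s) (hp x)
    have h2 := h.act s (p x)
    rw [← huniq h1, hLab', hLab', Ne, Option.some.injEq, Option.some.injEq] at h2
    exact h2
  · intro x a ha b hab
    -- Without such an `e` the rounding map, and with it the label, would be constant on `[a, b)`,
    -- so that `a` would not be a jump.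
    have hE : ∃ e ∈ leftLimitSet f, a < e ∧ e < b := by
      by_contra hcon
      push Not at hcon
      refine ha ?_
      filter_upwards [Ioo_mem_nhdsGT hab] with y hy
      apply hLabeq
      rw [hconst hy.1.le fun e he hey => absurd (hcon e he hey.1) (not_le.2 (hey.2.trans_lt hy.2))]
    obtain ⟨e, he, hae, heb⟩ := hE
    obtain ⟨u, hu, hua⟩ := (Frequently.and_eventually he (Ioo_mem_nhdsLT hae)).exists
    obtain ⟨y, hy, hyo⟩ := mem_closure_iff.1 (limitSet_subset_closure_orb x hu) (Ioo a b)
      isOpen_Ioo ⟨hua.1, hua.2.trans heb⟩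
    exact ⟨y, hyo, hy.1, hy.2⟩

end Coding

/-! ### Arcs of a coding -/

section Arcs

variable {f : ι → CircleDeg1Liftˣ} {Lab : ℝ → ι × Bool}

theorem Coding.add_int (h : Coding f Lab) (n : ℤ) (x : ℝ) : Lab (x + n) = Lab x := by
  have hper : Function.Periodic Lab 1 := h.add_one
  simpa using hper.int_mul n x

theorem eventually_nhdsGT_add_int {p : ℝ → Prop} (n : ℤ) {x : ℝ} :
    (∀ᶠ y in 𝓝[>] (x + n), p y) ↔ ∀ᶠ y in 𝓝[>] x, p (y + n) := by
  have := eventually_nhdsGT_unit (CircleDeg1Lift.translate (Multiplicative.ofAdd (n : ℝ)))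
    (x := x) (p := p)
  simpa only [translate_int_apply] using this

theorem Coding.add_int_mem_jumps (h : Coding f Lab) (n : ℤ) {x : ℝ} :
    x + n ∈ jumps Lab ↔ x ∈ jumps Lab := by
  simp only [jumps, mem_ofPred_eq, eventually_nhdsGT_add_int, h.add_int]

theorem Coding.eventually_notMem_jumps (h : Coding f Lab) (x : ℝ) :
    ∀ᶠ y in 𝓝[≠] x, y ∉ jumps Lab := by
  rw [← nhdsLT_sup_nhdsGT, eventually_sup]
  constructor
  · obtain ⟨p, hp, hpx⟩ := (mem_nhdsLT_iff_exists_Ioo_subset).1 (h.left x)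
    filter_upwards [Ioo_mem_nhdsLT hp] with y hy
    simp only [jumps, mem_ofPred_eq, not_not]
    filter_upwards [Ioo_mem_nhdsGT hy.2] with z hz
    exact (hpx ⟨hy.1.trans hz.1, hz.2⟩ : Lab z = Lab x).trans (hpx hy : Lab y = Lab x).symm
  · obtain ⟨c, hc⟩ := h.right x
    obtain ⟨p, hp, hpx⟩ := (mem_nhdsGT_iff_exists_Ioo_subset).1 hc
    filter_upwards [Ioo_mem_nhdsGT hp] with y hy
    simp only [jumps, mem_ofPred_eq, not_not]
    filter_upwards [Ioo_mem_nhdsGT hy.2] with z hz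
    exact (hpx ⟨hy.1.trans hz.1, hz.2⟩ : Lab z = c).trans (hpx hy : Lab y = c).symm

theorem Coding.finite_jumps (h : Coding f Lab) (a b : ℝ) : (jumps Lab ∩ Icc a b).Finite := by
  by_contra hinf
  obtain ⟨x, -, hx⟩ := Set.Infinite.exists_accPt_of_subset_isCompact hinf isCompact_Icc
    inter_subset_right
  rw [accPt_iff_frequently_nhdsNE] at hx
  exact hx ((h.eventually_notMem_jumps x).mono fun y hy hy' => hy hy'.1)

/-- A local constancy argument running down from `b`: the left germ at the supremum of the points
with a different value keeps that value, the right germ carries it further. -/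
theorem eq_of_germs {α : Type*} {u : ℝ → α} {a b : ℝ} (hl : ∀ x, ∀ᶠ y in 𝓝[<] x, u y = u x)
    (hr : ∀ x ∈ Ioo a b, ∀ᶠ y in 𝓝[>] x, u y = u x) {y : ℝ} (hy : y ∈ Ioc a b) : u y = u b := by
  by_contra hne
  set S : Set ℝ := {z | z ∈ Icc y b ∧ u z ≠ u b} with hS
  have hyS : y ∈ S := ⟨⟨le_rfl, hy.2⟩, hne⟩
  have hSb : BddAbove S := ⟨b, fun z hz => hz.1.2⟩
  set c := sSup S with hc
  have hyc : y ≤ c := le_csSup hSb hyS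
  have hcb : c ≤ b := csSup_le ⟨y, hyS⟩ fun z hz => hz.1.2
  have hcne : u c ≠ u b := by
    intro heq
    obtain ⟨p, hp, hpc⟩ := (mem_nhdsLT_iff_exists_Ioo_subset).1 (hl c)
    obtain ⟨z, hz, hpz⟩ := exists_lt_of_lt_csSup ⟨y, hyS⟩ (show p < sSup S from hp)
    rcases (le_csSup hSb hz).eq_or_lt with hzc | hzc
    · exact hz.2 (by rw [hzc]; exact heq)
    · exact hz.2 ((hpc ⟨hpz, hzc⟩ : u z = u c).trans heq)
  have hcb' : c < b := lt_of_le_of_ne hcb fun h => hcne (by rw [h])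
  obtain ⟨z, hz1, hz2⟩ :=
    ((hr c ⟨hy.1.trans_le hyc, hcb'⟩).and (Ioo_mem_nhdsGT hcb')).exists
  exact absurd (le_csSup hSb (show z ∈ S from ⟨⟨hyc.trans hz2.1.le, hz2.2.le⟩, hz1 ▸ hcne⟩))
    (not_le.2 hz2.1)

theorem Coding.lab_eq_of_forall_notMem_jumps (h : Coding f Lab) {a b : ℝ}
    (hab : ∀ x ∈ Ioo a b, x ∉ jumps Lab) {y : ℝ} (hy : y ∈ Ioc a b) : Lab y = Lab b :=
  eq_of_germs h.left (fun x hx => not_not.1 (hab x hx)) hy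

/-- The label cannot be constant: a generator other than that of `Lab 0` sends `0` to a point with
its own label. -/
theorem Coding.jumps_nonempty [Nontrivial ι] (h : Coding f Lab) : (jumps Lab).Nonempty := by
  by_contra hcon
  rw [not_nonempty_iff_eq_empty] at hcon
  have hconst : ∀ x y, Lab x = Lab y := by
    have key : ∀ x y, x ≤ y → Lab x = Lab y := fun x y hxy =>
      h.lab_eq_of_forall_notMem_jumps (a := x - 1) (fun z _ => by rw [hcon]; exact notMem_empty z)
        ⟨by linarith, hxy⟩
    intro x y
    rcases le_total x y with hxy | hxy
    · exact key x y hxy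
    · exact (key y x hxy).symm
  obtain ⟨i, hi⟩ := exists_ne (Lab 0).1
  have h1 := (h.act (i, true) 0).2 fun h2 => hi (by rw [h2]; rfl)
  rw [hconst _ 0] at h1
  exact hi (by rw [h1])

theorem Coding.exists_next [Nontrivial ι] (h : Coding f Lab) (x : ℝ) :
    ∃ b ∈ jumps Lab, x < b ∧ ∀ y ∈ Ioo x b, y ∉ jumps Lab := by
  obtain ⟨c, hc⟩ := h.jumps_nonempty
  set c' := c + (⌊x - c⌋ + 1 : ℤ) with hc'
  have hcJ : c' ∈ jumps Lab := (h.add_int_mem_jumps _).2 hc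
  have hxc : x < c' := by
    have := Int.lt_floor_add_one (x - c)
    rw [hc']
    push_cast
    linarith
  have hfin : (jumps Lab ∩ Ioc x c').Finite :=
    (h.finite_jumps x c').subset (inter_subset_inter_right _ Ioc_subset_Icc_self)
  obtain ⟨b, hb, hmin⟩ := exists_min_image _ id hfin ⟨c', hcJ, hxc, le_rfl⟩
  refine ⟨b, hb.1, hb.2.1, fun y hy hyJ => ?_⟩
  exact absurd (hmin y ⟨hyJ, hy.1, hy.2.le.trans hb.2.2⟩) (not_le.2 hy.2)

/-! ### Boundary points of a label, and arcs -/

/-- The ends of the arcs labelled `s`, adjacent arcs with the same label being merged. -/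
def bd (Lab : ℝ → ι × Bool) (s : ι × Bool) : Set ℝ :=
  {x | ¬ ∀ᶠ y in 𝓝[>] x, (Lab y = s ↔ Lab x = s)}

theorem bd_subset_jumps (s : ι × Bool) : bd Lab s ⊆ jumps Lab := by
  intro x hx hj
  exact hx (hj.mono fun y hy => by rw [hy])

/-- A set and its complement have the same boundary points. Only the boundary of a single label is
transported in this way; a jump between two labels other than `sbar s` is sent by `s` into an arc.
-/
theorem Coding.letter_mem_bd (h : Coding f Lab) (s : ι × Bool) {x : ℝ} :
    letter f s x ∈ bd Lab s ↔ x ∈ bd Lab (sbar s) := by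
  simp only [bd, mem_ofPred_eq, eventually_nhdsGT_unit, h.act, not_iff_not]

/-- `Ioc a b` is an arc of the labelling: `a` and `b` are consecutive jumps. -/
structure IsArc (Lab : ℝ → ι × Bool) (a b : ℝ) : Prop where
  left_mem : a ∈ jumps Lab
  right_mem : b ∈ jumps Lab
  lt : a < b
  notMem : ∀ x ∈ Ioo a b, x ∉ jumps Lab

theorem IsArc.lab_eq (h : Coding f Lab) {a b : ℝ} (hab : IsArc Lab a b) {y : ℝ}
    (hy : y ∈ Ioc a b) : Lab y = Lab b := h.lab_eq_of_forall_notMem_jumps hab.notMem hy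

theorem IsArc.eq_of_mem {a b : ℝ} (hab : IsArc Lab a b) {x : ℝ} (hx : x ∈ Ioc a b)
    (hj : x ∈ jumps Lab) : x = b := by
  by_contra hne
  exact hab.notMem x ⟨hx.1, lt_of_le_of_ne hx.2 hne⟩ hj

theorem IsArc.left_bd (h : Coding f Lab) {a b : ℝ} (hab : IsArc Lab a b) :
    a ∈ bd Lab (Lab b) := by
  have h1 : ∀ᶠ y in 𝓝[>] a, Lab y = Lab b := by
    filter_upwards [Ioo_mem_nhdsGT hab.lt] with y hy
    exact hab.lab_eq h ⟨hy.1, hy.2.le⟩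
  intro h2
  obtain ⟨y, hy1, hy2⟩ := (h1.and h2).exists
  exact hab.left_mem (h1.mono fun z hz => hz.trans (hy2.1 hy1).symm)

theorem right_bd {b : ℝ} (hb : b ∈ jumps Lab) : b ∈ bd Lab (Lab b) := by
  intro h2
  exact hb (h2.mono fun z hz => hz.2 rfl)

theorem IsArc.add_int (h : Coding f Lab) {a b : ℝ} (hab : IsArc Lab a b) (n : ℤ) :
    IsArc Lab (a + n) (b + n) where
  left_mem := (h.add_int_mem_jumps n).2 hab.left_mem
  right_mem := (h.add_int_mem_jumps n).2 hab.right_mem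
  lt := by linarith [hab.lt]
  notMem x hx hj := by
    refine hab.notMem (x - n) ⟨by linarith [hx.1], by linarith [hx.2]⟩ ?_
    rw [← h.add_int_mem_jumps n, sub_add_cancel]
    exact hj

theorem IsArc.left_eq {a b c d : ℝ} (hab : IsArc Lab a b) (hcd : IsArc Lab c d) {x : ℝ}
    (h1 : x ∈ Ioo a b) (h2 : x ∈ Ioo c d) : a = c := by
  rcases lt_trichotomy a c with h | h | h
  · exact absurd hcd.left_mem (hab.notMem c ⟨h, h2.1.trans h1.2⟩)
  · exact h
  · exact absurd hab.left_mem (hcd.notMem a ⟨h, h1.1.trans h2.2⟩)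

theorem IsArc.right_eq {a b d : ℝ} (hab : IsArc Lab a b) (hcd : IsArc Lab a d) : b = d := by
  rcases lt_trichotomy b d with h | h | h
  · exact absurd hab.right_mem (hcd.notMem b ⟨hab.lt, h⟩)
  · exact h
  · exact absurd hcd.right_mem (hab.notMem d ⟨hcd.lt, h⟩)

theorem Coding.exists_isArc [Nontrivial ι] (h : Coding f Lab) {a : ℝ} (ha : a ∈ jumps Lab) :
    ∃ b, IsArc Lab a b := by
  obtain ⟨b, hb, hab, hn⟩ := h.exists_next a
  exact ⟨b, ha, hb, hab, hn⟩

/-- A point outside the arcs labelled by the inverse of the last letter of a reduced word is mapped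
to an arc labelled by the first letter. -/
theorem Coding.lab_lift (h : Coding f Lab) {x : ℝ} (s : ι × Bool) (L : List (ι × Bool))
    (hL : FreeGroup.IsReduced (s :: L)) (hx : ∀ r ∈ (s :: L).getLast?, Lab x ≠ sbar r) :
    Lab (FreeGroup.lift f (FreeGroup.mk (s :: L)) x) = s := by
  induction L generalizing s with
  | nil =>
    rw [lift_mk_cons_apply, lift_mk_nil_apply, h.act]
    exact hx s (by simp)
  | cons t L ih =>
    rw [lift_mk_cons_apply, h.act, ih t (reduced_tail hL) (by simpa using hx)]
    intro heq
    have h1 := (reduced_cons_cons.1 hL).1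
    exact h1 (by rw [heq, sbar_sbar])

/-! ### Refined arcs -/

/-- The jumps of the labelling by words of length `k + 1`. -/
def refinedJumps (f : ι → CircleDeg1Liftˣ) (Lab : ℝ → ι × Bool) : ℕ → Set ℝ
  | 0 => jumps Lab
  | k + 1 => jumps Lab ∪ {x | letter f (sbar (Lab x)) x ∈ refinedJumps f Lab k}

theorem jumps_subset_refinedJumps (k : ℕ) : jumps Lab ⊆ refinedJumps f Lab k := by
  cases k with
  | zero => exact subset_rfl
  | succ k => exact subset_union_left

theorem refinedJumps_subset_succ (k : ℕ) :
    refinedJumps f Lab k ⊆ refinedJumps f Lab (k + 1) := by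
  induction k with
  | zero => exact subset_union_left
  | succ k ih =>
    rintro x (hx | hx)
    · exact Or.inl hx
    · exact Or.inr (ih hx)

theorem refinedJumps_mono : Monotone (refinedJumps f Lab) :=
  monotone_nat_of_le_succ refinedJumps_subset_succ

theorem Coding.add_int_mem_refinedJumps (h : Coding f Lab) (n : ℤ) (k : ℕ) {x : ℝ} :
    x + n ∈ refinedJumps f Lab k ↔ x ∈ refinedJumps f Lab k := by
  induction k generalizing x with
  | zero => exact h.add_int_mem_jumps n
  | succ k ih =>
    simp only [refinedJumps, mem_union, h.add_int_mem_jumps, mem_ofPred_eq, h.add_int,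
      CircleDeg1Lift.map_add_int, ih]

theorem Coding.finite_refinedJumps [Finite ι] (h : Coding f Lab) (k : ℕ) (a b : ℝ) :
    (refinedJumps f Lab k ∩ Icc a b).Finite := by
  induction k generalizing a b with
  | zero => exact h.finite_jumps a b
  | succ k ih =>
    have hfin : (⋃ s : ι × Bool, letter f s ''
        (refinedJumps f Lab k ∩ Icc (letter f (sbar s) a) (letter f (sbar s) b))).Finite :=
      finite_iUnion fun s => (ih _ _).image _
    refine ((h.finite_jumps a b).union hfin).subset ?_
    rintro x ⟨hx | hx, hxab⟩
    · exact Or.inl ⟨hx, hxab⟩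
    · refine Or.inr (mem_iUnion.2 ⟨Lab x, letter f (sbar (Lab x)) x, ⟨hx, ?_⟩,
        letter_apply_sbar f _ x⟩)
      exact ⟨(unit_le_iff _).2 hxab.1, (unit_le_iff _).2 hxab.2⟩

/-- The only jump in `Ioc a b` is `b`. It is a boundary point of its own label, so its image is
again a jump and belongs to every refinement. -/
theorem IsArc.mem_refinedJumps_succ (h : Coding f Lab) {a b : ℝ} (hab : IsArc Lab a b) (k : ℕ)
    {x : ℝ} (hx : x ∈ Ioc a b) : x ∈ refinedJumps f Lab (k + 1) ↔
      letter f (sbar (Lab b)) x ∈ refinedJumps f Lab k := by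
  simp only [refinedJumps, mem_union, mem_ofPred_eq, hab.lab_eq h hx]
  refine or_iff_right_of_imp fun hj => ?_
  rw [hab.eq_of_mem hx hj]
  apply jumps_subset_refinedJumps
  apply bd_subset_jumps (sbar (Lab b))
  rw [h.letter_mem_bd, sbar_sbar]
  exact right_bd hab.right_mem

theorem IsArc.image_refinedJumps (h : Coding f Lab) {a b : ℝ} (hab : IsArc Lab a b) (k : ℕ) :
    letter f (sbar (Lab b)) '' (refinedJumps f Lab (k + 1) ∩ Ioc a b) =
      refinedJumps f Lab k ∩ Ioc (letter f (sbar (Lab b)) a) (letter f (sbar (Lab b)) b) := by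
  rw [← unit_image_Ioc]
  ext y
  constructor
  · rintro ⟨x, ⟨hx1, hx2⟩, rfl⟩
    exact ⟨(hab.mem_refinedJumps_succ h k hx2).1 hx1, x, hx2, rfl⟩
  · rintro ⟨hy, x, hx, rfl⟩
    exact ⟨x, ⟨(hab.mem_refinedJumps_succ h k hx).2 hy, hx⟩, rfl⟩

theorem IsArc.ncard_refinedJumps (h : Coding f Lab) {a b : ℝ} (hab : IsArc Lab a b) (k : ℕ) :
    (refinedJumps f Lab k ∩
      Ioc (letter f (sbar (Lab b)) a) (letter f (sbar (Lab b)) b)).ncard =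
      (refinedJumps f Lab (k + 1) ∩ Ioc a b).ncard := by
  rw [← hab.image_refinedJumps h]
  exact Set.ncard_image_of_injective _ (CircleDeg1Lift.toOrderIso _).injective

theorem IsArc.ncard_jumps {a b : ℝ} (hab : IsArc Lab a b) :
    (refinedJumps f Lab 0 ∩ Ioc a b).ncard = 1 := by
  rw [Set.ncard_eq_one]
  refine ⟨b, Subset.antisymm ?_ ?_⟩
  · rintro x ⟨hx, hxab⟩
    exact hab.eq_of_mem hxab hx
  · rintro _ rfl
    exact ⟨hab.right_mem, hab.lt, le_rfl⟩

/-- An arc that is not subdivided by any of the refinements. -/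
structure IsRigidArc (f : ι → CircleDeg1Liftˣ) (Lab : ℝ → ι × Bool) (a b : ℝ) : Prop
    extends IsArc Lab a b where
  notMem_refined : ∀ k, ∀ x ∈ Ioo a b, x ∉ refinedJumps f Lab k

/-- The ends are boundary points of the label and go to jumps. Level `k` in the image corresponds to
level `k + 1` in the arc, which is why rigidity asks for all levels. -/
theorem IsRigidArc.map (h : Coding f Lab) {a b : ℝ} (hab : IsRigidArc f Lab a b) :
    IsRigidArc f Lab (letter f (sbar (Lab b)) a) (letter f (sbar (Lab b)) b) := by
  have key : ∀ k, ∀ x ∈ Ioo (letter f (sbar (Lab b)) a) (letter f (sbar (Lab b)) b),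
      x ∉ refinedJumps f Lab k := by
    intro k x hx hxk
    rw [← unit_image_Ioo] at hx
    obtain ⟨y, hy, rfl⟩ := hx
    exact hab.notMem_refined (k + 1) y hy
      ((hab.toIsArc.mem_refinedJumps_succ h k ⟨hy.1, hy.2.le⟩).2 hxk)
  refine ⟨⟨?_, ?_, (unit_lt_iff _).2 hab.lt, key 0⟩, key⟩
  · apply bd_subset_jumps (sbar (Lab b))
    rw [h.letter_mem_bd, sbar_sbar]
    exact hab.toIsArc.left_bd h
  · apply bd_subset_jumps (sbar (Lab b))
    rw [h.letter_mem_bd, sbar_sbar]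
    exact right_bd hab.right_mem

/-- The images of rigid arcs are equal or disjoint. -/
theorem IsRigidArc.left_eq_of_mem (h : Coding f Lab) (L : List (ι × Bool))
    (hL : FreeGroup.IsReduced L) (n : ℤ) {a b c d x : ℝ} (hab : IsRigidArc f Lab a b)
    (hcd : IsRigidArc f Lab c d) (hx : x ∈ Ioo a b)
    (hy : FreeGroup.lift f (FreeGroup.mk L) x + n ∈ Ioo c d) :
    FreeGroup.lift f (FreeGroup.mk L) a + n = c := by
  induction hlen : L.length generalizing L a b c d x with
  | zero =>
    obtain rfl := List.length_eq_zero_iff.1 hlen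
    rw [lift_mk_nil_apply] at hy ⊢
    exact (hab.toIsArc.add_int h n).left_eq hcd.toIsArc
      ⟨by linarith [hx.1], by linarith [hx.2]⟩ hy
  | succ m ih =>
    obtain ⟨s, L', rfl⟩ := List.exists_cons_of_length_eq_add_one hlen
    -- Induction on the length: the first letter is cancelled against the label of the target arc,
    -- or the last letter against the label of the source arc. If neither is possible, the word
    -- sends `x` to a point labelled `s`, which is not the label of the target.
    by_cases h1 : s = Lab d
    · have hmem : FreeGroup.lift f (FreeGroup.mk L') x + n ∈
          Ioo (letter f (sbar (Lab d)) c) (letter f (sbar (Lab d)) d) := by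
        rw [← unit_image_Ioo]
        refine ⟨_, hy, ?_⟩
        rw [lift_mk_cons_apply, CircleDeg1Lift.map_add_int, h1, letter_sbar_apply]
      have h2 := ih L' (reduced_tail hL) hab (hcd.map h) hx hmem (by simpa using hlen)
      rw [lift_mk_cons_apply, ← CircleDeg1Lift.map_add_int, h2, h1, letter_apply_sbar]
    · obtain ⟨L'', r, hr⟩ := (List.eq_nil_or_concat (s :: L')).resolve_left (by simp)
      rw [List.concat_eq_append] at hr
      by_cases h2 : r = sbar (Lab b)
      · rw [hr] at hy hlen hL ⊢
        rw [lift_mk_concat_apply, h2] at hy ⊢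
        refine ih L'' (hL.infix (List.prefix_append _ _).isInfix) (hab.map h) hcd ?_ hy
          (by simpa using hlen)
        exact ⟨(unit_lt_iff _).2 hx.1, (unit_lt_iff _).2 hx.2⟩
      · exfalso
        have h3 := h.lab_lift (x := x) s L' hL (by
          rw [hr]
          intro r' hr'
          rw [List.getLast?_concat, Option.mem_def, Option.some.injEq] at hr'
          rw [← hr', hab.toIsArc.lab_eq h ⟨hx.1, hx.2.le⟩]
          exact fun h4 => h2 (eq_sbar_comm.1 h4))
        rw [← h.add_int n, hcd.toIsArc.lab_eq h ⟨hy.1, hy.2.le⟩] at h3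
        exact h1 h3.symm

/-- The orbit of `a` enters the arc, and so a translate of the arc overlaps it with a different left
end, although images of rigid arcs are equal or disjoint. -/
theorem not_isRigidArc (h : Coding f Lab) (hacc : OrbitsAccumulate f Lab) {a b : ℝ} :
    ¬ IsRigidArc f Lab a b := by
  intro hab
  obtain ⟨_, ⟨γ, n, rfl⟩, h1, h2⟩ := hacc a a hab.left_mem b hab.lt
  obtain ⟨L, hL, rfl⟩ := exists_reduced γ
  set F := FreeGroup.lift f (FreeGroup.mk L)
  have hopen : IsOpen {y : ℝ | F y + n ∈ Ioo a b} :=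
    isOpen_Ioo.preimage ((unit_continuous F).add continuous_const)
  have hev : ∀ᶠ y in 𝓝[>] a, F y + n ∈ Ioo a b :=
    nhdsWithin_le_nhds (hopen.mem_nhds ⟨h1, h2⟩)
  obtain ⟨x, hx1, hx2⟩ := (hev.and (Ioo_mem_nhdsGT hab.lt)).exists
  have := hab.left_eq_of_mem h L hL n hab hx2 hx1
  linarith

theorem IsArc.exists_two_le_ncard [Finite ι] (h : Coding f Lab) (hacc : OrbitsAccumulate f Lab)
    {a b : ℝ} (hab : IsArc Lab a b) : ∃ k, 2 ≤ (refinedJumps f Lab k ∩ Ioc a b).ncard := by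
  by_contra hcon
  push Not at hcon
  refine not_isRigidArc h hacc (a := a) (b := b) ⟨hab, fun k x hx hxk => ?_⟩
  refine absurd (hcon k) (not_lt.2 ?_)
  rw [← Set.ncard_pair hx.2.ne]
  refine Set.ncard_le_ncard ?_ ((h.finite_refinedJumps k a b).subset
    (inter_subset_inter_right _ Ioc_subset_Icc_self))
  rintro _ (rfl | rfl)
  · exact ⟨hxk, hx.1, hx.2.le⟩
  · exact ⟨jumps_subset_refinedJumps k hab.right_mem, hab.lt, le_rfl⟩

theorem Coding.ncard_add_int (h : Coding f Lab) (k : ℕ) (n : ℤ) (a b : ℝ) :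
    (refinedJumps f Lab k ∩ Ioc (a + n) (b + n)).ncard =
      (refinedJumps f Lab k ∩ Ioc a b).ncard := by
  rw [← Set.ncard_image_of_injective (refinedJumps f Lab k ∩ Ioc a b)
    (add_left_injective (n : ℝ))]
  congr 1
  ext x
  constructor
  · rintro ⟨hx, hxab⟩
    refine ⟨x - n, ⟨?_, by linarith [hxab.1], by linarith [hxab.2]⟩, sub_add_cancel x _⟩
    rw [← h.add_int_mem_refinedJumps n, sub_add_cancel]
    exact hx
  · rintro ⟨y, ⟨hy, hyab⟩, rfl⟩
    exact ⟨(h.add_int_mem_refinedJumps n k).2 hy, by dsimp only; linarith [hyab.1],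
      by dsimp only; linarith [hyab.2]⟩

/-- There are finitely many arcs modulo 1 and refinements increase with the level, so one level
serves for all arcs. -/
theorem Coding.exists_two_le_ncard [Finite ι] (h : Coding f Lab)
    (hacc : OrbitsAccumulate f Lab) :
    ∃ K, ∀ a b, IsArc Lab a b → 2 ≤ (refinedJumps f Lab K ∩ Ioc a b).ncard := by
  have hex : ∀ a, ∃ k, ∀ b, IsArc Lab a b → 2 ≤ (refinedJumps f Lab k ∩ Ioc a b).ncard := by
    intro a
    by_cases hb : ∃ b, IsArc Lab a b
    · obtain ⟨b, hb⟩ := hb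
      obtain ⟨k, hk⟩ := hb.exists_two_le_ncard h hacc
      exact ⟨k, fun b' hb' => by rwa [← hb.right_eq hb']⟩
    · exact ⟨0, fun b' hb' => absurd ⟨b', hb'⟩ hb⟩
  choose k hk using hex
  refine ⟨(h.finite_jumps 0 1).toFinset.sup k, fun a b hab => ?_⟩
  have hab' := hab.add_int h (-⌊a⌋)
  have ha : a + (-⌊a⌋ : ℤ) ∈ jumps Lab ∩ Icc 0 1 := by
    refine ⟨hab'.left_mem, ?_⟩
    push_cast
    rw [← sub_eq_add_neg]
    exact ⟨Int.fract_nonneg a, (Int.fract_lt_one a).le⟩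
  rw [← h.ncard_add_int _ (-⌊a⌋)]
  refine (hk _ _ hab').trans (Set.ncard_le_ncard ?_ ((h.finite_refinedJumps _ _ _).subset
    (inter_subset_inter_right _ Ioc_subset_Icc_self)))
  exact inter_subset_inter_left _ (refinedJumps_mono
    (Finset.le_sup (f := k) ((Set.Finite.mem_toFinset _).2 ha)))

end Arcs

/-! ### Lengths of arcs -/

/-- A continuous approximation of the integer part. -/
noncomputable def softFloor (n : ℕ) (x : ℝ) : ℝ := ⌊x⌋ + Int.fract x ^ (n + 1)

theorem softFloor_add_one (n : ℕ) (x : ℝ) : softFloor n (x + 1) = softFloor n x + 1 := by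
  simp only [softFloor, Int.floor_add_one, Int.fract_add_one]
  push_cast
  ring

theorem continuous_softFloor (n : ℕ) : Continuous (softFloor n) := by
  have h1 : Continuous ((fun t : ℝ => t ^ (n + 1) - t) ∘ Int.fract) :=
    ContinuousOn.comp_fract'' (by fun_prop) (by simp)
  have h2 : softFloor n = fun x => x + ((fun t : ℝ => t ^ (n + 1) - t) ∘ Int.fract) x := by
    ext x
    have := Int.floor_add_fract x
    simp only [softFloor, Function.comp_apply]
    linarith
  rw [h2]
  exact continuous_id.add h1

theorem strictMono_softFloor (n : ℕ) : StrictMono (softFloor n) := by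
  intro x y hxy
  rcases (Int.floor_mono hxy.le).eq_or_lt with h | h
  · have h1 : Int.fract x < Int.fract y := by
      rw [Int.fract, Int.fract, h]
      linarith
    have h2 : Int.fract x ^ (n + 1) < Int.fract y ^ (n + 1) :=
      pow_lt_pow_left₀ h1 (Int.fract_nonneg x) (Nat.succ_ne_zero n)
    simp only [softFloor, h]
    linarith
  · have h1 : ((⌊x⌋ + 1 : ℤ) : ℝ) ≤ ⌊y⌋ := by exact_mod_cast h
    have h2 : Int.fract x ^ (n + 1) < 1 :=
      pow_lt_one₀ (Int.fract_nonneg x) (Int.fract_lt_one x) (Nat.succ_ne_zero n)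
    have h3 : 0 ≤ Int.fract y ^ (n + 1) := pow_nonneg (Int.fract_nonneg y) _
    push_cast at h1
    simp only [softFloor]
    linarith

theorem tendsto_softFloor (x : ℝ) : Tendsto (fun n => softFloor n x) atTop (𝓝 ⌊x⌋) := by
  have h1 : Tendsto (fun n : ℕ => Int.fract x ^ (n + 1)) atTop (𝓝 0) :=
    (tendsto_add_atTop_iff_nat 1).2
      (tendsto_pow_atTop_nhds_zero_of_lt_one (Int.fract_nonneg x) (Int.fract_lt_one x))
  simpa [softFloor] using h1.const_add (⌊x⌋ : ℝ)

/-- Points of `X` are uniquely `p + m` with `p ∈ P` and `m` an integer, and `a < p + m ≤ b` is a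
condition on floors. Writing counts through floors allows them to be smoothed. -/
theorem ncard_inter_Ioc_eq_sum {X : Set ℝ} (hX : ∀ (n : ℤ) (x : ℝ), x + n ∈ X ↔ x ∈ X)
    (P : Finset ℝ) (hP : (P : Set ℝ) = X ∩ Ico 0 1) {a b : ℝ} (hab : a ≤ b) :
    ((X ∩ Ioc a b).ncard : ℝ) = ∑ p ∈ P, ((⌊b - p⌋ : ℝ) - ⌊a - p⌋) := by
  have hPm : ∀ {p}, p ∈ P ↔ p ∈ X ∧ p ∈ Ico (0 : ℝ) 1 := fun {p} => by
    rw [← Finset.mem_coe, hP]; rfl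
  have himg : X ∩ Ioc a b = (fun q : (_ : ℝ) × ℤ => q.1 + (q.2 : ℝ)) ''
      (P.sigma fun p => Finset.Ioc ⌊a - p⌋ ⌊b - p⌋ : Finset ((_ : ℝ) × ℤ)) := by
    ext x
    simp only [mem_image, Finset.mem_coe, Finset.mem_sigma, Finset.mem_Ioc]
    constructor
    · rintro ⟨hx, hxa, hxb⟩
      refine ⟨⟨Int.fract x, ⌊x⌋⟩, ⟨hPm.2 ⟨?_, Int.fract_nonneg x, Int.fract_lt_one x⟩, ?_, ?_⟩,
        Int.fract_add_floor x⟩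
      · rw [← hX ⌊x⌋, Int.fract_add_floor]
        exact hx
      · rw [Int.floor_lt]
        have := Int.fract_add_floor x
        dsimp only
        linarith
      · rw [Int.le_floor]
        have := Int.fract_add_floor x
        dsimp only
        linarith
    · rintro ⟨⟨p, m⟩, ⟨hp, h1, h2⟩, rfl⟩
      rw [Int.floor_lt] at h1
      rw [Int.le_floor] at h2
      dsimp only at h1 h2 ⊢
      exact ⟨(hX m p).2 (hPm.1 hp).1, by linarith, by linarith⟩
  have hinj : InjOn (fun q : (_ : ℝ) × ℤ => q.1 + (q.2 : ℝ))
      (P.sigma fun p => Finset.Ioc ⌊a - p⌋ ⌊b - p⌋ : Finset ((_ : ℝ) × ℤ)) := by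
    rintro ⟨p, m⟩ hq ⟨p', m'⟩ hq' heq
    rw [Finset.mem_coe, Finset.mem_sigma] at hq hq'
    dsimp only at heq hq hq'
    have h1 := (hPm.1 hq.1).2
    have h2 := (hPm.1 hq'.1).2
    have h3 : ⌊p + (m : ℝ)⌋ = m := by
      rw [Int.floor_add_intCast, Int.floor_eq_zero_iff.2 h1, zero_add]
    have h4 : ⌊p' + (m' : ℝ)⌋ = m' := by
      rw [Int.floor_add_intCast, Int.floor_eq_zero_iff.2 h2, zero_add]
    have h5 : m = m' := by rw [← h3, ← h4, heq]
    subst h5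
    have h6 : p = p' := by linarith
    rw [h6]
  rw [himg, hinj.ncard_image, Set.ncard_coe_finset, Finset.card_sigma]
  push_cast
  refine Finset.sum_congr rfl fun p _ => ?_
  rw [Int.card_Ioc, ← Int.cast_natCast, Int.toNat_of_nonneg]
  · push_cast; ring
  · have := Int.floor_mono (sub_le_sub_right hab p)
    lia

section Height

variable {f : ι → CircleDeg1Liftˣ} {Lab : ℝ → ι × Bool}

/-- The inverse of the label shifts levels by one, so the sum telescopes: the gain is the count at
level `K`, at least 2, minus the count at level 0, equal to 1. -/
theorem IsArc.sum_ncard_lt (h : Coding f Lab) {K : ℕ} {a b : ℝ} (hab : IsArc Lab a b)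
    (hK : 2 ≤ (refinedJumps f Lab K ∩ Ioc a b).ncard) :
    ∑ k ∈ Finset.range K, (refinedJumps f Lab k ∩ Ioc a b).ncard <
      ∑ k ∈ Finset.range K, (refinedJumps f Lab k ∩
        Ioc (letter f (sbar (Lab b)) a) (letter f (sbar (Lab b)) b)).ncard := by
  simp only [hab.ncard_refinedJumps h]
  have h1 := Finset.sum_range_succ (fun k => (refinedJumps f Lab k ∩ Ioc a b).ncard) K
  have h2 := Finset.sum_range_succ' (fun k => (refinedJumps f Lab k ∩ Ioc a b).ncard) K
  rw [hab.ncard_jumps] at h2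
  omega

/-- Measured by the total number of refined jumps of level below `K`, every arc gets strictly
longer. This measure is atomic; a close continuous approximation, normalized to have mass 1 per
period, is the derivative measure of `τ`. -/
theorem Coding.exists_lengthen [Finite ι] [Nontrivial ι] (h : Coding f Lab)
    (hacc : OrbitsAccumulate f Lab) : ∃ τ : CircleDeg1Liftˣ, ∀ a b, IsArc Lab a b →
      τ b - τ a < τ (letter f (sbar (Lab b)) b) - τ (letter f (sbar (Lab b)) a) := by
  obtain ⟨K, hK⟩ := h.exists_two_le_ncard hacc
  have hfin : ∀ k, (refinedJumps f Lab k ∩ Ico 0 1).Finite := fun k =>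
    (h.finite_refinedJumps k 0 1).subset (inter_subset_inter_right _ Ico_subset_Icc_self)
  let P : ℕ → Finset ℝ := fun k => (hfin k).toFinset
  have hP : ∀ k, (P k : Set ℝ) = refinedJumps f Lab k ∩ Ico 0 1 := fun k =>
    (hfin k).coe_toFinset
  let W : ℕ → ℝ → ℝ := fun n x => ∑ k ∈ Finset.range K, ∑ p ∈ P k, softFloor n (x - p)
  let N : ℝ := ∑ k ∈ Finset.range K, ∑ _p ∈ P k, (1 : ℝ)
  obtain ⟨c, hc⟩ := h.jumps_nonempty
  obtain ⟨d, hcd⟩ := h.exists_isArc hc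
  -- At level 0 an arc contains just one jump, which excludes `K = 0`.
  have hKpos : 0 < K := by
    rcases Nat.eq_zero_or_pos K with rfl | hK0
    · have := hK c d hcd
      rw [hcd.ncard_jumps] at this
      omega
    · exact hK0
  have hP0 : Int.fract c ∈ P 0 := by
    rw [← Finset.mem_coe, hP]
    refine ⟨?_, Int.fract_nonneg c, Int.fract_lt_one c⟩
    have := (h.add_int_mem_jumps (-⌊c⌋)).2 hc
    rwa [Int.cast_neg, ← sub_eq_add_neg] at this
  have hN : 0 < N := by
    refine Finset.sum_pos' (fun k _ => Finset.sum_nonneg fun _ _ => zero_le_one)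
      ⟨0, Finset.mem_range.2 hKpos, ?_⟩
    exact Finset.sum_pos (fun _ _ => zero_lt_one) ⟨_, hP0⟩
  have hWc : ∀ n, Continuous (W n) := fun n =>
    continuous_finsetSum _ fun k _ => continuous_finsetSum _ fun p _ =>
      (continuous_softFloor n).comp (continuous_id.sub continuous_const)
  have hWm : ∀ n, StrictMono (W n) := by
    intro n x y hxy
    have hle : ∀ p, softFloor n (x - p) < softFloor n (y - p) := fun p =>
      strictMono_softFloor n (by linarith)
    refine Finset.sum_lt_sum (fun k _ => Finset.sum_le_sum fun p _ => (hle p).le)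
      ⟨0, Finset.mem_range.2 hKpos, ?_⟩
    exact Finset.sum_lt_sum (fun p _ => (hle p).le) ⟨_, hP0, hle _⟩
  have hW1 : ∀ n x, W n (x + 1) = W n x + N := by
    intro n x
    simp only [W, N, ← Finset.sum_add_distrib]
    refine Finset.sum_congr rfl fun k _ => Finset.sum_congr rfl fun p _ => ?_
    rw [← softFloor_add_one]
    congr 1
    ring
  have hlim : ∀ a b, a ≤ b → Tendsto (fun n => W n b - W n a) atTop
      (𝓝 ((∑ k ∈ Finset.range K, (refinedJumps f Lab k ∩ Ioc a b).ncard : ℕ) : ℝ)) := by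
    intro a b hab
    have h1 : ((∑ k ∈ Finset.range K, (refinedJumps f Lab k ∩ Ioc a b).ncard : ℕ) : ℝ) =
        ∑ k ∈ Finset.range K, ∑ p ∈ P k, ((⌊b - p⌋ : ℝ) - ⌊a - p⌋) := by
      push_cast
      exact Finset.sum_congr rfl fun k _ =>
        ncard_inter_Ioc_eq_sum (fun n x => h.add_int_mem_refinedJumps n k) (P k) (hP k) hab
    rw [h1]
    simp only [W, ← Finset.sum_sub_distrib]
    exact tendsto_finsetSum _ fun k _ => tendsto_finsetSum _ fun p _ =>
      (tendsto_softFloor _).sub (tendsto_softFloor _)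
  -- Finitely many strict inequalities between limits hold for all large `n`.
  have hev : ∀ᶠ n in atTop, ∀ a ∈ jumps Lab ∩ Icc 0 1, ∀ b, IsArc Lab a b →
      W n b - W n a < W n (letter f (sbar (Lab b)) b) - W n (letter f (sbar (Lab b)) a) := by
    rw [eventually_all_finite (h.finite_jumps 0 1)]
    intro a ha
    obtain ⟨b, hab⟩ := h.exists_isArc ha.1
    have h1 := (hlim a b hab.lt.le).eventually_lt
      (hlim _ _ ((unit_le_iff (letter f (sbar (Lab b)))).2 hab.lt.le))
      (by exact_mod_cast hab.sum_ncard_lt h (hK a b hab))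
    filter_upwards [h1] with n hn b' hb'
    rw [← hab.right_eq hb']
    exact hn
  obtain ⟨n, hn⟩ := hev.exists
  obtain ⟨τ, hτ⟩ := exists_unit_of_strictMono (fun x => W n x / N) ((hWc n).div_const N)
    (fun x y hxy => div_lt_div_of_pos_right (hWm n hxy) hN)
    (fun x => by rw [hW1, add_div, div_self hN.ne'])
  refine ⟨τ, fun a b hab => ?_⟩
  have hab' := hab.add_int h (-⌊a⌋)
  have ha : a + (-⌊a⌋ : ℤ) ∈ jumps Lab ∩ Icc 0 1 := by
    refine ⟨hab'.left_mem, ?_⟩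
    push_cast
    rw [← sub_eq_add_neg]
    exact ⟨Int.fract_nonneg a, (Int.fract_lt_one a).le⟩
  have key := div_lt_div_of_pos_right (hn _ ha _ hab') hN
  rw [sub_div, sub_div, ← hτ, ← hτ, ← hτ, ← hτ, h.add_int] at key
  simp only [CircleDeg1Lift.map_add_int] at key
  linarith

/-! ### Conjugation -/

/-- The conjugate of an action on the line. -/
def conj (τ : CircleDeg1Liftˣ) (f : ι → CircleDeg1Liftˣ) : ι → CircleDeg1Liftˣ :=
  fun i => τ * f i * τ⁻¹

theorem lift_conj (τ : CircleDeg1Liftˣ) (f : ι → CircleDeg1Liftˣ) (γ : FreeGroup ι) :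
    FreeGroup.lift (conj τ f) γ = τ * FreeGroup.lift f γ * τ⁻¹ := by
  have : FreeGroup.lift (conj τ f) = (MulAut.conj τ).toMonoidHom.comp (FreeGroup.lift f) := by
    ext i
    simp [conj]
  rw [this]
  rfl

theorem letter_conj_apply (τ : CircleDeg1Liftˣ) (f : ι → CircleDeg1Liftˣ) (s : ι × Bool) (x : ℝ) :
    letter (conj τ f) s x = τ (letter f s (τ⁻¹ x)) := by
  obtain ⟨i, _ | _⟩ := s
  · rw [letter_false, letter_false, conj, mul_inv_rev, mul_inv_rev, inv_inv, ← mul_assoc]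
    rfl
  · rfl

theorem Coding.conj (h : Coding f Lab) (τ : CircleDeg1Liftˣ) :
    Coding (conj τ f) fun x => Lab (τ⁻¹ x) where
  add_one x := by rw [CircleDeg1Lift.map_add_one, h.add_one]
  left x := (eventually_nhdsLT_unit τ⁻¹).1 (h.left (τ⁻¹ x))
  right x := by
    obtain ⟨c, hc⟩ := h.right (τ⁻¹ x)
    exact ⟨c, (eventually_nhdsGT_unit τ⁻¹).1 hc⟩
  act s x := by
    rw [letter_conj_apply, CircleDeg1Lift.units_inv_apply_apply]
    exact h.act s _

theorem mem_jumps_conj (τ : CircleDeg1Liftˣ) {x : ℝ} :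
    x ∈ jumps (fun x => Lab (τ⁻¹ x)) ↔ (τ⁻¹ x : ℝ) ∈ jumps Lab := by
  simp only [jumps, mem_ofPred_eq,
    ← eventually_nhdsGT_unit τ⁻¹ (x := x) (p := fun y => Lab y = Lab (τ⁻¹ x))]

theorem IsArc.of_conj {τ : CircleDeg1Liftˣ} {a b : ℝ}
    (hab : IsArc (fun x => Lab (τ⁻¹ x)) a b) : IsArc Lab (τ⁻¹ a) (τ⁻¹ b) where
  left_mem := (mem_jumps_conj τ).1 hab.left_mem
  right_mem := (mem_jumps_conj τ).1 hab.right_mem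
  lt := (unit_lt_iff _).2 hab.lt
  notMem x hx hj := by
    refine hab.notMem (τ x) ⟨(unit_inv_lt_iff τ).1 hx.1, (lt_unit_inv_iff τ).1 hx.2⟩ ?_
    rw [mem_jumps_conj, CircleDeg1Lift.units_inv_apply_apply]
    exact hj

theorem OrbitsAccumulate.conj (hacc : OrbitsAccumulate f Lab) (τ : CircleDeg1Liftˣ) :
    OrbitsAccumulate (conj τ f) fun x => Lab (τ⁻¹ x) := by
  intro x a ha b hab
  obtain ⟨_, ⟨γ, n, rfl⟩, h1, h2⟩ := hacc (τ⁻¹ x) (τ⁻¹ a) ((mem_jumps_conj τ).1 ha) (τ⁻¹ b)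
    ((unit_lt_iff _).2 hab)
  refine ⟨_, ⟨γ, n, rfl⟩, ?_⟩
  rw [unit_inv_lt_iff, CircleDeg1Lift.map_add_int] at h1
  rw [lt_unit_inv_iff, CircleDeg1Lift.map_add_int] at h2
  rw [lift_conj]
  exact ⟨h1, h2⟩

/-- The inverse of its label lengthens every arc. -/
def Lengthening (f : ι → CircleDeg1Liftˣ) (Lab : ℝ → ι × Bool) : Prop :=
  ∀ a b, IsArc Lab a b → b - a < letter f (sbar (Lab b)) b - letter f (sbar (Lab b)) a

theorem Coding.exists_conj_lengthening [Finite ι] [Nontrivial ι] (h : Coding f Lab)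
    (hacc : OrbitsAccumulate f Lab) :
    ∃ τ : CircleDeg1Liftˣ, Lengthening (PingPong.conj τ f) fun x => Lab (τ⁻¹ x) := by
  obtain ⟨τ, hτ⟩ := h.exists_lengthen hacc
  refine ⟨τ, fun a b hab => ?_⟩
  have := hτ _ _ hab.of_conj
  simp only [letter_conj_apply]
  simpa only [CircleDeg1Lift.units_apply_inv_apply] using this

end Height

/-! ### Real-analytic densities with prescribed integrals -/

/-- In finite dimension a convex set of full affine span has the same interior as its closure. This
turns approximate attainment of a vector of integrals into exact attainment. -/
theorem mem_of_isOpen_subset_closure_of_convex {E : Type*} [NormedAddCommGroup E] [NormedSpace ℝ E]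
    [FiniteDimensional ℝ E] {D O : Set E} (hD : Convex ℝ D) (hO : IsOpen O)
    (hOD : O ⊆ closure D) {v : E} (hv : v ∈ O) : v ∈ D := by
  have hspan : affineSpan ℝ D = ⊤ := by
    rw [eq_top_iff, ← hO.affineSpan_eq_top ⟨v, hv⟩, affineSpan_le]
    refine hOD.trans (closure_minimal (subset_affineSpan ℝ D) ?_)
    exact AffineSubspace.closed_of_finiteDimensional _
  have hne := hD.interior_nonempty_iff_affineSpan_eq_top.2 hspan
  have h1 : v ∈ interior (closure D) := interior_maximal hOD hO hv
  rw [hD.interior_closure_eq_interior_of_nonempty_interior hne] at h1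
  exact interior_subset h1

/-! ### Entire functions on the circle and sign functions of arcs -/

/-- The restriction to the real line of an entire function. -/
def IsEntireRestriction (φ : ℝ → ℝ) : Prop :=
  ∃ g : ℂ → ℂ, Differentiable ℂ g ∧ ∀ x : ℝ, g x = φ x

/-- The algebra of functions on the circle that are restrictions of entire functions. -/
noncomputable def entireAlgebra : Subalgebra ℝ C(UnitAddCircle, ℝ) where
  carrier := {u | IsEntireRestriction fun x : ℝ => u x}
  mul_mem' := by
    rintro u v ⟨g, hg, hgu⟩ ⟨k, hk, hkv⟩
    exact ⟨fun z => g z * k z, hg.mul hk, fun x => by simp [hgu, hkv]⟩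
  add_mem' := by
    rintro u v ⟨g, hg, hgu⟩ ⟨k, hk, hkv⟩
    exact ⟨fun z => g z + k z, hg.add hk, fun x => by simp [hgu, hkv]⟩
  algebraMap_mem' r := ⟨fun _ => r, differentiable_const _, fun x => by simp⟩

theorem mem_entireAlgebra {u : C(UnitAddCircle, ℝ)} :
    u ∈ entireAlgebra ↔ IsEntireRestriction fun x : ℝ => u x := Iff.rfl

theorem fourier_one_coe (x : ℝ) :
    fourier (T := 1) 1 (x : UnitAddCircle) =
      Complex.cos (2 * Real.pi * x) + Complex.sin (2 * Real.pi * x) * Complex.I := by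
  rw [fourier_coe_apply, ← Complex.exp_mul_I]
  congr 1
  push_cast
  ring

theorem entireAlgebra_separatesPoints : entireAlgebra.SeparatesPoints := by
  intro y₁ y₂ hne
  have hcast : ∀ x : ℝ, fourier (T := 1) 1 (x : UnitAddCircle) =
      ((Real.cos (2 * Real.pi * x) : ℝ) : ℂ) +
        ((Real.sin (2 * Real.pi * x) : ℝ) : ℂ) * Complex.I := fun x => by
    rw [fourier_one_coe]
    push_cast
    ring
  have hne' : fourier (T := 1) 1 y₁ ≠ fourier (T := 1) 1 y₂ := by
    intro h
    rw [fourier_one, fourier_one] at h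
    exact hne (AddCircle.injective_toCircle one_ne_zero (Subtype.ext h))
  let u : C(UnitAddCircle, ℝ) := ⟨fun y => (fourier (T := 1) 1 y).re, by fun_prop⟩
  let v : C(UnitAddCircle, ℝ) := ⟨fun y => (fourier (T := 1) 1 y).im, by fun_prop⟩
  have hu : u ∈ entireAlgebra := by
    refine ⟨fun z => Complex.cos (2 * Real.pi * z), by fun_prop, fun x => ?_⟩
    change _ = (((fourier (T := 1) 1 (x : UnitAddCircle)).re : ℝ) : ℂ)
    rw [hcast, Complex.add_re, Complex.re_ofReal_mul, Complex.ofReal_re, Complex.I_re, mul_zero,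
      add_zero]
    push_cast
    rfl
  have hv : v ∈ entireAlgebra := by
    refine ⟨fun z => Complex.sin (2 * Real.pi * z), by fun_prop, fun x => ?_⟩
    change _ = (((fourier (T := 1) 1 (x : UnitAddCircle)).im : ℝ) : ℂ)
    rw [hcast, Complex.add_im, Complex.im_ofReal_mul, Complex.ofReal_im, Complex.I_im, mul_one,
      zero_add]
    push_cast
    rfl
  by_cases hre : u y₁ = u y₂
  · refine ⟨v, ⟨v, hv, rfl⟩, fun him => hne' (Complex.ext hre him)⟩
  · exact ⟨u, ⟨u, hu, rfl⟩, hre⟩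

/-- A function on the circle which is positive exactly on the arc from `a` to `b`. -/
noncomputable def arcFun (a b x : ℝ) : ℝ :=
  Real.sin (Real.pi * (x - a)) * Real.sin (Real.pi * (b - x))

theorem continuous_arcFun (a b : ℝ) : Continuous (arcFun a b) := by
  unfold arcFun
  fun_prop

theorem periodic_arcFun (a b : ℝ) : Function.Periodic (arcFun a b) 1 := by
  intro x
  have h1 : Real.pi * (x + 1 - a) = Real.pi * (x - a) + Real.pi := by ring
  have h2 : Real.pi * (b - (x + 1)) = Real.pi * (b - x) - Real.pi := by ring
  rw [arcFun, h1, h2, Real.sin_add_pi, Real.sin_sub_pi, neg_mul_neg, arcFun]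

theorem arcFun_add_int (a b x : ℝ) (n : ℤ) : arcFun a b (x + n) = arcFun a b x := by
  simpa using (periodic_arcFun a b).int_mul n x

theorem abs_arcFun_le (a b x : ℝ) : |arcFun a b x| ≤ 1 := by
  rw [arcFun, abs_mul]
  exact mul_le_one₀ (Real.abs_sin_le_one _) (abs_nonneg _) (Real.abs_sin_le_one _)

theorem arcFun_pos {a b x : ℝ} (hb : b < a + 1) (hx : x ∈ Ioo a b) : 0 < arcFun a b x := by
  have hpi := Real.pi_pos
  refine mul_pos (Real.sin_pos_of_pos_of_lt_pi (mul_pos hpi (by linarith [hx.1])) ?_)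
    (Real.sin_pos_of_pos_of_lt_pi (mul_pos hpi (by linarith [hx.2])) ?_)
  · nlinarith [hx.1, hx.2]
  · nlinarith [hx.1, hx.2]

theorem exists_add_int_mem_Ico (a x : ℝ) : ∃ n : ℤ, x + n ∈ Ico a (a + 1) := by
  refine ⟨-⌊x - a⌋, ?_⟩
  push_cast
  have h1 := Int.floor_le (x - a)
  have h2 := Int.lt_floor_add_one (x - a)
  constructor <;> linarith

theorem arcFun_neg {a b x : ℝ} (hab : a < b) (hx : ∀ n : ℤ, x + n ∉ Icc a b) :
    arcFun a b x < 0 := by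
  obtain ⟨n, hn⟩ := exists_add_int_mem_Ico a x
  have hbn : b < x + n := by
    by_contra hle
    exact hx n ⟨hn.1, not_lt.1 hle⟩
  rw [← arcFun_add_int a b x n]
  have hpi := Real.pi_pos
  refine mul_neg_of_pos_of_neg (Real.sin_pos_of_pos_of_lt_pi (mul_pos hpi (by linarith)) ?_)
    (Real.sin_neg_of_neg_of_neg_pi_lt (mul_neg_of_pos_of_neg hpi (by linarith)) ?_)
  · nlinarith [hn.1, hn.2]
  · nlinarith [hn.1, hn.2]

theorem exists_of_arcFun_pos {a b x : ℝ} (hab : a < b) (hx : 0 < arcFun a b x) :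
    ∃ n : ℤ, x + n ∈ Ioo a b := by
  obtain ⟨n, hn⟩ := exists_add_int_mem_Ico a x
  rw [← arcFun_add_int a b x n] at hx
  have hpi := Real.pi_pos
  refine ⟨n, ?_, ?_⟩
  · refine lt_of_le_of_ne hn.1 fun heq => ?_
    rw [← heq, arcFun] at hx
    simp at hx
  · by_contra hle
    push Not at hle
    refine absurd hx (not_lt.2 (mul_nonpos_of_nonneg_of_nonpos
      (Real.sin_nonneg_of_nonneg_of_le_pi (mul_nonneg hpi.le (by linarith)) ?_)
      (Real.sin_nonpos_of_nonpos_of_neg_pi_le (mul_nonpos_of_nonneg_of_nonpos hpi.le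
        (by linarith)) ?_)))
    · nlinarith [hn.1, hn.2]
    · nlinarith [hn.1, hn.2]

theorem isEntireRestriction_arcFun (a b : ℝ) : IsEntireRestriction (arcFun a b) := by
  refine ⟨fun z => Complex.sin (Real.pi * (z - a)) * Complex.sin (Real.pi * (b - z)),
    by fun_prop, fun x => ?_⟩
  rw [arcFun]
  push_cast
  rfl

theorem exists_continuousMap_of_periodic {p : ℝ → ℝ} (hc : Continuous p)
    (hp : Function.Periodic p 1) : ∃ P : C(UnitAddCircle, ℝ), ∀ x : ℝ, P x = p x :=
  ⟨⟨hp.lift, Continuous.quotient_lift hc _⟩, fun x => hp.lift_coe x⟩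

/-- The density is `P * u`: `P` is a fixed product of sines with the required signs on the arcs, `u`
a positive element of the entire algebra. By Stone-Weierstrass the integral vectors of such `u` are
dense among those of positive continuous `u`, and these approximate every admissible vector.
Convexity makes the approximation exact. -/
theorem exists_entire_density {J : Type*} [Finite J] (α β : J → ℝ) (hαβ : ∀ j, α j < β j)
    (hβ : ∀ j, β j < α j + 1) (up : J → Prop)
    (hd : ∀ i j, i ≠ j → ∀ x ∈ Ioo (α i) (β i), ∀ n : ℤ, x + n ∉ Icc (α j) (β j))
    (v : J → ℝ) (hup : ∀ j, up j → 0 < v j)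
    (hdown : ∀ j, ¬ up j → -(β j - α j) < v j ∧ v j < 0) :
    ∃ φ : ℝ → ℝ, IsEntireRestriction φ ∧ Function.Periodic φ 1 ∧ (∀ x, -1 < φ x) ∧
      (∀ j, ∫ x in (α j)..(β j), φ x = v j) ∧
      (∀ j, up j → ∀ x ∈ Ioo (α j) (β j), 0 < φ x) ∧
      ∀ j, ¬ up j → ∀ x ∈ Ioo (α j) (β j), φ x < 0 := by
  classical
  have := Fintype.ofFinite J
  choose Q hQ using fun j => exists_continuousMap_of_periodic (continuous_arcFun (α j) (β j))
    (periodic_arcFun (α j) (β j))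
  have hQA : ∀ j, Q j ∈ entireAlgebra := fun j => by
    rw [mem_entireAlgebra]
    simp only [hQ]
    exact isEntireRestriction_arcFun _ _
  -- at most one of the `Q j` is positive at a given point
  have hQneg : ∀ i j, i ≠ j → ∀ y, 0 < Q i y → Q j y < 0 := by
    intro i j hij y hy
    obtain ⟨x, rfl⟩ := coe_surj y
    rw [hQ] at hy ⊢
    obtain ⟨n, hn⟩ := exists_of_arcFun_pos (hαβ i) hy
    rw [← arcFun_add_int _ _ x n]
    exact arcFun_neg (hαβ j) (hd i j hij _ hn)
  have hQpos : ∀ j, ∀ x ∈ Ioo (α j) (β j), 0 < Q j (x : UnitAddCircle) := fun j x hx => by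
    rw [hQ]; exact arcFun_pos (hβ j) hx
  -- On an arc, every `-Q j` of another arc is positive, so the sign of `P` is decided by whether
  -- the arc's own factor occurs.
  set P : C(UnitAddCircle, ℝ) := -∏ j ∈ Finset.univ.filter up, -Q j with hPdef
  have hPA : P ∈ entireAlgebra :=
    neg_mem (prod_mem fun j _ => neg_mem (hQA j))
  have hPapply : ∀ y, P y = -∏ j ∈ Finset.univ.filter up, -Q j y := fun y => by
    simp [hPdef, ContinuousMap.coe_prod]
  have hPup : ∀ i, up i → ∀ y, 0 < Q i y → 0 < P y := by
    intro i hi y hy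
    rw [hPapply, ← Finset.mul_prod_erase _ _ (Finset.mem_filter.2 ⟨Finset.mem_univ i, hi⟩),
      neg_mul, neg_neg]
    refine mul_pos hy (Finset.prod_pos fun j hj => ?_)
    exact neg_pos.2 (hQneg i j (Finset.ne_of_mem_erase hj).symm y hy)
  have hPdown : ∀ i, ¬ up i → ∀ y, 0 < Q i y → P y < 0 := by
    intro i hi y hy
    rw [hPapply, neg_lt_zero]
    refine Finset.prod_pos fun j hj => neg_pos.2 (hQneg i j ?_ y hy)
    rintro rfl
    exact hi (Finset.mem_filter.1 hj).2
  have hPabs : ∀ y, |P y| ≤ 1 := by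
    intro y
    rw [hPapply, abs_neg, Finset.abs_prod]
    refine Finset.prod_le_one (fun j _ => abs_nonneg _) fun j _ => ?_
    obtain ⟨x, rfl⟩ := coe_surj y
    rw [abs_neg, hQ]
    exact abs_arcFun_le _ _ _
  let I : C(UnitAddCircle, ℝ) →ₗ[ℝ] (J → ℝ) :=
    { toFun := fun u j => ∫ x in (α j)..(β j), (P * u) (x : UnitAddCircle)
      map_add' := by
        intro u w
        ext j
        simp only [Pi.add_apply, mul_add, ContinuousMap.add_apply]
        exact intervalIntegral.integral_add
          (((map_continuous (P * u)).comp continuous_coe).intervalIntegrable _ _)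
          (((map_continuous (P * w)).comp continuous_coe).intervalIntegrable _ _)
      map_smul' := by
        intro c u
        ext j
        simp only [mul_smul_comm, ContinuousMap.smul_apply, RingHom.id_apply, Pi.smul_apply]
        exact intervalIntegral.integral_smul c _ }
  have hIapply : ∀ u j, I u j = ∫ x in (α j)..(β j), P x * u x := fun u j => rfl
  have hIc : Continuous I := by
    refine continuous_pi fun j => ?_
    simp only [hIapply]
    refine intervalIntegral.continuous_parametric_intervalIntegral_of_continuous' ?_ _ _
    have h1 : Continuous fun q : C(UnitAddCircle, ℝ) × ℝ => q.1 (q.2 : UnitAddCircle) :=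
      continuous_eval.comp (continuous_fst.prodMk (continuous_coe.comp continuous_snd))
    exact ((map_continuous P).comp (continuous_coe.comp continuous_snd)).mul h1
  set Ω : Set C(UnitAddCircle, ℝ) := {u | (∀ y, 0 < u y) ∧ ∀ y, -1 < P y * u y} with hΩ
  have hΩo : IsOpen Ω := by
    have h1 : IsOpen {u : C(UnitAddCircle, ℝ) | MapsTo u univ (Ioi 0)} :=
      ContinuousMap.isOpen_setOfPred_mapsTo isCompact_univ isOpen_Ioi
    have h2 : IsOpen {u : C(UnitAddCircle, ℝ) | MapsTo u univ (Ioi (-1))} :=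
      ContinuousMap.isOpen_setOfPred_mapsTo isCompact_univ isOpen_Ioi
    have h3 := h1.inter (h2.preimage (continuous_const_mul P))
    convert h3 using 1
    ext u
    simp [hΩ, MapsTo]
  have hΩconv : Convex ℝ Ω := by
    intro u hu w hw a b ha hb hab
    have key : ∀ c p q : ℝ, c < p → c < q → c < a * p + b * q := by
      intro c p q hp hq
      have h1 : c = a * c + b * c := by rw [← add_mul, hab, one_mul]
      rcases ha.eq_or_lt with rfl | ha'
      · have hb1 : b = 1 := by linarith
        subst hb1
        linarith
      · nlinarith [mul_lt_mul_of_pos_left hp ha', mul_le_mul_of_nonneg_left hq.le hb]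
    constructor
    · intro y
      simpa using key 0 _ _ (hu.1 y) (hw.1 y)
    · intro y
      have := key (-1) _ _ (hu.2 y) (hw.2 y)
      simp only [ContinuousMap.add_apply, ContinuousMap.smul_apply, smul_eq_mul]
      convert this using 1
      ring
  set D : Set (J → ℝ) := I '' (Ω ∩ (entireAlgebra : Set C(UnitAddCircle, ℝ))) with hD
  have hDconv : Convex ℝ D := by
    refine (hΩconv.inter ?_).linear_image I
    exact (Subalgebra.toSubmodule entireAlgebra).convex
  have hΩD : I '' Ω ⊆ closure D := by
    have hdense : closure (entireAlgebra : Set C(UnitAddCircle, ℝ)) = univ := by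
      have := ContinuousMap.subalgebra_topologicalClosure_eq_top_of_separatesPoints entireAlgebra
        entireAlgebra_separatesPoints
      rw [← Subalgebra.topologicalClosure_coe, this]
      rfl
    rintro _ ⟨u, hu, rfl⟩
    have h1 : u ∈ closure (Ω ∩ (entireAlgebra : Set C(UnitAddCircle, ℝ))) :=
      hΩo.inter_closure ⟨hu, by rw [hdense]; trivial⟩
    exact image_closure_subset_closure_image hIc ⟨u, h1, rfl⟩
  set O : Set (J → ℝ) := univ.pi fun j => if up j then Ioi 0 else Ioo (-(β j - α j)) 0 with hO
  have hOo : IsOpen O := by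
    refine isOpen_set_pi finite_univ fun j _ => ?_
    split_ifs
    · exact isOpen_Ioi
    · exact isOpen_Ioo
  have hvO : v ∈ O := by
    intro j _
    dsimp only
    split_ifs with hj
    · exact hup j hj
    · exact hdown j hj
  have hOD : O ⊆ closure D := by
    intro w hw
    have hwup : ∀ j, up j → 0 < w j := fun j hj => by
      have := hw j trivial
      simp only [hj, if_true] at this
      exact this
    have hwdown : ∀ j, ¬ up j → -(β j - α j) < w j ∧ w j < 0 := fun j hj => by
      have := hw j trivial
      simp only [hj, if_false] at this
      exact this
    -- `r j` is the mean value wanted on the arc `j`. It exceeds `-1`, which leaves room for the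
    -- bound defining `Ω`.
    let r : J → ℝ := fun j => w j / (β j - α j)
    have hlen : ∀ j, 0 < β j - α j := fun j => sub_pos.2 (hαβ j)
    have hrup : ∀ j, up j → 0 < r j := fun j hj => div_pos (hwup j hj) (hlen j)
    have hrdown : ∀ j, ¬ up j → r j < 0 := fun j hj =>
      div_neg_of_neg_of_pos (hwdown j hj).2 (hlen j)
    have hr1 : ∀ j, 0 < 1 + r j := by
      intro j
      by_cases hj : up j
      · linarith [hrup j hj]
      · have := (lt_div_iff₀ (hlen j)).2 (show -1 * (β j - α j) < w j by linarith [(hwdown j hj).1])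
        linarith
    -- This is a regularization of `|r i| / |P|` on the arc `i`, so that `P * U η` tends to `r i`
    -- there; the summand `η` makes it positive everywhere.
    let U : ℝ → UnitAddCircle → ℝ := fun η y =>
      η + ∑ i, |r i| * max 0 (Q i y) / (|P y| * max 0 (Q i y) + η)
    have hden : ∀ η > 0, ∀ i y, 0 < |P y| * max 0 (Q i y) + η := fun η hη i y => by positivity
    have hUc : ∀ η > 0, Continuous (U η) := by
      intro η hη
      refine continuous_const.add (continuous_finsetSum _ fun i _ => ?_)
      refine Continuous.div (by fun_prop) (by fun_prop) fun y => (hden η hη i y).ne'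
    have hUpos : ∀ η > 0, ∀ y, 0 < U η y := by
      intro η hη y
      refine add_pos_of_pos_of_nonneg hη (Finset.sum_nonneg fun i _ => ?_)
      exact div_nonneg (by positivity) (hden η hη i y).le
    have hPU : ∀ η > 0, ∀ i y, 0 < Q i y →
        P y * U η y = η * P y + r i * ((|P y| * Q i y) / (|P y| * Q i y + η)) := by
      intro η hη i y hy
      have h1 : ∑ j, |r j| * max 0 (Q j y) / (|P y| * max 0 (Q j y) + η) =
          |r i| * Q i y / (|P y| * Q i y + η) := by
        rw [Finset.sum_eq_single i]
        · rw [max_eq_right hy.le]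
        · intro j _ hji
          rw [max_eq_left (hQneg i j hji.symm y hy).le, mul_zero, zero_div]
        · intro hi
          exact absurd (Finset.mem_univ i) hi
      have h2 : P y * |r i| = r i * |P y| := by
        by_cases hi : up i
        · rw [abs_of_pos (hrup i hi), abs_of_pos (hPup i hi y hy), mul_comm]
        · rw [abs_of_neg (hrdown i hi), abs_of_neg (hPdown i hi y hy)]
          ring
      simp only [U]
      rw [h1, mul_add, mul_comm (P y) η]
      congr 1
      rw [mul_div_assoc', ← mul_assoc, h2, mul_div_assoc', mul_assoc]
    have hfrac : ∀ η > 0, ∀ t ≥ (0 : ℝ), 0 ≤ t / (t + η) ∧ t / (t + η) ≤ 1 := by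
      intro η hη t ht
      refine ⟨div_nonneg ht (by linarith), (div_le_one (by linarith)).2 (by linarith)⟩
    have hUΩ : ∀ᶠ η in 𝓝[>] (0 : ℝ), ∀ y, -1 < P y * U η y := by
      have h1 : ∀ᶠ η in 𝓝[>] (0 : ℝ), ∀ i, η < 1 + r i :=
        eventually_all.2 fun i => nhdsWithin_le_nhds (Iio_mem_nhds (hr1 i))
      have h2 : ∀ᶠ η in 𝓝[>] (0 : ℝ), η < 1 := nhdsWithin_le_nhds (Iio_mem_nhds one_pos)
      filter_upwards [h1, h2, self_mem_nhdsWithin] with η hη1 hη2 hη y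
      have hη0 : (0 : ℝ) < η := hη
      have hηP : -η ≤ η * P y := by
        have := (abs_le.1 (hPabs y)).1
        nlinarith
      by_cases hy : ∃ i, 0 < Q i y
      · obtain ⟨i, hi⟩ := hy
        rw [hPU η hη0 i y hi]
        obtain ⟨h3, h4⟩ := hfrac η hη0 (|P y| * Q i y) (by positivity)
        by_cases hiu : up i
        · have := mul_nonneg (hrup i hiu).le h3
          linarith
        · have := hη1 i
          nlinarith [hrdown i hiu]
      · push Not at hy
        have h3 : U η y = η := by
          simp only [U]
          rw [Finset.sum_eq_zero, add_zero]
          intro i _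
          rw [max_eq_left (hy i), mul_zero, zero_div]
        rw [h3, mul_comm]
        linarith
    have hlimj : ∀ j, Tendsto (fun η => ∫ x in (α j)..(β j), P x * U η x) (𝓝[>] 0) (𝓝 (w j)) := by
      intro j
      have h1 : w j = ∫ _x in (α j)..(β j), r j := by
        rw [intervalIntegral.integral_const, smul_eq_mul, mul_div_cancel₀ _ (hlen j).ne']
      rw [h1]
      -- The domain of integration contains the end `β j`, at which `Q j` vanishes; it is a null
      -- set.
      have hβae : ∀ᵐ x : ℝ, x ≠ β j := by
        simp [MeasureTheory.ae_iff]
      have hIoo : ∀ x, x ≠ β j → x ∈ uIoc (α j) (β j) → 0 < Q j (x : UnitAddCircle) := by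
        intro x hx hxI
        rw [uIoc_of_le (hαβ j).le] at hxI
        exact hQpos j x ⟨hxI.1, lt_of_le_of_ne hxI.2 hx⟩
      apply intervalIntegral.tendsto_integral_filter_of_dominated_convergence
        (fun _ => 1 + |r j|)
      · filter_upwards [self_mem_nhdsWithin] with η hη
        have h2 : Continuous fun y => P y * U η y := (map_continuous P).mul (hUc η hη)
        exact (h2.comp continuous_coe).aestronglyMeasurable
      · have h2 : ∀ᶠ η in 𝓝[>] (0 : ℝ), η < 1 := nhdsWithin_le_nhds (Iio_mem_nhds one_pos)
        filter_upwards [h2, self_mem_nhdsWithin] with η hη1 hη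
        have hη0 : (0 : ℝ) < η := hη
        filter_upwards [hβae] with x hx hxI
        rw [hPU η hη0 j _ (hIoo x hx hxI), Real.norm_eq_abs]
        obtain ⟨h3, h4⟩ := hfrac η hη0 (|P x| * Q j x) (mul_nonneg (abs_nonneg _)
          (hIoo x hx hxI).le)
        refine (abs_add_le _ _).trans (add_le_add ?_ ?_)
        · rw [abs_mul, abs_of_pos hη0]
          exact mul_le_one₀ hη1.le (abs_nonneg _) (hPabs _)
        · rw [abs_mul, abs_of_nonneg h3]
          exact mul_le_of_le_one_right (abs_nonneg _) h4
      · exact intervalIntegrable_const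
      · filter_upwards [hβae] with x hx hxI
        have hq := hIoo x hx hxI
        have hPne : P (x : UnitAddCircle) ≠ 0 := by
          by_cases hj : up j
          · exact (hPup j hj _ hq).ne'
          · exact (hPdown j hj _ hq).ne
        have ht : 0 < |P x| * Q j x := mul_pos (abs_pos.2 hPne) hq
        have h2 : Tendsto (fun η : ℝ => η * P x +
            r j * ((|P x| * Q j x) / (|P x| * Q j x + η))) (𝓝[>] 0) (𝓝 (r j)) := by
          have h3 : ContinuousAt (fun η : ℝ => η * P x +
              r j * ((|P x| * Q j x) / (|P x| * Q j x + η))) 0 := by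
            refine ContinuousAt.add (by fun_prop) (ContinuousAt.mul (by fun_prop) ?_)
            exact ContinuousAt.div (by fun_prop) (by fun_prop) (by simpa using ht.ne')
          have h4 := h3.tendsto.mono_left (nhdsWithin_le_nhds (s := Ioi 0))
          simpa [div_self ht.ne'] using h4
        refine h2.congr' ?_
        filter_upwards [self_mem_nhdsWithin] with η hη
        rw [hPU η hη j _ hq]
    have hlim : Tendsto (fun η => fun j => ∫ x in (α j)..(β j), P x * U η x) (𝓝[>] 0) (𝓝 w) :=
      tendsto_pi_nhds.2 hlimj
    refine isClosed_closure.mem_of_tendsto hlim ?_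
    filter_upwards [hUΩ, self_mem_nhdsWithin] with η hη1 hη
    exact hΩD ⟨⟨U η, hUc η hη⟩, ⟨hUpos η hη, hη1⟩, rfl⟩
  obtain ⟨u, ⟨⟨hu1, hu2⟩, huA⟩, hIu⟩ :=
    mem_of_isOpen_subset_closure_of_convex hDconv hOo hOD hvO
  refine ⟨fun x => P x * u x, mul_mem hPA huA, ?_, fun x => hu2 x, fun j => congrFun hIu j, ?_, ?_⟩
  · intro x
    have : ((x + 1 : ℝ) : UnitAddCircle) = x := coe_eq_coe_iff.2 ⟨1, by simp⟩
    dsimp only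
    rw [this]
  · exact fun j hj x hx => mul_pos (hPup j hj _ (hQpos j x hx)) (hu1 _)
  · exact fun j hj x hx => mul_neg_of_neg_of_pos (hPdown j hj _ (hQpos j x hx)) (hu1 _)

/-! ### Analytic interpolation of a circle homeomorphism -/

theorem IsEntireRestriction.continuous {φ : ℝ → ℝ} (h : IsEntireRestriction φ) :
    Continuous φ := by
  obtain ⟨g, hg, hgφ⟩ := h
  have h1 : φ = fun x : ℝ => (g x).re := by
    funext x
    rw [hgφ, Complex.ofReal_re]
  rw [h1]
  exact Complex.continuous_re.comp (hg.continuous.comp Complex.continuous_ofReal)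

theorem IsEntireRestriction.exists_primitive {φ : ℝ → ℝ} (h : IsEntireRestriction φ) (x₀ c : ℝ) :
    ∃ Φ : ℝ → ℝ, AnalyticOnNhd ℝ Φ univ ∧ (∀ x, HasDerivAt Φ (1 + φ x) x) ∧ Φ x₀ = c := by
  obtain ⟨g, hg, hgφ⟩ := h
  obtain ⟨k, hk⟩ := (hg.const_add 1).isExactOn_univ
  have hkd : Differentiable ℂ k := fun z => (hk z (mem_univ z)).differentiableAt
  refine ⟨fun x => (k x).re - ((k x₀).re - c), fun x _ => ?_, fun x => ?_, by ring⟩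
  · exact ((hkd.analyticAt x).re_ofReal).sub analyticAt_const
  · have h1 := (hk x (mem_univ _)).real_of_complex
    dsimp only at h1
    rw [hgφ, Complex.add_re, Complex.one_re, Complex.ofReal_re] at h1
    exact h1.sub_const _

theorem analyticOnNhd_unit_inv {F : CircleDeg1Liftˣ} (hF : AnalyticOnNhd ℝ (fun x => F x) univ)
    (hF' : ∀ x, deriv (fun x => F x) x ≠ 0) : AnalyticOnNhd ℝ (fun x => F⁻¹ x) univ := by
  intro y _
  have h1 := (analyticAt_comp_iff_of_deriv_ne_zero (g := fun x => F⁻¹ x) (hF (F⁻¹ y) (mem_univ _))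
    (hF' _)).1
  rw [CircleDeg1Lift.units_apply_inv_apply] at h1
  refine h1 ?_
  have h2 : ((fun x => F⁻¹ x) ∘ fun x => F x) = id :=
    funext fun x => CircleDeg1Lift.units_inv_apply_apply F x
  rw [h2]
  exact analyticAt_id

/-- `a` and `b` are consecutive points of `D`. -/
structure Consecutive (D : Set ℝ) (a b : ℝ) : Prop where
  left_mem : a ∈ D
  right_mem : b ∈ D
  lt : a < b
  notMem : ∀ x ∈ Ioo a b, x ∉ D

section Consecutive

variable {D : Set ℝ}

theorem Consecutive.left_eq {a b c d : ℝ} (hab : Consecutive D a b) (hcd : Consecutive D c d)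
    {x : ℝ} (h1 : x ∈ Ioo a b) (h2 : x ∈ Ioo c d) : a = c := by
  rcases lt_trichotomy a c with h | h | h
  · exact absurd hcd.left_mem (hab.notMem c ⟨h, h2.1.trans h1.2⟩)
  · exact h
  · exact absurd hab.left_mem (hcd.notMem a ⟨h, h1.1.trans h2.2⟩)

theorem Consecutive.right_le {a b d : ℝ} (hab : Consecutive D a b) (hd : d ∈ D) (had : a < d) :
    b ≤ d := by
  by_contra! h
  exact hab.notMem d ⟨had, h⟩ hd

theorem Consecutive.add_int (hD : ∀ (n : ℤ) (x : ℝ), x + n ∈ D ↔ x ∈ D) {a b : ℝ}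
    (hab : Consecutive D a b) (n : ℤ) : Consecutive D (a + n) (b + n) where
  left_mem := (hD n _).2 hab.left_mem
  right_mem := (hD n _).2 hab.right_mem
  lt := by linarith [hab.lt]
  notMem x hx hj := by
    refine hab.notMem (x - n) ⟨by linarith [hx.1], by linarith [hx.2]⟩ ?_
    rw [← hD n, sub_add_cancel]
    exact hj

theorem exists_consecutive (hfin : ∀ a b, (D ∩ Icc a b).Finite) {a b : ℝ} (ha : a ∈ D)
    (hb : b ∈ D) (hab : a < b) : ∃ c, Consecutive D a c ∧ c ≤ b := by
  obtain ⟨c, hc, hmin⟩ := exists_min_image (D ∩ Ioc a b) id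
    ((hfin a b).subset (inter_subset_inter_right _ Ioc_subset_Icc_self)) ⟨b, hb, hab, le_rfl⟩
  refine ⟨c, ⟨ha, hc.1, hc.2.1, fun x hx hxD => ?_⟩, hc.2.2⟩
  exact absurd (hmin x ⟨hxD, hx.1, hx.2.le.trans hc.2.2⟩) (not_le.2 hx.2)

theorem exists_consecutive_Ioc (hD : ∀ (n : ℤ) (x : ℝ), x + n ∈ D ↔ x ∈ D)
    (hfin : ∀ a b, (D ∩ Icc a b).Finite) (hne : D.Nonempty) (x : ℝ) :
    ∃ a b, Consecutive D a b ∧ x ∈ Ioc a b := by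
  obtain ⟨d, hd⟩ := hne
  obtain ⟨n, hn1, hn2⟩ := exists_add_int_mem_Ico (x - 1) d
  have hnx : d + n < x := by linarith
  obtain ⟨a, ha, hmax⟩ := exists_max_image (D ∩ Ico (d + n) x) id
    ((hfin (d + n) x).subset (inter_subset_inter_right _ Ico_subset_Icc_self))
    ⟨d + n, (hD n d).2 hd, le_rfl, hnx⟩
  obtain ⟨b, hab, -⟩ := exists_consecutive hfin ha.1 (b := a + (1 : ℤ)) ((hD 1 a).2 ha.1) (by simp)
  refine ⟨a, b, hab, ha.2.2, ?_⟩
  by_contra! hbx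
  exact absurd (hmax b ⟨hab.right_mem, ha.2.1.trans hab.lt.le, hbx⟩) (not_le.2 hab.lt)

/-- Any two points of a locally finite set are joined by finitely many consecutive steps. -/
theorem eq_of_forall_consecutive (hfin : ∀ a b, (D ∩ Icc a b).Finite) {u : ℝ → ℝ}
    (hu : ∀ a b, Consecutive D a b → u a = u b) {a b : ℝ} (ha : a ∈ D) (hb : b ∈ D) :
    u a = u b := by
  have key : ∀ a b, a ∈ D → b ∈ D → a ≤ b → u a = u b := by
    intro a b ha hb hab
    obtain ⟨d, hd, hmax⟩ := exists_max_image {d | d ∈ D ∩ Icc a b ∧ u a = u d} id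
      ((hfin a b).subset fun d hd => hd.1) ⟨a, ⟨ha, le_rfl, hab⟩, rfl⟩
    rcases hd.1.2.2.eq_or_lt with h | h
    · rw [← h]
      exact hd.2
    · obtain ⟨c, hc, hcb⟩ := exists_consecutive hfin hd.1.1 hb h
      exact absurd (hmax c ⟨⟨hc.right_mem, hd.1.2.1.trans hc.lt.le, hcb⟩,
        hd.2.trans (hu d c hc)⟩) (not_le.2 hc.lt)
  rcases le_total a b with h | h
  · exact key a b ha hb h
  · exact (key b a hb ha h).symm

/-- A circle homeomorphism can be replaced by an analytic diffeomorphism with the same values on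
a finite set modulo `1`, which moreover is an expansion or a contraction between consecutive
points. -/
theorem exists_analytic_unit (F : CircleDeg1Liftˣ) (hD : ∀ (n : ℤ) (x : ℝ), x + n ∈ D ↔ x ∈ D)
    (hfin : ∀ a b, (D ∩ Icc a b).Finite) (hne : D.Nonempty)
    (hnext : ∀ a ∈ D, ∃ b ∈ D, a < b ∧ b < a + 1) {up : ℝ → Prop}
    (hupD : ∀ (n : ℤ) (x : ℝ), up (x + n) ↔ up x)
    (hup : ∀ a b, Consecutive D a b → up a → b - a < F b - F a)
    (hdown : ∀ a b, Consecutive D a b → ¬ up a → F b - F a < b - a) :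
    ∃ F' : CircleDeg1Liftˣ, AnalyticOnNhd ℝ (fun x => F' x) univ ∧
      AnalyticOnNhd ℝ (fun x => F'⁻¹ x) univ ∧ (∀ d ∈ D, F' d = F d) ∧
      (∀ a b, Consecutive D a b → up a → StrictMonoOn (fun x => F' x - x) (Icc a b)) ∧
      (∀ a b, Consecutive D a b → ¬ up a → StrictAntiOn (fun x => F' x - x) (Icc a b)) := by
  have hnext' : ∀ a : ↥(D ∩ Ico 0 1), ∃ b, Consecutive D a b ∧ b < a + 1 := by
    intro a
    obtain ⟨b, hb, hab, hba⟩ := hnext a a.2.1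
    obtain ⟨c, hc, hcb⟩ := exists_consecutive hfin a.2.1 hb hab
    exact ⟨c, hc, hcb.trans_lt hba⟩
  choose β hβ hβ1 using hnext'
  have hJ : Finite ↥(D ∩ Ico 0 1) :=
    ((hfin 0 1).subset (inter_subset_inter_right _ Ico_subset_Icc_self)).to_subtype
  obtain ⟨φ, hφe, hφp, hφ1, hφi, hφu, hφd⟩ := exists_entire_density (J := ↥(D ∩ Ico 0 1))
    (fun a => a) β (fun a => (hβ a).lt) hβ1 (fun a => up a)
    (by
      rintro ⟨a, ha⟩ ⟨b, hb⟩ hij x hx n hxn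
      have h1 := (hβ ⟨a, ha⟩).add_int hD n
      have h2 : x + n ∈ Ioo (a + n) (β ⟨a, ha⟩ + n) :=
        ⟨by linarith [hx.1], by linarith [hx.2]⟩
      have h3 : x + n ∉ D := h1.notMem _ h2
      have h4 : x + n ∈ Ioo b (β ⟨b, hb⟩) :=
        ⟨lt_of_le_of_ne hxn.1 fun h => h3 (h ▸ hb.1),
          lt_of_le_of_ne hxn.2 fun h => h3 (h ▸ (hβ ⟨b, hb⟩).right_mem)⟩
      have h5 : a + n = b := h1.left_eq (hβ ⟨b, hb⟩) h2 h4
      have h6 : n = 0 := by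
        have h7 : (n : ℝ) < 1 := by linarith [ha.2.1, hb.2.2]
        have h8 : (-1 : ℝ) < n := by linarith [ha.2.2, hb.2.1]
        norm_cast at h7 h8
        omega
      subst h6
      exact hij (Subtype.ext (by simpa using h5)))
    -- The density to be found is the derivative minus 1, so its integral is the change in length.
    -- This exceeds `-(β a - a)` because `F` is increasing.
    (fun a => (F (β a) - F a) - (β a - a))
    (fun a ha => by linarith [hup _ _ (hβ a) ha])
    (fun a ha => by
      have h1 := (unit_lt_iff F).2 (hβ a).lt
      exact ⟨by linarith, by linarith [hdown _ _ (hβ a) ha]⟩)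
  have hφc := hφe.continuous
  have hφint : ∀ (n : ℤ) (x : ℝ), φ (x + n) = φ x := fun n x => by
    simpa using hφp.int_mul n x
  have hred : ∀ a b, Consecutive D a b → ∃ (c : ↥(D ∩ Ico 0 1)) (n : ℤ), a + n = c ∧ b + n = β c := by
    intro a b hab
    obtain ⟨n, hn⟩ := exists_add_int_mem_Ico 0 a
    rw [zero_add] at hn
    have h1 := hab.add_int hD n
    refine ⟨⟨a + n, h1.left_mem, hn⟩, n, rfl, ?_⟩
    have h2 := hβ ⟨a + n, h1.left_mem, hn⟩
    exact le_antisymm (h1.right_le h2.right_mem h2.lt) (h2.right_le h1.right_mem h1.lt)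
  have hint : ∀ a b, Consecutive D a b → ∫ x in a..b, φ x = (F b - F a) - (b - a) := by
    intro a b hab
    obtain ⟨c, n, hc1, hc2⟩ := hred a b hab
    have h1 := hφi c
    rw [← hc1, ← hc2, ← intervalIntegral.integral_comp_add_right] at h1
    simp only [hφint, CircleDeg1Lift.map_add_int] at h1
    rw [h1]
    ring
  have hpos : ∀ a b, Consecutive D a b → up a → ∀ x ∈ Ioo a b, 0 < φ x := by
    intro a b hab ha x hx
    obtain ⟨c, n, hc1, hc2⟩ := hred a b hab
    rw [← hφint n]
    refine hφu c (by rw [← hc1, hupD]; exact ha) _ ⟨?_, ?_⟩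
    · rw [← hc1]
      linarith [hx.1]
    · rw [← hc2]
      linarith [hx.2]
  have hneg : ∀ a b, Consecutive D a b → ¬ up a → ∀ x ∈ Ioo a b, φ x < 0 := by
    intro a b hab ha x hx
    obtain ⟨c, n, hc1, hc2⟩ := hred a b hab
    rw [← hφint n]
    refine hφd c (by rw [← hc1, hupD]; exact ha) _ ⟨?_, ?_⟩
    · rw [← hc1]
      linarith [hx.1]
    · rw [← hc2]
      linarith [hx.2]
  obtain ⟨d₀, hd₀⟩ := hne
  obtain ⟨Φ, hΦa, hΦd, hΦ0⟩ := hφe.exists_primitive d₀ (F d₀)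
  have hΦc : Continuous Φ := continuous_iff_continuousAt.2 fun x => (hΦd x).continuousAt
  have hΦD : ∀ d ∈ D, Φ d = F d := by
    intro d hd
    have h1 : Φ d₀ - F d₀ = Φ d - F d := by
      refine eq_of_forall_consecutive hfin (u := fun x => Φ x - F x) (fun a b hab => ?_) hd₀ hd
      have h2 : ∫ x in a..b, (1 + φ x) = Φ b - Φ a :=
        intervalIntegral.integral_eq_sub_of_hasDerivAt (fun x _ => hΦd x)
          ((continuous_const.add hφc).intervalIntegrable _ _)
      rw [intervalIntegral.integral_add intervalIntegrable_const (hφc.intervalIntegrable _ _),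
        hint a b hab, intervalIntegral.integral_const, smul_eq_mul, mul_one] at h2
      linarith
    linarith
  -- `Φ (x + 1) - Φ x` is constant, its derivative being zero by periodicity of `φ`; at `d₀` it is 1
  -- because `Φ` agrees with `F` on `D`.
  have hΦ1 : ∀ x, Φ (x + 1) = Φ x + 1 := by
    have h1 : ∀ x, HasDerivAt (fun x => Φ (x + 1) - Φ x) 0 x := by
      intro x
      have h2 := ((hΦd (x + 1)).comp_add_const x 1).sub (hΦd x)
      rw [hφp x, sub_self] at h2
      exact h2
    have h3 : ∀ x, Φ (x + 1) - Φ x = Φ (d₀ + 1) - Φ d₀ := fun x =>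
      is_const_of_deriv_eq_zero (fun x => (h1 x).differentiableAt) (fun x => (h1 x).deriv) x d₀
    have h4 : Φ (d₀ + 1) = F d₀ + 1 := by
      rw [hΦD (d₀ + 1) (by simpa using (hD 1 d₀).2 hd₀), CircleDeg1Lift.map_add_one]
    intro x
    have := h3 x
    linarith
  have hΦm : StrictMono Φ := strictMono_of_deriv_pos fun x => by
    rw [(hΦd x).deriv]
    linarith [hφ1 x]
  obtain ⟨F', hF'⟩ := exists_unit_of_strictMono Φ hΦc hΦm hΦ1
  have hF'Φ : (fun x => F' x) = Φ := funext hF'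
  have hd' : ∀ x, HasDerivAt (fun x => F' x - x) (φ x) x := by
    intro x
    simp only [hF']
    have h1 := (hΦd x).sub (hasDerivAt_id x)
    rw [add_sub_cancel_left] at h1
    exact h1
  have hc' : Continuous fun x => F' x - x :=
    continuous_iff_continuousAt.2 fun x => (hd' x).continuousAt
  have han : AnalyticOnNhd ℝ (fun x => F' x) univ := by
    rw [hF'Φ]
    exact hΦa
  refine ⟨F', han, analyticOnNhd_unit_inv han fun x => ?_, fun d hd => (hF' d).trans (hΦD d hd),
    fun a b hab ha => ?_, fun a b hab ha => ?_⟩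
  · rw [hF'Φ, (hΦd x).deriv]
    linarith [hφ1 x]
  · refine strictMonoOn_of_deriv_pos (convex_Icc a b) hc'.continuousOn fun x hx => ?_
    rw [interior_Icc] at hx
    rw [(hd' x).deriv]
    exact hpos a b hab ha x hx
  · refine strictAntiOn_of_deriv_neg (convex_Icc a b) hc'.continuousOn fun x hx => ?_
    rw [interior_Icc] at hx
    rw [(hd' x).deriv]
    exact hneg a b hab ha x hx

end Consecutive

/-! ### Analytic realization of a coding -/

section Realization

variable {f f' : ι → CircleDeg1Liftˣ} {Lab : ℝ → ι × Bool}

theorem Coding.add_int_mem_bd (h : Coding f Lab) (s : ι × Bool) (n : ℤ) (x : ℝ) :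
    x + n ∈ bd Lab s ↔ x ∈ bd Lab s := by
  simp only [bd, mem_ofPred_eq, eventually_nhdsGT_add_int, h.add_int]

theorem Coding.finite_bd (h : Coding f Lab) (s : ι × Bool) (a b : ℝ) :
    (bd Lab s ∩ Icc a b).Finite :=
  (h.finite_jumps a b).subset (inter_subset_inter_left _ (bd_subset_jumps s))

theorem Coding.lab_eq_iff_of_forall_notMem_bd (h : Coding f Lab) {s : ι × Bool} {a b : ℝ}
    (hab : ∀ x ∈ Ioo a b, x ∉ bd Lab s) {y : ℝ} (hy : y ∈ Ioc a b) : Lab y = s ↔ Lab b = s := by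
  refine Eq.to_iff (eq_of_germs (u := fun x => Lab x = s) (fun x => ?_) (fun x hx => ?_) hy)
  · filter_upwards [h.left x] with z hz
    rw [hz]
  · filter_upwards [not_not.1 (hab x hx)] with z hz
    exact propext hz

/-- The letter `s` reaches its label from any point not labelled `sbar s`; if `0` is such a bad
point, another generator moves it away first. -/
theorem Coding.exists_lab_eq [Nontrivial ι] (h : Coding f Lab) (s : ι × Bool) :
    ∃ x, Lab x = s := by
  by_cases h0 : Lab 0 = sbar s
  · obtain ⟨i, hi⟩ := exists_ne s.1
    have h1 := (h.act (i, true) 0).2 fun h2 => hi (by rw [h0] at h2; exact congrArg Prod.fst h2.symm)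
    refine ⟨letter f s (letter f (i, true) 0), (h.act s _).2 fun h2 => hi ?_⟩
    rw [h1] at h2
    exact congrArg Prod.fst h2
  · exact ⟨_, (h.act s 0).2 h0⟩

theorem Coding.bd_nonempty [Nontrivial ι] (h : Coding f Lab) (s : ι × Bool) :
    (bd Lab s).Nonempty := by
  by_contra hcon
  rw [not_nonempty_iff_eq_empty] at hcon
  have key : ∀ x y, x ≤ y → (Lab x = s ↔ Lab y = s) := fun x y hxy =>
    h.lab_eq_iff_of_forall_notMem_bd (a := x - 1) (fun z _ => by rw [hcon]; exact notMem_empty z)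
      ⟨by linarith, hxy⟩
  obtain ⟨x, hx⟩ := h.exists_lab_eq s
  obtain ⟨y, hy⟩ := h.exists_lab_eq (sbar s)
  refine sbar_ne s (hy.symm.trans ?_)
  rcases le_total x y with hxy | hxy
  · exact (key x y hxy).1 hx
  · exact (key y x hxy).2 hx

/-- Otherwise membership in the label would be constant on `Ioc a (a + 1)`, and by periodicity equal
to that at `a`, which would not be a boundary point. -/
theorem Coding.exists_mem_bd_Ioo (h : Coding f Lab) {s : ι × Bool} {a : ℝ} (ha : a ∈ bd Lab s) :
    ∃ b ∈ bd Lab s, a < b ∧ b < a + 1 := by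
  by_contra! hcon
  refine ha ?_
  filter_upwards [Ioo_mem_nhdsGT (show a < a + 1 by linarith)] with y hy
  rw [h.lab_eq_iff_of_forall_notMem_bd (s := s)
    (fun x hx hxb => absurd (hcon x hxb hx.1) (not_le.2 hx.2)) ⟨hy.1, hy.2.le⟩, h.add_one]

theorem Consecutive.lab_eq_iff (h : Coding f Lab) {s : ι × Bool} {a b : ℝ}
    (hab : Consecutive (bd Lab s) a b) {y : ℝ} (hy : y ∈ Ioc a b) : Lab y = s ↔ Lab b = s :=
  h.lab_eq_iff_of_forall_notMem_bd hab.notMem hy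

theorem Consecutive.lab_right_eq_iff (h : Coding f Lab) {s : ι × Bool} {a b : ℝ}
    (hab : Consecutive (bd Lab s) a b) : Lab b = s ↔ Lab a ≠ s := by
  have h1 := hab.left_mem
  by_contra hcon
  refine h1 ?_
  filter_upwards [Ioo_mem_nhdsGT hab.lt] with y hy
  rw [hab.lab_eq_iff h ⟨hy.1, hy.2.le⟩]
  tauto

theorem Consecutive.isArc (h : Coding f Lab) {s : ι × Bool} {a b : ℝ}
    (hab : Consecutive (bd Lab s) a b) (hb : Lab b = s) : IsArc Lab a b where
  left_mem := bd_subset_jumps s hab.left_mem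
  right_mem := bd_subset_jumps s hab.right_mem
  lt := hab.lt
  notMem x hx hj := by
    refine hj ?_
    filter_upwards [Ioo_mem_nhdsGT hx.2] with y hy
    rw [(hab.lab_eq_iff h ⟨hx.1, hx.2.le⟩).2 hb,
      (hab.lab_eq_iff h ⟨hx.1.trans hy.1, hy.2.le⟩).2 hb]

theorem IsArc.consecutive (h : Coding f Lab) {a b : ℝ} (hab : IsArc Lab a b) :
    Consecutive (bd Lab (Lab b)) a b where
  left_mem := hab.left_bd h
  right_mem := right_bd hab.right_mem
  lt := hab.lt
  notMem x hx hj := hab.notMem x hx (bd_subset_jumps _ hj)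

theorem Consecutive.letter (h : Coding f Lab) {s : ι × Bool} {a b : ℝ}
    (hab : Consecutive (bd Lab (sbar s)) a b) :
    Consecutive (bd Lab s) (letter f s a) (letter f s b) where
  left_mem := (h.letter_mem_bd s).2 hab.left_mem
  right_mem := (h.letter_mem_bd s).2 hab.right_mem
  lt := (unit_lt_iff _).2 hab.lt
  notMem x hx hj := by
    obtain ⟨y, rfl⟩ : ∃ y, x = PingPong.letter f s y :=
      ⟨PingPong.letter f (sbar s) x, (letter_apply_sbar f s x).symm⟩
    exact hab.notMem y ⟨(unit_lt_iff _).1 hx.1, (unit_lt_iff _).1 hx.2⟩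
      ((h.letter_mem_bd s).1 hj)

/-- The letter inverse to the label of an arc expands this arc. -/
def Expanding (f : ι → CircleDeg1Liftˣ) (Lab : ℝ → ι × Bool) : Prop :=
  ∀ a b, IsArc Lab a b → StrictMonoOn (fun x => letter f (sbar (Lab b)) x - x) (Icc a b)

/-- The lifts `f` and `f'` agree wherever the coding `Lab` jumps between the label `s` and
the other ones. -/
def AgreeOnBd (f f' : ι → CircleDeg1Liftˣ) (Lab : ℝ → ι × Bool) : Prop :=
  ∀ s, ∀ d ∈ bd Lab (sbar s), letter f' s d = letter f s d

/-- One interpolation per generator suffices. The map `f i` lengthens the arcs labelled `(i, false)`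
and shortens the complementary intervals, which it maps onto arcs labelled `(i, true)` that its
inverse lengthens. -/
theorem Coding.exists_analytic [Nontrivial ι] (h : Coding f Lab) (hl : Lengthening f Lab) :
    ∃ f' : ι → CircleDeg1Liftˣ,
      (∀ i, AnalyticOnNhd ℝ (fun x => f' i x) univ ∧ AnalyticOnNhd ℝ (fun x => (f' i)⁻¹ x) univ) ∧
      AgreeOnBd f f' Lab ∧ Expanding f' Lab := by
  have key : ∀ i, ∃ F' : CircleDeg1Liftˣ, AnalyticOnNhd ℝ (fun x => F' x) univ ∧
      AnalyticOnNhd ℝ (fun x => F'⁻¹ x) univ ∧ (∀ d ∈ bd Lab (i, false), F' d = f i d) ∧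
      (∀ a b, Consecutive (bd Lab (i, false)) a b → Lab a ≠ (i, false) →
        StrictMonoOn (fun x => F' x - x) (Icc a b)) ∧
      (∀ a b, Consecutive (bd Lab (i, false)) a b → ¬ Lab a ≠ (i, false) →
        StrictAntiOn (fun x => F' x - x) (Icc a b)) := by
    intro i
    refine exists_analytic_unit (f i) (h.add_int_mem_bd _) (h.finite_bd _) (h.bd_nonempty _)
      -- Arcs are left-open, so `Lab a` belongs to the interval ending at `a`. As labels alternate
      -- along the boundary, `up a` says that the interval following `a` is labelled `(i, false)`.
      (fun a ha => h.exists_mem_bd_Ioo ha) (up := fun a => Lab a ≠ (i, false))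
      (fun n x => by rw [h.add_int]) (fun a b hab ha => ?_) (fun a b hab ha => ?_)
    · have hb : Lab b = (i, false) := (hab.lab_right_eq_iff h).2 ha
      have h1 := hl a b (hab.isArc h hb)
      rw [hb] at h1
      exact h1
    · have h1 : Consecutive (bd Lab (i, true)) (f i a) (f i b) := Consecutive.letter (s := (i, true)) h hab
      have hb : Lab (f i b) = (i, true) := (h.act (i, true) b).2 fun hb =>
        ha ((hab.lab_right_eq_iff h).1 hb)
      have h2 := hl _ _ (h1.isArc h hb)
      rw [hb] at h2
      have h3 : ∀ x, letter f (sbar (i, true)) (f i x) = x := letter_sbar_apply f (i, true)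
      rw [h3, h3] at h2
      exact h2
  choose f' hfa hfa' hfe hfu hfd using key
  have hagree : AgreeOnBd f f' Lab := by
    rintro ⟨i, _ | _⟩ d hd
    · have h1 : (f i)⁻¹ d ∈ bd Lab (i, false) := (h.letter_mem_bd (i, false)).2 hd
      have h2 := hfe i _ h1
      rw [CircleDeg1Lift.units_apply_inv_apply] at h2
      exact (unit_inv_eq_iff _).2 h2.symm
    · exact hfe i d hd
  refine ⟨f', fun i => ⟨hfa i, hfa' i⟩, hagree, fun a b hab => ?_⟩
  have hc := hab.consecutive h
  obtain ⟨⟨i, c⟩, hs⟩ : ∃ s, s = Lab b := ⟨_, rfl⟩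
  rw [← hs] at hc ⊢
  cases c
  · exact hfu i a b hc ((hc.lab_right_eq_iff h).1 hs.symm)
  -- For a positive label the inverse generator must expand the arc; this is the contraction by `f'
  -- i` on its preimage, read backwards.
  · have h1 : Consecutive (bd Lab (i, false)) _ _ := Consecutive.letter (s := (i, false)) h hc
    have hb : Lab (letter f (i, false) b) ≠ (i, false) := fun h2 =>
      (h.act (i, false) b).1 h2 hs.symm
    have ha : ¬ Lab (letter f (i, false) a) ≠ (i, false) := fun h2 =>
      hb ((h1.lab_right_eq_iff h).2 h2)
    have h2 := hfd i _ _ h1 ha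
    rw [← hagree (i, false) a hc.left_mem, ← hagree (i, false) b hc.right_mem] at h2
    intro x hx y hy hxy
    have h3 := h2 (a := letter f' (i, false) x) (b := letter f' (i, false) y)
      ⟨(unit_le_iff _).2 hx.1, (unit_le_iff _).2 hx.2⟩
      ⟨(unit_le_iff _).2 hy.1, (unit_le_iff _).2 hy.2⟩ ((unit_lt_iff _).2 hxy)
    have h4 : ∀ x, f' i (letter f' (i, false) x) = x := letter_apply_sbar f' (i, true)
    simp only [h4] at h3
    change letter f' (i, false) x - x < letter f' (i, false) y - y
    linarith

/-- Agreement at the boundary points means that `f'` and `f` map each interval between consecutive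
ones to the same interval, on which the label condition is constant. -/
theorem AgreeOnBd.coding [Nontrivial ι] (hf' : AgreeOnBd f f' Lab) (h : Coding f Lab) :
    Coding f' Lab where
  add_one := h.add_one
  left := h.left
  right := h.right
  act s x := by
    obtain ⟨a, b, hab, hx⟩ := exists_consecutive_Ioc (h.add_int_mem_bd (sbar s))
      (h.finite_bd (sbar s)) (h.bd_nonempty (sbar s)) x
    have h1 : letter f' s x ∈ Ioc (letter f s a) (letter f s b) := by
      rw [← hf' s a hab.left_mem, ← hf' s b hab.right_mem]
      exact ⟨(unit_lt_iff _).2 hx.1, (unit_le_iff _).2 hx.2⟩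
    rw [(Consecutive.letter h hab).lab_eq_iff h h1, h.act, ne_eq, ne_eq, hab.lab_eq_iff h hx]

end Realization

/-! ### Semi-conjugacy of two actions with the same coding -/

section Semiconjugacy

variable {f f' : ι → CircleDeg1Liftˣ} {Lab : ℝ → ι × Bool}

theorem AgreeOnBd.letter_mem_arc (hf' : AgreeOnBd f f' Lab) (h : Coding f Lab) {s : ι × Bool}
    {c d x y : ℝ} (hcd : Consecutive (bd Lab (sbar s)) c d) (hd : Lab d ≠ sbar s)
    (hx : x ∈ Ioo c d) (hy : y ∈ Ioo c d) :
    ∃ a b, IsArc Lab a b ∧ letter f s x ∈ Ioo a b ∧ letter f' s y ∈ Ioo a b ∧ Lab b = s := by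
  have hb := (h.act s d).2 hd
  refine ⟨_, _, (Consecutive.letter h hcd).isArc h hb,
    ⟨(unit_lt_iff _).2 hx.1, (unit_lt_iff _).2 hx.2⟩, ?_, hb⟩
  rw [← hf' s c hcd.left_mem, ← hf' s d hcd.right_mem]
  exact ⟨(unit_lt_iff _).2 hy.1, (unit_lt_iff _).2 hy.2⟩

/-- The two images of a jump coincide as long as they are boundary points for the next letter.
Afterwards they share an open arc, and keep sharing one: by reducedness the next letter is never
inverse to its label, so the arc lies in an interval sent by both actions into one arc. -/
theorem AgreeOnBd.lift_mk [Nontrivial ι] (hf' : AgreeOnBd f f' Lab) (h : Coding f Lab) {q : ℝ}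
    (hq : q ∈ jumps Lab) (L : List (ι × Bool)) (hL : FreeGroup.IsReduced L) :
    (FreeGroup.lift f' (FreeGroup.mk L) q = FreeGroup.lift f (FreeGroup.mk L) q ∧
      FreeGroup.lift f (FreeGroup.mk L) q ∈ jumps Lab) ∨
    ∃ a b, IsArc Lab a b ∧ FreeGroup.lift f (FreeGroup.mk L) q ∈ Ioo a b ∧
      FreeGroup.lift f' (FreeGroup.mk L) q ∈ Ioo a b ∧ ∀ s ∈ L.head?, Lab b = s := by
  induction L with
  | nil =>
    left
    rw [lift_mk_nil_apply, lift_mk_nil_apply]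
    exact ⟨rfl, hq⟩
  | cons s L ih =>
    rw [lift_mk_cons_apply, lift_mk_cons_apply]
    have hcons := exists_consecutive_Ioc (h.add_int_mem_bd (sbar s)) (h.finite_bd (sbar s))
      (h.bd_nonempty (sbar s))
    rcases ih (reduced_tail hL) with ⟨h1, h2⟩ | ⟨a, b, hab, h1, h2, h3⟩
    · rw [h1]
      set x := FreeGroup.lift f (FreeGroup.mk L) q
      by_cases hx : (x : ℝ) ∈ bd Lab (sbar s)
      · exact Or.inl ⟨hf' s x hx, bd_subset_jumps s ((h.letter_mem_bd s).2 hx)⟩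
      · right
        obtain ⟨c, d, hcd, hxcd⟩ := hcons x
        have hxd : x ∈ Ioo c d :=
          ⟨hxcd.1, lt_of_le_of_ne hxcd.2 fun heq => hx (heq ▸ hcd.right_mem)⟩
        have hd : Lab d ≠ sbar s := by
          rw [ne_eq, ← hcd.lab_eq_iff h hxcd]
          intro h3
          exact hx (h3 ▸ right_bd h2)
        obtain ⟨a, b, hab, h3, h4, h5⟩ := hf'.letter_mem_arc h hcd hd hxd hxd
        exact ⟨a, b, hab, h3, h4, by simpa using h5⟩
    · right
      obtain ⟨c, d, hcd, hbcd⟩ := hcons b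
      have hb : Lab b ≠ sbar s := by
        -- For the empty word the image is `q`, a jump, which cannot be interior to an arc.
        cases L with
        | nil =>
          rw [lift_mk_nil_apply] at h1
          exact absurd hq (hab.notMem q h1)
        | cons t L =>
          rw [h3 t (by simp)]
          intro h4
          exact (reduced_cons_cons.1 hL).1 (eq_sbar_comm.1 h4)
      have hd : Lab d ≠ sbar s := by
        rwa [ne_eq, ← hcd.lab_eq_iff h hbcd]
      have hca : c ≤ a := by
        by_contra! hac
        exact hab.notMem c ⟨hac, hbcd.1⟩ (bd_subset_jumps _ hcd.left_mem)
      obtain ⟨a', b', hab', h4, h5, h6⟩ := hf'.letter_mem_arc h hcd hd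
        (Ioo_subset_Ioo hca hbcd.2 h1) (Ioo_subset_Ioo hca hbcd.2 h2)
      exact ⟨a', b', hab', h4, h5, by simpa using h6⟩

theorem AgreeOnBd.lift_le [Nontrivial ι] (hf' : AgreeOnBd f f' Lab) (h : Coding f Lab) {q r : ℝ}
    (hq : q ∈ jumps Lab) (hr : r ∈ jumps Lab) {γ : FreeGroup ι}
    (hle : FreeGroup.lift f γ q ≤ r) : FreeGroup.lift f' γ q ≤ r := by
  obtain ⟨L, hL, rfl⟩ := exists_reduced γ
  rcases hf'.lift_mk h hq L hL with ⟨h1, -⟩ | ⟨a, b, hab, h1, h2, -⟩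
  · rwa [h1]
  · refine h2.2.le.trans ?_
    by_contra! hrb
    exact hab.notMem r ⟨h1.1.trans_le hle, hrb⟩ hr

/-- The images of the jumps under the action `f'` whose counterparts under `f` are at most `x`. -/
def lowerOrbit (f f' : ι → CircleDeg1Liftˣ) (Lab : ℝ → ι × Bool) (x : ℝ) : Set ℝ :=
  {y | ∃ (γ : FreeGroup ι) (q : ℝ), q ∈ jumps Lab ∧ FreeGroup.lift f γ q ≤ x ∧
    y = FreeGroup.lift f' γ q}

theorem lowerOrbit_mono {x y : ℝ} (hxy : x ≤ y) : lowerOrbit f f' Lab x ⊆ lowerOrbit f f' Lab y :=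
  fun _ ⟨γ, q, hq, h1, h2⟩ => ⟨γ, q, hq, h1.trans hxy, h2⟩

theorem lowerOrbit_lift (γ : FreeGroup ι) (x : ℝ) :
    lowerOrbit f f' Lab (FreeGroup.lift f γ x) =
      FreeGroup.lift f' γ '' lowerOrbit f f' Lab x := by
  ext y
  constructor
  · rintro ⟨δ, q, hq, h1, rfl⟩
    refine ⟨_, ⟨γ⁻¹ * δ, q, hq, ?_, rfl⟩, ?_⟩
    · rw [map_mul, map_inv]
      exact (unit_inv_le_iff _).2 h1
    · rw [map_mul, map_inv]
      exact CircleDeg1Lift.units_apply_inv_apply _ _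
  · rintro ⟨_, ⟨δ, q, hq, h1, rfl⟩, rfl⟩
    refine ⟨γ * δ, q, hq, ?_, ?_⟩
    · rw [map_mul]
      exact (unit_le_iff _).2 h1
    · rw [map_mul]
      rfl

theorem Coding.lowerOrbit_add_one (h : Coding f Lab) (x : ℝ) :
    lowerOrbit f f' Lab (x + 1) = (fun y => y + 1) '' lowerOrbit f f' Lab x := by
  ext y
  constructor
  · rintro ⟨δ, q, hq, h1, rfl⟩
    have hq1 : q - 1 + 1 = q := sub_add_cancel q 1
    refine ⟨_, ⟨δ, q - 1, ?_, ?_, rfl⟩, ?_⟩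
    · simpa [sub_eq_add_neg] using (h.add_int_mem_jumps (-1)).2 hq
    · rw [← hq1, CircleDeg1Lift.map_add_one] at h1
      linarith
    · dsimp only
      rw [← CircleDeg1Lift.map_add_one, hq1]
  · rintro ⟨_, ⟨δ, q, hq, h1, rfl⟩, rfl⟩
    refine ⟨δ, q + 1, ?_, ?_, ?_⟩
    · simpa using (h.add_int_mem_jumps 1).2 hq
    · rw [CircleDeg1Lift.map_add_one]
      linarith
    · rw [CircleDeg1Lift.map_add_one]

/-- The map is `x ↦ sSup (lowerOrbit f f' Lab x)`. By `AgreeOnBd.lift_le` it fixes the jumps, and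
jumps beyond `x` give upper bounds. It is equivariant because lower orbits are. -/
theorem AgreeOnBd.exists_semiconj [Nontrivial ι] (hf' : AgreeOnBd f f' Lab) (h : Coding f Lab) :
    ∃ k : CircleDeg1Lift, (∀ q ∈ jumps Lab, k q = q) ∧
      ∀ (γ : FreeGroup ι) (x : ℝ), k (FreeGroup.lift f γ x) = FreeGroup.lift f' γ (k x) := by
  have hmem : ∀ q ∈ jumps Lab, q ∈ lowerOrbit f f' Lab q := fun q hq =>
    ⟨1, q, hq, by simp, by simp⟩
  have hub : ∀ q ∈ jumps Lab, ∀ y ∈ lowerOrbit f f' Lab q, y ≤ q := by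
    rintro q hq _ ⟨γ, p, hp, h1, rfl⟩
    exact hf'.lift_le h hp hq h1
  have hbdd : ∀ x, BddAbove (lowerOrbit f f' Lab x) := by
    intro x
    obtain ⟨b, hb, hxb, -⟩ := h.exists_next x
    exact ⟨b, fun y hy => hub b hb y (lowerOrbit_mono hxb.le hy)⟩
  have hne : ∀ x, (lowerOrbit f f' Lab x).Nonempty := by
    intro x
    obtain ⟨q, hq⟩ := h.jumps_nonempty
    obtain ⟨n, -, hn⟩ := exists_add_int_mem_Ico (x - 1) q
    refine ⟨q + n, lowerOrbit_mono (by linarith) (hmem _ ((h.add_int_mem_jumps n).2 hq))⟩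
  refine ⟨⟨⟨fun x => sSup (lowerOrbit f f' Lab x), fun x y hxy =>
    csSup_le_csSup (hbdd y) (hne x) (lowerOrbit_mono hxy)⟩, fun x => ?_⟩, fun q hq => ?_,
    fun γ x => ?_⟩
  · change sSup (lowerOrbit f f' Lab (x + 1)) = sSup (lowerOrbit f f' Lab x) + 1
    rw [h.lowerOrbit_add_one]
    exact ((OrderIso.addRight (1 : ℝ)).map_csSup' (hne x) (hbdd x)).symm
  · exact IsGreatest.csSup_eq ⟨hmem q hq, hub q hq⟩
  · change sSup (lowerOrbit f f' Lab (FreeGroup.lift f γ x)) =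
      FreeGroup.lift f' γ (sSup (lowerOrbit f f' Lab x))
    rw [lowerOrbit_lift]
    exact ((CircleDeg1Lift.toOrderIso (FreeGroup.lift f' γ)).map_csSup' (hne x) (hbdd x)).symm

end Semiconjugacy

/-! ### Minimality and faithfulness of the analytic action -/

section Minimality

variable {f f' : ι → CircleDeg1Liftˣ} {Lab : ℝ → ι × Bool} {K : Set ℝ}

/-- A point `y₀` of `K` need not be a value of `k`, so it is replaced by the place where `k` passes
it, the supremum of `S`. An element of the original action carries this place into the arc; since
`k` fixes the ends, the corresponding new element carries `y₀` into the closed arc. -/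
theorem meets_arc {k : CircleDeg1Lift} (hk : ∀ q ∈ jumps Lab, k q = q)
    (hkf : ∀ (γ : FreeGroup ι) (x : ℝ), k (FreeGroup.lift f γ x) = FreeGroup.lift f' γ (k x))
    (hacc : OrbitsAccumulate f Lab) (hKi : Invariant f' K) (hKne : K.Nonempty) {a b : ℝ}
    (hab : IsArc Lab a b) : ∃ y ∈ K, a ≤ y ∧ y ≤ b := by
  obtain ⟨y₀, hy₀⟩ := hKne
  set S : Set ℝ := {x | k x ≤ y₀}
  have hSne : S.Nonempty := by
    obtain ⟨x, hx⟩ := (k.tendsto_atBot.eventually_le_atBot y₀).exists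
    exact ⟨x, hx⟩
  have hSb : BddAbove S := by
    obtain ⟨x, hx⟩ := (k.tendsto_atTop.eventually_gt_atTop y₀).exists
    refine ⟨x, fun z hz => ?_⟩
    by_contra! hxz
    exact absurd (k.mono hxz.le) (not_le.2 (lt_of_le_of_lt hz hx))
  obtain ⟨x', ⟨γ, n, rfl⟩, h1, h2⟩ := hacc (sSup S) a hab.left_mem b hab.lt
  have hmem : FreeGroup.lift f' γ y₀ + n ∈ K := hKi.add_int_mem n _ (hKi.lift_mem γ hy₀)
  have hinv : ∀ x, k ((FreeGroup.lift f γ)⁻¹ (x - n)) = (FreeGroup.lift f' γ)⁻¹ (k x - n) := by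
    intro x
    have := hkf γ⁻¹ (x - n)
    rw [map_inv, map_inv, CircleDeg1Lift.map_sub_int k] at this
    exact this
  refine ⟨_, hmem, ?_, ?_⟩
  · have h3 : (FreeGroup.lift f γ)⁻¹ (a - n) < sSup S := by
      rw [unit_inv_lt_iff]
      linarith
    obtain ⟨x, hxS, hx⟩ := exists_lt_of_lt_csSup hSne h3
    have h4 := (k.mono hx.le).trans hxS
    rw [hinv, hk a hab.left_mem, unit_inv_le_iff] at h4
    linarith
  · have h3 : sSup S < (FreeGroup.lift f γ)⁻¹ (b - n) := by
      rw [lt_unit_inv_iff]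
      linarith
    have h4 : y₀ < k ((FreeGroup.lift f γ)⁻¹ (b - n)) := by
      by_contra! h5
      exact absurd (le_csSup hSb h5) (not_le.2 h3)
    rw [hinv, hk b hab.right_mem, lt_unit_inv_iff] at h4
    linarith

theorem Expanding.jumps_subset [Nontrivial ι] (he : Expanding f' Lab) (h : Coding f' Lab)
    (hKc : IsClosed K) (hKi : Invariant f' K)
    (hK : ∀ a b, IsArc Lab a b → ∃ y ∈ K, a ≤ y ∧ y ≤ b) : jumps Lab ⊆ K := by
  by_contra hcon
  rw [not_subset] at hcon
  obtain ⟨q₀, hq₀, hq₀K⟩ := hcon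
  -- `r q` is the first point of `K` after the jump `q`. It lies within the arc starting at `q`,
  -- where expansion is available.
  have hr : ∀ q, ∃ r, q ∈ jumps Lab → q ∉ K →
      IsLeast (K ∩ Ici q) r ∧ q < r ∧ ∀ b, IsArc Lab q b → r ≤ b := by
    intro q
    by_cases hq : q ∈ jumps Lab ∧ q ∉ K
    · obtain ⟨b, hb⟩ := h.exists_isArc hq.1
      obtain ⟨y, hyK, hy1, hy2⟩ := hK q b hb
      have hl : IsLeast (K ∩ Ici q) (sInf (K ∩ Ici q)) :=
        (hKc.inter isClosed_Ici).isLeast_csInf ⟨y, hyK, hy1⟩ ⟨q, fun z hz => hz.2⟩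
      refine ⟨_, fun _ _ => ⟨hl, lt_of_le_of_ne hl.1.2 fun heq => hq.2 (heq ▸ hl.1.1),
        fun c hc => ?_⟩⟩
      rw [← hb.right_eq hc]
      exact (hl.2 ⟨hyK, hy1⟩).trans hy2
    · exact ⟨0, fun h1 h2 => absurd ⟨h1, h2⟩ hq⟩
  choose r hr using hr
  have hper : ∀ q (n : ℤ), q ∈ jumps Lab → q ∉ K → r (q + n) = r q + n := by
    intro q n hq hqK
    have h1 := (hr q hq hqK).1
    have h2 := (hr (q + n) ((h.add_int_mem_jumps n).2 hq)
      fun h3 => hqK ((hKi.add_int_mem_iff n).1 h3)).1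
    refine le_antisymm (h2.2 ⟨hKi.add_int_mem n _ h1.1.1, ?_⟩) ?_
    · have : q ≤ r q := h1.1.2
      simpa using this
    · have h4 : r (q + n) - n ∈ K := by
        simpa [sub_eq_add_neg] using hKi.add_int_mem (-n) _ h2.1.1
      have h5 : q ≤ r (q + n) - n := by
        have : q + n ≤ r (q + n) := h2.1.2
        linarith
      linarith [h1.2 ⟨h4, h5⟩]
  obtain ⟨n₀, hn₀⟩ := exists_add_int_mem_Ico 0 q₀
  rw [zero_add] at hn₀
  obtain ⟨q, ⟨⟨hqJ, -⟩, hqK⟩, hmax⟩ := exists_max_image {q | q ∈ jumps Lab ∩ Ico 0 1 ∧ q ∉ K}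
    (fun q => r q - q)
    ((h.finite_jumps 0 1).subset fun q hq => ⟨hq.1.1, Ico_subset_Icc_self hq.1.2⟩)
    ⟨q₀ + n₀, ⟨(h.add_int_mem_jumps n₀).2 hq₀, hn₀⟩,
      fun h3 => hq₀K ((hKi.add_int_mem_iff n₀).1 h3)⟩
  obtain ⟨b, hb⟩ := h.exists_isArc hqJ
  obtain ⟨hl, hlt, hle⟩ := hr q hqJ hqK
  set g := letter f' (sbar (Lab b)) with hg
  have hgJ : g q ∈ jumps Lab := by
    refine bd_subset_jumps (sbar (Lab b)) ((h.letter_mem_bd _).2 ?_)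
    rw [sbar_sbar]
    exact hb.left_bd h
  have hgK : g q ∉ K := fun h1 => hqK ((hKi.letter_mem_iff _).1 h1)
  have hexp : r q - q < g (r q) - g q := by
    have h1 := he q b hb ⟨le_rfl, hb.lt.le⟩ ⟨hlt.le, hle b hb⟩ hlt
    change g q - q < g (r q) - r q at h1
    linarith
  -- `K` is invariant, so `g` maps the gap after `q` into the gap after the jump `g q`. With `hexp`
  -- this contradicts the maximal choice of `q`.
  have hgr : g (r q) ≤ r (g q) := by
    have h1 := (hr (g q) hgJ hgK).1.1
    have h2 : letter f' (Lab b) (r (g q)) ∈ K := hKi.letter_mem _ _ h1.1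
    have h3 : g (letter f' (Lab b) (r (g q))) = r (g q) := letter_sbar_apply f' (Lab b) _
    rw [← h3, unit_le_iff]
    refine hl.2 ⟨h2, ?_⟩
    rw [mem_Ici, ← unit_le_iff g, h3]
    exact h1.2
  obtain ⟨n, hn⟩ := exists_add_int_mem_Ico 0 (g q)
  rw [zero_add] at hn
  have h1 := hmax (g q + n) ⟨⟨(h.add_int_mem_jumps n).2 hgJ, hn⟩,
    fun h3 => hgK ((hKi.add_int_mem_iff n).1 h3)⟩
  rw [hper _ n hgJ hgK] at h1
  linarith

theorem Expanding.eq_univ [Nontrivial ι] (he : Expanding f' Lab) (h : Coding f' Lab)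
    (hKc : IsClosed K) (hKi : Invariant f' K) (hJ : jumps Lab ⊆ K) : K = univ := by
  have hKne : K.Nonempty := h.jumps_nonempty.mono hJ
  have hper : Function.Periodic (fun x => Metric.infDist x K) 1 := by
    have hle : ∀ (n : ℤ) (x : ℝ), Metric.infDist (x + n) K ≤ Metric.infDist x K := by
      intro n x
      refine (Metric.le_infDist hKne).2 fun y hy => ?_
      refine (Metric.infDist_le_dist_of_mem (hKi.add_int_mem n y hy)).trans ?_
      rw [dist_add_right]
    intro x
    refine le_antisymm (by simpa using hle 1 x) ?_
    simpa using hle (-1) (x + 1)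
  -- `x₀` is farthest from `K`. As `K` contains the jumps, the interval of radius `δ` about it lies
  -- in one arc; the expanding letter enlarges both halves, so `g x₀` is farther still.
  obtain ⟨x₀, -, hx₀⟩ := isCompact_Icc.exists_isMaxOn (nonempty_Icc.2 (zero_le_one (α := ℝ)))
    (Metric.continuous_infDist_pt K).continuousOn
  have hmax : ∀ x, Metric.infDist x K ≤ Metric.infDist x₀ K := by
    intro x
    obtain ⟨n, hn⟩ := exists_add_int_mem_Ico 0 x
    rw [zero_add] at hn
    have h1 : Metric.infDist (x + n) K = Metric.infDist x K := by
      simpa using hper.int_mul n x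
    rw [← h1]
    exact hx₀ (Ico_subset_Icc_self hn)
  by_contra hcon
  obtain ⟨z, hz⟩ := (ne_univ_iff_exists_notMem K).1 hcon
  set δ := Metric.infDist x₀ K
  have hδ : 0 < δ := ((hKc.notMem_iff_infDist_pos hKne).1 hz).trans_le (hmax z)
  have hfar : ∀ y ∈ K, y ≤ x₀ - δ ∨ x₀ + δ ≤ y := by
    intro y hy
    have h1 : δ ≤ dist x₀ y := Metric.infDist_le_dist_of_mem hy
    rw [Real.dist_eq] at h1
    rcases le_abs.1 h1 with h2 | h2
    · left; linarith
    · right; linarith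
  obtain ⟨a, b, hab, hxab⟩ := exists_consecutive_Ioc (fun n _ => h.add_int_mem_jumps n)
    h.finite_jumps h.jumps_nonempty x₀
  have hab' : IsArc Lab a b := ⟨hab.left_mem, hab.right_mem, hab.lt, hab.notMem⟩
  have ha : a ≤ x₀ - δ := (hfar a (hJ hab.left_mem)).resolve_right (by linarith [hxab.1])
  have hb : x₀ + δ ≤ b := (hfar b (hJ hab.right_mem)).resolve_left (by linarith [hxab.2])
  set g := letter f' (sbar (Lab b)) with hg
  have hx₀' : x₀ ∈ Icc a b := ⟨hxab.1.le, hxab.2⟩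
  have h1 := he a b hab' ⟨ha, by linarith⟩ hx₀' (show x₀ - δ < x₀ by linarith)
  have h2 := he a b hab' hx₀' ⟨by linarith, hb⟩ (show x₀ < x₀ + δ by linarith)
  change g (x₀ - δ) - (x₀ - δ) < g x₀ - x₀ at h1
  change g x₀ - x₀ < g (x₀ + δ) - (x₀ + δ) at h2
  obtain ⟨y, hy, hyd⟩ := (Metric.infDist_lt_iff hKne (x := g x₀)
    (r := min (g x₀ - g (x₀ - δ)) (g (x₀ + δ) - g x₀))).1
    ((hmax (g x₀)).trans_lt (lt_min (by linarith) (by linarith)))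
  have h3 : g (letter f' (Lab b) y) = y := letter_sbar_apply f' (Lab b) y
  rw [Real.dist_eq, abs_lt, lt_min_iff, neg_lt] at hyd
  rcases hfar _ (hKi.letter_mem (Lab b) y hy) with h4 | h4
  · have h5 := (unit_le_iff g).2 h4
    rw [h3] at h5
    linarith [hyd.2.1]
  · have h5 := (unit_le_iff g).2 h4
    rw [h3] at h5
    linarith [(lt_min_iff.1 hyd.1).2]

/-- A point labelled neither by the first letter nor by the inverse of the last is moved to the
label of the first letter. The second generator guarantees that such a label `u` exists. -/
theorem Coding.injective_descend_lift [Nontrivial ι] (h : Coding f Lab) :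
    Function.Injective (descend.comp (FreeGroup.lift f)) := by
  rw [injective_iff_map_eq_one]
  intro γ hγ
  obtain ⟨L, hL, rfl⟩ := exists_reduced γ
  cases L with
  | nil => rfl
  | cons s L =>
    exfalso
    obtain ⟨r, hr⟩ : ∃ r, (s :: L).getLast? = some r := ⟨_, List.getLast?_eq_some_getLast (by simp)⟩
    obtain ⟨u, hus, hur⟩ : ∃ u, u ≠ s ∧ u ≠ sbar r := by
      obtain ⟨i, hi⟩ := exists_ne s.1
      refine ⟨(i, !(sbar r).2), fun h1 => hi (congrArg Prod.fst h1), fun h1 => ?_⟩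
      have := congrArg Prod.snd h1
      simp at this
    obtain ⟨x, hx⟩ := h.exists_lab_eq u
    have h1 := h.lab_lift s L hL (x := x) (by
      intro r' hr'
      rw [hr, Option.mem_some_iff] at hr'
      rw [hx, ← hr']
      exact hur)
    have h2 : ((FreeGroup.lift f (FreeGroup.mk (s :: L)) x : ℝ) : UnitAddCircle) = x := by
      rw [← isLift_descend]
      exact congrArg (fun e : UnitAddCircle ≃ₜ UnitAddCircle => e x) hγ
    obtain ⟨n, hn⟩ := coe_eq_coe_iff.1 h2
    rw [hn, h.add_int, hx] at h1
    exact hus h1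

end Minimality

/-! ### Central extensions and the main theorem -/

theorem descend_eq {F : CircleDeg1Liftˣ} {g : UnitAddCircle ≃ₜ UnitAddCircle} (h : IsLift F g) :
    descend F = g := by
  ext y
  obtain ⟨x, rfl⟩ := coe_surj y
  rw [h x]
  rfl

/-- The extension of an action of `G` on the line to `G × ℤ`, where the second factor acts by
translations. -/
def centralLift {G : Type} [Group G] (R : G →* CircleDeg1Liftˣ) :
    G × Multiplicative ℤ →* CircleDeg1Liftˣ where
  toFun p := R p.1 * CircleDeg1Lift.translate (Multiplicative.ofAdd ((p.2.toAdd : ℤ) : ℝ))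
  map_one' := by simp
  map_mul' p q := by
    ext x
    change R (p.1 * q.1) (CircleDeg1Lift.translate _ x) =
      R p.1 (CircleDeg1Lift.translate _ (R q.1 (CircleDeg1Lift.translate _ x)))
    simp only [translate_int_apply, map_mul, CircleDeg1Lift.map_add_int, Prod.snd_mul, toAdd_mul]
    change R p.1 (R q.1 x) + _ = _
    push_cast
    ring

theorem centralLift_apply {G : Type} [Group G] (R : G →* CircleDeg1Liftˣ)
    (p : G × Multiplicative ℤ) (x : ℝ) :
    centralLift R p x = R p.1 x + (p.2.toAdd : ℤ) := by
  change R p.1 (CircleDeg1Lift.translate _ x) = _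
  rw [translate_int_apply, CircleDeg1Lift.map_add_int]

/-- When both actions lift to the line as homomorphisms, the trivial extension `G × ℤ` serves as the
common central extension. -/
theorem semiConjugate_of_lifts {G : Type} [Group G] {ρ₁ ρ₂ : G →* (UnitAddCircle ≃ₜ UnitAddCircle)}
    {R₁ R₂ : G →* CircleDeg1Liftˣ} (h₁ : ∀ g, IsLift (R₁ g) (ρ₁ g))
    (h₂ : ∀ g, IsLift (R₂ g) (ρ₂ g)) (k : CircleDeg1Lift)
    (hk : ∀ g x, k (R₁ g x) = R₂ g (k x)) : SemiConjugate ρ₁ ρ₂ := by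
  have hlift : ∀ {R : G →* CircleDeg1Liftˣ} {ρ : G →* (UnitAddCircle ≃ₜ UnitAddCircle)},
      (∀ g, IsLift (R g) (ρ g)) → ∀ p, IsLift (centralLift R p) (ρ p.1) := by
    intro R ρ h p x
    rw [h p.1 x, centralLift_apply, coe_add_int]
  refine ⟨G × Multiplicative ℤ, inferInstance, MonoidHom.fst _ _, (1, Multiplicative.ofAdd 1),
    centralLift R₁, centralLift R₂, k, Prod.fst_surjective, ?_, ?_, ?_, ?_, hlift h₁, hlift h₂, ?_⟩
  · rw [Subgroup.mem_center_iff]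
    rintro ⟨g, n⟩
    simp [mul_comm]
  · ext ⟨g, n⟩
    rw [MonoidHom.mem_ker, Subgroup.mem_zpowers_iff]
    constructor
    · rintro rfl
      exact ⟨n.toAdd, by simp [← ofAdd_zsmul]⟩
    · rintro ⟨m, hm⟩
      have := congrArg Prod.fst hm
      simpa using this.symm
  · simp [centralLift]
  · simp [centralLift]
  · intro p x
    rw [centralLift_apply, centralLift_apply, CircleDeg1Lift.map_add_int, hk]

theorem exists_analytic_semiconj [Finite ι] [Nontrivial ι] {f : ι → CircleDeg1Liftˣ}
    {Lab : ℝ → Option (ι × Bool)} (hLab : WeakLabelling f Lab) :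
    ∃ (f' : ι → CircleDeg1Liftˣ) (k : CircleDeg1Lift),
      (∀ i, AnalyticOnNhd ℝ (fun x => f' i x) univ ∧ AnalyticOnNhd ℝ (fun x => (f' i)⁻¹ x) univ) ∧
      Function.Injective (descend.comp (FreeGroup.lift f')) ∧ (∀ x, Dense (orb f' x)) ∧
      ∀ (γ : FreeGroup ι) (x : ℝ), k (FreeGroup.lift f γ x) = FreeGroup.lift f' γ (k x) := by
  obtain ⟨_, h₁⟩ := hLab.exists_partialCoding
  obtain ⟨_, h₂, hacc₂⟩ := h₁.exists_coding
  obtain ⟨τ, hl⟩ := h₂.exists_conj_lengthening hacc₂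
  have h := h₂.conj τ
  have hacc := hacc₂.conj τ
  obtain ⟨f', hfa, hagree, hexp⟩ := h.exists_analytic hl
  have h' := hagree.coding h
  obtain ⟨k, hkJ, hk⟩ := hagree.exists_semiconj h
  -- The analytic action realizes the coding of the conjugated action, so the semi-conjugacy from
  -- the original one is preceded by `τ`.
  refine ⟨f', k * (τ : CircleDeg1Lift), hfa, h'.injective_descend_lift, fun x => ?_, fun γ x => ?_⟩
  · rw [dense_iff_closure_eq]
    have hKi := (invariant_orb f' x).closure
    exact hexp.eq_univ h' isClosed_closure hKi (hexp.jumps_subset h' isClosed_closure hKi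
      fun a b hab => meets_arc hkJ hk hacc hKi ⟨x, subset_closure (mem_orb_self f' x)⟩ hab)
  · have h1 := hk γ (τ x)
    rw [lift_conj] at h1
    change k (τ (FreeGroup.lift f γ (τ⁻¹ (τ x)))) = _ at h1
    rw [CircleDeg1Lift.units_inv_apply_apply] at h1
    exact h1

theorem descend_lift_mem_diffOmegaPlus {f' : ι → CircleDeg1Liftˣ}
    (h : ∀ i, AnalyticOnNhd ℝ (fun x => f' i x) univ ∧
      AnalyticOnNhd ℝ (fun x => (f' i)⁻¹ x) univ) (γ : FreeGroup ι) :
    descend (FreeGroup.lift f' γ) ∈ DiffOmegaPlus := by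
  have hgen : ∀ i, descend (f' i) ∈ DiffOmegaPlus := fun i => ⟨f' i, isLift_descend _, h i⟩
  induction γ using FreeGroup.induction_on with
  | C1 => simp [DiffOmegaPlus.one_mem]
  | of i => simpa using hgen i
  | inv_of i _ => simpa using hgen i
  | mul x y hx hy =>
    rw [map_mul, map_mul]
    exact DiffOmegaPlus.mul_mem hx hy

end PingPong

open PingPong in
theorem mainTheorem8 {ι κ : Type} [Finite ι] [Nontrivial ι] [Finite κ]
    (G : Subgroup (UnitAddCircle ≃ₜ UnitAddCircle)) (hG : G ≤ HomeoPlus)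
    (b : FreeGroupBasis ι G)
    (V : ι × Bool → Set UnitAddCircle) (U : κ → Set UnitAddCircle)
    (hΘ : IsProperPingPongPartition b V U) :
    ∃ (G' : Subgroup (UnitAddCircle ≃ₜ UnitAddCircle)) (e : G ≃* G'),
      G' ≤ DiffOmegaPlus ∧
      ActsMinimally G' ∧
      SemiConjugate G.subtype (G'.subtype.comp e.toMonoidHom) := by
  -- Arbitrary lifts of the basis elements extend to a lift of the whole action, because the group
  -- is free.
  choose f hf using fun i => hG (b i).2
  obtain ⟨Lab, hLab⟩ := exists_weakLabelling hΘ.toIsPingPongPartition hf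
  obtain ⟨f', k, hfa, hinj, hdense, hk⟩ := exists_analytic_semiconj hLab
  let ρ : G →* (UnitAddCircle ≃ₜ UnitAddCircle) :=
    (descend.comp (FreeGroup.lift f')).comp b.repr.toMonoidHom
  have hρ : Function.Injective ρ := hinj.comp b.repr.injective
  have hlift : descend.comp (FreeGroup.lift f) = G.subtype.comp b.repr.symm.toMonoidHom := by
    ext1 i
    simp only [MonoidHom.comp_apply, FreeGroup.lift_apply_of]
    exact descend_eq (hf i)
  refine ⟨ρ.range, MonoidHom.ofInjective hρ, ?_, ?_, ?_⟩
  · rintro _ ⟨g, rfl⟩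
    exact descend_lift_mem_diffOmegaPlus hfa _
  · intro y
    obtain ⟨x, rfl⟩ := coe_surj y
    refine (DenseRange.dense_image (Function.Surjective.denseRange coe_surj) continuous_coe (hdense x)).mono ?_
    rintro _ ⟨_, ⟨γ, n, rfl⟩, rfl⟩
    refine ⟨_, ⟨b.repr.symm γ, rfl⟩, ?_⟩
    have h1 : ρ (b.repr.symm γ) = descend (FreeGroup.lift f' γ) := by simp [ρ]
    rw [h1, isLift_descend, coe_add_int]
  · refine semiConjugate_of_lifts (R₁ := (FreeGroup.lift f).comp b.repr.toMonoidHom)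
      (R₂ := (FreeGroup.lift f').comp b.repr.toMonoidHom) (fun g => ?_) (fun g => ?_) k
      fun g x => hk _ x
    · have h1 := DFunLike.congr_fun hlift (b.repr g)
      have h2 : (G.subtype.comp b.repr.symm.toMonoidHom) (b.repr g) = G.subtype g := by simp
      rw [← h2, ← h1]
      exact isLift_descend _
    · exact isLift_descend _
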